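/- Let \((x,y)\) be a square-integrable random vector in \(\mathbb{R}^d\times\mathbb{R}\), let \(L(\theta)=\frac12E((y-x^T\theta)^2)\) for \(\theta\in\mathbb{R}^d\), and assume that \(H=E(xx^T)\) is positive-definite, with smallest eigenvalue \(\lambda_{\min}\). Let \(\theta^*\) be the solution of \(H\theta^*=E(yx)\). Assume (Assumption 1) that \(\sigma,R>0\) are such that \(E((y-x^T\theta^*)^2xx^T)\preccurlyeq\sigma^2H\) and \(E(\|x\|^2xx^T)\preccurlyeq R^2H\) (both expectations being finite), where \(A\preccurlyeq B\) means that \(B-A\) is positive semi-definite. Let \(0<\gamma<2/R^2\), \(0<\alpha\le1/2\), \(\delta>1\), \(q\in(0,1]\) and \(\theta_0\in\mathbb{R}^d\), let \(k\ge2\) be an integer, and let \(s(k)\) be \(\alpha k\), rounded up or down to an integer if it is not one. Let \((x_t,y_t)\), \(t\in\mathbb{Z}\), be independent copies of \((x,y)\). For \(m\in\mathbb{Z}\), set \(\theta_{m:m}=\theta_0\) and \(\theta_{m:t+1}=\theta_{m:t}-\gamma(x_t^T\theta_{m:t}-y_t)x_t\) for \(t\ge m\), and let \[\bar\theta_k=\frac1{k-s(k)}\sum_{t=s(k)}^{k-1}\theta_{0:t}.\]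 Let \(\tau(k,0)\) be uniformly distributed on \(\{s(k),\dots,k-1\}\) and, for \(l\ge1\), let \(\tau(k,l)\) be uniformly distributed on \(\{k(2^l-1),\dots,k(2^{l+1}-1)-1\}\), where the variables \(\tau(k,l)\), \(l\ge0\), and \((x_t,y_t)\), \(t\in\mathbb{Z}\), are independent. Set \(f_{k,l}=\theta_{-\tau(k,l):0}\) and \[p_l=\frac1{2^l(l+1)^\delta}-\frac1{2^{l+1}(l+2)^\delta},\qquad Z_k=\frac{f_{k,N+1}-f_{k,N}}{p_N},\] where \(N\) is independent of all the \((x_t,y_t)\) and \(\tau(k,l)\) jointly, with \(\Pr(N=l)=p_l\) for \(l\ge0\). Let \[\hat f_k=\bar\theta_k+q^{-1}QZ'_k,\] where \(Q\) is a Bernoulli variable independent of \(\bar\theta_k\) with \(\Pr(Q=1)=q\), and \(Z'_k\) is a copy of \(Z_k\), sampled independently of \((\bar\theta_k,Q)\). Running time is measured by the number of simulated copies of \((x,y)\), and \(Z'_k\) is sampled only when \(Q=1\). Let \(T_k\) and \(\hat T_k\) be the expected times to sample \(Z_k\) and \(\hat f_k\), and set \[c=\frac{\sigma^2d}{(2-\gamma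 R^2)^2}+\frac{\|\theta_0-\theta^*\|^2}{\gamma(2-\gamma R^2)},\qquad \xi=\gamma(2-\gamma R^2)\lambda_{\min}.\] Then \(T_k\le 4\delta k/(\delta-1)\) and \(\hat T_k\le k+qT_k\). Furthermore, \(\hat f_k\) is square-integrable, \(E(\hat f_k)=\theta^*\), and \[E(L(\hat f_k))-L(\theta^*)\le\frac1{2qk}\left(\frac{27c}{\alpha}+6c\left(4\ln\left(\frac{4\delta+8}{\alpha\xi}\right)\right)^{\delta+1}\right).\] -/

import Mathlib

open MeasureTheory ProbabilityTheory
open scoped ENNReal Matrix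

namespace LeastSquares

/-- Column vectors of dimension `d`, with the Euclidean norm. -/
abbrev Vec (d : ℕ) : Type := EuclideanSpace ℝ (Fin d)

noncomputable section

/-! ### The regression problem

`P` is the law of the random pair `(x, y)`; a point `z` of `Vec d × ℝ` is a value `(x, y)`. -/

/-- `H = E(x xᵀ)`. -/
def hessian {d : ℕ} (P : Measure (Vec d × ℝ)) : Matrix (Fin d) (Fin d) ℝ :=
  Matrix.of fun i j => ∫ z, z.1 i * z.1 j ∂P

/-- `E(w(x, y) x xᵀ)` for a scalar weight `w`. -/
def weightedMoment {d : ℕ} (P : Measure (Vec d × ℝ)) (w : Vec d × ℝ → ℝ) :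
    Matrix (Fin d) (Fin d) ℝ :=
  Matrix.of fun i j => ∫ z, w z * (z.1 i * z.1 j) ∂P

/-- The expectation `E(w(x, y) x xᵀ)` exists. -/
def HasWeightedMoment {d : ℕ} (P : Measure (Vec d × ℝ)) (w : Vec d × ℝ → ℝ) : Prop :=
  ∀ i j : Fin d, Integrable (fun z => w z * (z.1 i * z.1 j)) P

/-- `L(θ) = E((y - xᵀ θ)²) / 2`. -/
def risk {d : ℕ} (P : Measure (Vec d × ℝ)) (θ : Vec d) : ℝ :=
  (1 / 2) * ∫ z, (z.2 - inner ℝ z.1 θ) ^ 2 ∂P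

/-- The normal equation `H θ = E(y x)`. -/
def NormalEq {d : ℕ} (P : Measure (Vec d × ℝ)) (θ : Vec d) : Prop :=
  hessian P *ᵥ θ.ofLp = fun i => ∫ z, z.2 * z.1 i ∂P

/-- `σ, R > 0`, `E((y - xᵀθ*)² x xᵀ) ≼ σ² H` and `E(‖x‖² x xᵀ) ≼ R² H`, where `A ≼ B` means that
`B - A` is positive semi-definite; both expectations are required to exist. -/
structure Assumption1 {d : ℕ} (P : Measure (Vec d × ℝ)) (θs : Vec d) (σ R : ℝ) : Prop where
  sigma_pos : 0 < σ
  R_pos : 0 < R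
  noise_exists : HasWeightedMoment P fun z => (z.2 - inner ℝ z.1 θs) ^ 2
  noise_le :
    (σ ^ 2 • hessian P - weightedMoment P fun z => (z.2 - inner ℝ z.1 θs) ^ 2).PosSemidef
  fourth_exists : HasWeightedMoment P fun z => ‖z.1‖ ^ 2
  fourth_le : (R ^ 2 • hessian P - weightedMoment P fun z => ‖z.1‖ ^ 2).PosSemidef

/-- The smallest eigenvalue of a symmetric matrix. -/
def lambdaMin {d : ℕ} (A : Matrix (Fin d) (Fin d) ℝ) : ℝ := sInf (spectrum ℝ A)

/-- `c = σ² d / (2 - γR²)² + ‖θ₀ - θ*‖² / (γ (2 - γR²))`. -/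
def cConst {d : ℕ} (γ σ R : ℝ) (θ₀ θs : Vec d) : ℝ :=
  σ ^ 2 * d / (2 - γ * R ^ 2) ^ 2 + ‖θ₀ - θs‖ ^ 2 / (γ * (2 - γ * R ^ 2))

/-- `ξ = γ (2 - γR²) λ_min`. -/
def xiConst {d : ℕ} (P : Measure (Vec d × ℝ)) (γ R : ℝ) : ℝ :=
  γ * (2 - γ * R ^ 2) * lambdaMin (hessian P)

/-! ### The estimators

`D t` is the value of `(x_t, y_t)`, for `t ∈ ℤ`. -/

/-- One step of stochastic gradient descent: `θ - γ (xᵀθ - y) x`. -/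
def sgdStep {d : ℕ} (γ : ℝ) (z : Vec d × ℝ) (θ : Vec d) : Vec d :=
  θ - (γ * (inner ℝ z.1 θ - z.2)) • z.1

/-- `chain γ θ₀ D m n` is `θ_{m:m+n}`: the chain started from `θ₀` at time `m` and driven by
`D m, D (m+1), …, D (m+n-1)`. -/
def chain {d : ℕ} (γ : ℝ) (θ₀ : Vec d) (D : ℤ → Vec d × ℝ) (m : ℤ) : ℕ → Vec d
  | 0 => θ₀
  | n + 1 => sgdStep γ (D (m + n)) (chain γ θ₀ D m n)

/-- The time average of `θ_t = θ_{0:t}` over `s ≤ t ≤ k - 1`. -/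
def thetaBar {d : ℕ} (γ : ℝ) (θ₀ : Vec d) (s k : ℕ) (D : ℤ → Vec d × ℝ) : Vec d :=
  ((k : ℝ) - s)⁻¹ • ∑ t ∈ Finset.Ico s k, chain γ θ₀ D 0 t

/-- The finite set on which `τ(k,l)` is uniformly distributed. -/
def tauRange (s k : ℕ) : ℕ → Finset ℕ
  | 0 => Finset.Ico s k
  | l + 1 => Finset.Ico (k * (2 ^ (l + 1) - 1)) (k * (2 ^ (l + 2) - 1))

/-- `f_{k,l} = θ_{-τ(k,l):0}`, where `τ l` is the value of `τ(k,l)`. -/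
def level {d : ℕ} (γ : ℝ) (θ₀ : Vec d) (D : ℤ → Vec d × ℝ) (τ : ℕ → ℕ) (l : ℕ) : Vec d :=
  chain γ θ₀ D (-(τ l : ℤ)) (τ l)

/-- `p_l = 1 / (2^l (l+1)^δ) - 1 / (2^(l+1) (l+2)^δ)`. -/
def levelProb (δ : ℝ) (l : ℕ) : ℝ :=
  1 / (2 ^ l * ((l : ℝ) + 1) ^ δ) - 1 / (2 ^ (l + 1) * ((l : ℝ) + 2) ^ δ)

/-- `Z_k = (f_{k,N+1} - f_{k,N}) / p_N`. -/
def zEst {d : ℕ} (γ δ : ℝ) (θ₀ : Vec d) (D : ℤ → Vec d × ℝ) (τ : ℕ → ℕ) (N : ℕ) : Vec d :=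
  (levelProb δ N)⁻¹ • (level γ θ₀ D τ (N + 1) - level γ θ₀ D τ N)

/-- `θ̄_k + q⁻¹ Q Z'_k`, with the Bernoulli variable `Q` coded by a Boolean. -/
def fHat {d : ℕ} (q : ℝ) (bar : Vec d) (Q : Bool) (Z' : Vec d) : Vec d :=
  bar + (q⁻¹ * (Q.toNat : ℝ)) • Z'

/-! ### Running times

Running time is measured by the number of simulated copies of `(x, y)`. A sampling program
returns its output together with the set of indices `t` for which it has simulated `(x_t, y_t)`;
a copy that is used several times is simulated once. -/

/-- The output of a sampling program, and the indices of the copies that it has simulated. -/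
structure Traced (α : Type) where
  val : α
  reads : Finset ℤ

instance : Monad Traced where
  pure a := ⟨a, ∅⟩
  bind u f := ⟨(f u.val).val, u.reads ∪ (f u.val).reads⟩

/-- Simulate (or look up) `(x_t, y_t)`. -/
def sample {d : ℕ} (D : ℤ → Vec d × ℝ) (t : ℤ) : Traced (Vec d × ℝ) := ⟨D t, {t}⟩

/-- The number of copies simulated by a program. -/
def Traced.time {α : Type} (u : Traced α) : ℕ := u.reads.card

/-- Program for `θ_{m:m+n}`. -/
def chainProg {d : ℕ} (γ : ℝ) (θ₀ : Vec d) (D : ℤ → Vec d × ℝ) (m : ℤ) : ℕ → Traced (Vec d)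
  | 0 => pure θ₀
  | n + 1 => do
    let θ ← chainProg γ θ₀ D m n
    let z ← sample D (m + n)
    pure (sgdStep γ z θ)

/-- Program for `θ_s + ⋯ + θ_{s+n-1}`. -/
def sumProg {d : ℕ} (γ : ℝ) (θ₀ : Vec d) (s : ℕ) (D : ℤ → Vec d × ℝ) : ℕ → Traced (Vec d)
  | 0 => pure 0
  | n + 1 => do
    let S ← sumProg γ θ₀ s D n
    let θ ← chainProg γ θ₀ D 0 (s + n)
    pure (S + θ)

/-- Program for `θ̄_k`. -/
def thetaBarProg {d : ℕ} (γ : ℝ) (θ₀ : Vec d) (s k : ℕ) (D : ℤ → Vec d × ℝ) :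
    Traced (Vec d) := do
  let S ← sumProg γ θ₀ s D (k - s)
  pure (((k : ℝ) - s)⁻¹ • S)

/-- Program for `Z_k`. -/
def zProg {d : ℕ} (γ δ : ℝ) (θ₀ : Vec d) (D : ℤ → Vec d × ℝ) (τ : ℕ → ℕ) (N : ℕ) :
    Traced (Vec d) := do
  let a ← chainProg γ θ₀ D (-(τ (N + 1) : ℤ)) (τ (N + 1))
  let b ← chainProg γ θ₀ D (-(τ N : ℤ)) (τ N)
  pure ((levelProb δ N)⁻¹ • (a - b))

/-- Sampling time of `θ̄_k + q⁻¹ Q Z'_k`: the copy `Z'_k`, whose own sampling time is `C'`, is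
sampled only if `Q = 1`. -/
def fHatTime {d : ℕ} (γ : ℝ) (θ₀ : Vec d) (s k : ℕ) (D : ℤ → Vec d × ℝ) (Q : Bool) (C' : ℕ) : ℕ :=
  (thetaBarProg γ θ₀ s k D).time + if Q then C' else 0

/-! The programs compute the estimators. -/

theorem chainProg_val {d : ℕ} (γ : ℝ) (θ₀ : Vec d) (D : ℤ → Vec d × ℝ) (m : ℤ) (n : ℕ) :
    (chainProg γ θ₀ D m n).val = chain γ θ₀ D m n := by
  induction n with
  | zero => rfl
  | succ n ih =>
    change sgdStep γ (D (m + n)) (chainProg γ θ₀ D m n).val = _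
    rw [ih]; rfl

theorem sumProg_val {d : ℕ} (γ : ℝ) (θ₀ : Vec d) (s : ℕ) (D : ℤ → Vec d × ℝ) (n : ℕ) :
    (sumProg γ θ₀ s D n).val = ∑ i ∈ Finset.range n, chain γ θ₀ D 0 (s + i) := by
  induction n with
  | zero => rfl
  | succ n ih =>
    change (sumProg γ θ₀ s D n).val + (chainProg γ θ₀ D 0 (s + n)).val = _
    rw [ih, chainProg_val, Finset.sum_range_succ]

theorem thetaBarProg_val {d : ℕ} (γ : ℝ) (θ₀ : Vec d) (s k : ℕ) (D : ℤ → Vec d × ℝ) :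
    (thetaBarProg γ θ₀ s k D).val = thetaBar γ θ₀ s k D := by
  change ((k : ℝ) - s)⁻¹ • (sumProg γ θ₀ s D (k - s)).val = _
  rw [sumProg_val, thetaBar, Finset.sum_Ico_eq_sum_range]

theorem zProg_val {d : ℕ} (γ δ : ℝ) (θ₀ : Vec d) (D : ℤ → Vec d × ℝ) (τ : ℕ → ℕ) (N : ℕ) :
    (zProg γ δ θ₀ D τ N).val = zEst γ δ θ₀ D τ N := by
  change (levelProb δ N)⁻¹ • ((chainProg γ θ₀ D (-(τ (N + 1) : ℤ)) (τ (N + 1))).val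
    - (chainProg γ θ₀ D (-(τ N : ℤ)) (τ N)).val) = _
  rw [chainProg_val, chainProg_val]; rfl

end

end LeastSquares

/-! The excess risk of `θ` is half of `‖θ - θ*‖_H²`, so everything reduces to second moments in the
`H`-norm and to one expectation. Write `κ = γ(2 - γR²)`.

Engine. Two chains driven by the same samples differ by products of the random maps `I - γxxᵀ`. Let
`transfer` send a function `Q` to `u ↦ E Q((I - γxxᵀ)u)`. The fourth-moment bound gives `transfer
‖·‖² + κ‖·‖_H² ≤ ‖·‖²`. Iterating and telescoping, the sum of the `H`-errors of the noiseless
recursion over all times is at most `‖u‖²/κ`; starting the sum at time `s` gains a factor `exp(-ξs)`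
(`MomentBounds.sum_Ico_iterate_transfer_le`). A uniformly distributed time `τ` turns this sum into
an average, which gains the inverse length of its range.

Levels. To compare `θ_{-m:0}` with `θ_{-n:0}`, `n ≤ m`, replace the start `θ₀` by `θ*` in both. This
costs two noiseless errors. The chain started at `θ*` at time `-m` has, at time `-n`, centered error
with covariance at most `aI`, `a = γσ²/(2 - γR²)` (`IsSample.covBound_chain`). From then on it
differs from the chain restarted at `θ*` by the noiseless recursion, whence a trace bound
(`lintegral_iterate_transfer_le`). The sum of these errors is the constant `c`
(`IsSample.lintegral_hSq_level_sub_le`).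

Randomization. Dividing by `p_N` makes `E(Z_k)` the telescoping series of `E f_{k,l+1} - E f_{k,l}`,
equal to `θ* - E f_{k,0} = θ* - E θ̄_k`. In the second moment, `1/p_l ≈ 2^l (l+1)^δ` is compensated
by the range length `k2^l`. There remains `Σ (l+1)^δ exp(-ξ2^l)`, in which only logarithmically many
levels count (`sum_rpow_mul_exp_le`). The time cost is of order `kΣ 2^l p_l`, which converges
because `δ > 1`.

Assembly. The average `θ̄_k` has risk of order `c/(k - s)` by a telescoping argument
(`IsSample.integral_hForm_sum_chain_le`). In the square of `θ̄_k - θ* + q⁻¹QZ'_k` the cross term is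
`-2‖E Z_k‖_H² ≤ 0`, and `E((Q/q)²) = 1/q`. -/

set_option linter.unusedSectionVars false

namespace LeastSquares

/-! ### Moments of the data: from matrix inequalities to quadratic forms -/

section Moments

variable {d : ℕ}

theorem inner_eq_sum (x u : Vec d) : inner ℝ x u = ∑ i, x i * u i := by
  rw [PiLp.inner_apply]
  simp [mul_comm]

theorem weighted_inner_mul_inner_eq (w : Vec d × ℝ → ℝ) (u v : Vec d) (z : Vec d × ℝ) :
    w z * (inner ℝ z.1 u * inner ℝ z.1 v)
      = ∑ i, ∑ j, u i * v j * (w z * (z.1 i * z.1 j)) := by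
  rw [inner_eq_sum, inner_eq_sum, Finset.sum_mul_sum, Finset.mul_sum]
  refine Finset.sum_congr rfl fun i _ => ?_
  rw [Finset.mul_sum]
  exact Finset.sum_congr rfl fun j _ => by ring

theorem HasWeightedMoment.integral_inner {P : Measure (Vec d × ℝ)} {w : Vec d × ℝ → ℝ}
    (hw : HasWeightedMoment P w) (u v : Vec d) :
    ∫ z, w z * (inner ℝ z.1 u * inner ℝ z.1 v) ∂P
      = u.ofLp ⬝ᵥ (weightedMoment P w *ᵥ v.ofLp) := by
  simp_rw [weighted_inner_mul_inner_eq]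
  rw [integral_finsetSum _ fun i _ => integrable_finsetSum _ fun j _ => (hw i j).const_mul _]
  refine Finset.sum_congr rfl fun i _ => ?_
  rw [integral_finsetSum _ fun j _ => (hw i j).const_mul _]
  simp only [integral_const_mul, Matrix.mulVec, dotProduct, weightedMoment, Matrix.of_apply,
    Finset.mul_sum]
  exact Finset.sum_congr rfl fun j _ => by ring

theorem HasWeightedMoment.integrable_mul_norm_sq {P : Measure (Vec d × ℝ)} {w : Vec d × ℝ → ℝ}
    (hw : HasWeightedMoment P w) : Integrable (fun z => w z * ‖z.1‖ ^ 2) P := by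
  have : (fun z : Vec d × ℝ => w z * ‖z.1‖ ^ 2) = fun z => ∑ i, w z * (z.1 i * z.1 i) := by
    funext z
    rw [EuclideanSpace.real_norm_sq_eq, Finset.mul_sum]
    simp [sq]
  rw [this]
  exact integrable_finsetSum _ fun i _ => hw i i

theorem weightedMoment_one (P : Measure (Vec d × ℝ)) :
    weightedMoment P (fun _ => 1) = hessian P := by
  ext i j
  simp [weightedMoment, hessian]

theorem memLp_coord {P : Measure (Vec d × ℝ)} (hx : MemLp (fun z : Vec d × ℝ => z.1) 2 P)
    (i : Fin d) : MemLp (fun z : Vec d × ℝ => z.1 i) 2 P :=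
  (EuclideanSpace.proj (𝕜 := ℝ) i).comp_memLp' hx

theorem hasWeightedMoment_one {P : Measure (Vec d × ℝ)}
    (hx : MemLp (fun z : Vec d × ℝ => z.1) 2 P) : HasWeightedMoment P fun _ => 1 := fun i j => by
  simpa only [one_mul] using! (memLp_coord hx i).integrable_mul (memLp_coord hx j)

/-- The bilinear form `(u, v) ↦ E(⟨x, u⟩ ⟨x, v⟩)` of the Hessian. -/
noncomputable def hForm (P : Measure (Vec d × ℝ)) (u v : Vec d) : ℝ :=
  ∫ z, inner ℝ z.1 u * inner ℝ z.1 v ∂P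

/-- The properties of the law of `(x, y)` on which the analysis rests. -/
structure MomentBounds (P : Measure (Vec d × ℝ)) (θs : Vec d) (σ R : ℝ) : Prop where
  sigma_pos : 0 < σ
  R_pos : 0 < R
  memLp_x : MemLp (fun z : Vec d × ℝ => z.1) 2 P
  memLp_noise : MemLp (fun z : Vec d × ℝ => z.2 - inner ℝ z.1 θs) 2 P
  integrable_fourth : Integrable (fun z : Vec d × ℝ => ‖z.1‖ ^ 2 * ‖z.1‖ ^ 2) P
  integrable_noise :
    Integrable (fun z : Vec d × ℝ => (z.2 - inner ℝ z.1 θs) ^ 2 * ‖z.1‖ ^ 2) P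
  noise_orth : ∀ u : Vec d, ∫ z, (z.2 - inner ℝ z.1 θs) * inner ℝ z.1 u ∂P = 0
  noise_le : ∀ u : Vec d,
    ∫ z, (z.2 - inner ℝ z.1 θs) ^ 2 * (inner ℝ z.1 u * inner ℝ z.1 u) ∂P ≤ σ ^ 2 * hForm P u u
  fourth_le : ∀ u : Vec d,
    ∫ z, ‖z.1‖ ^ 2 * (inner ℝ z.1 u * inner ℝ z.1 u) ∂P ≤ R ^ 2 * hForm P u u

theorem hForm_eq_dotProduct {P : Measure (Vec d × ℝ)}
    (hx : MemLp (fun z : Vec d × ℝ => z.1) 2 P) (u v : Vec d) :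
    hForm P u v = u.ofLp ⬝ᵥ (hessian P *ᵥ v.ofLp) := by
  have := (hasWeightedMoment_one hx).integral_inner u v
  rw [weightedMoment_one] at this
  rw [← this]
  simp [hForm]

theorem integral_weighted_le_of_posSemidef {P : Measure (Vec d × ℝ)}
    (hx : MemLp (fun z : Vec d × ℝ => z.1) 2 P) {w : Vec d × ℝ → ℝ} (hw : HasWeightedMoment P w)
    {C : ℝ} (h : (C • hessian P - weightedMoment P w).PosSemidef) (u : Vec d) :
    ∫ z, w z * (inner ℝ z.1 u * inner ℝ z.1 u) ∂P ≤ C * hForm P u u := by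
  have := h.dotProduct_mulVec_nonneg u.ofLp
  rw [Matrix.sub_mulVec, Matrix.smul_mulVec, dotProduct_sub, dotProduct_smul, star_trivial,
    ← hForm_eq_dotProduct hx, ← hw.integral_inner, smul_eq_mul] at this
  linarith

theorem momentBounds_of_assumption {P : Measure (Vec d × ℝ)} [IsProbabilityMeasure P]
    (hP : MemLp (fun z : Vec d × ℝ => z) 2 P) {θs : Vec d} (hθs : NormalEq P θs) {σ R : ℝ}
    (hA : Assumption1 P θs σ R) : MomentBounds P θs σ R := by
  have hx : MemLp (fun z : Vec d × ℝ => z.1) 2 P := hP.fst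
  have hy : MemLp (fun z : Vec d × ℝ => z.2) 2 P := hP.snd
  have hxu : ∀ u : Vec d, MemLp (fun z : Vec d × ℝ => inner ℝ z.1 u) 2 P := fun u => by
    simpa only [real_inner_comm] using hx.const_inner (𝕜 := ℝ) u
  refine ⟨hA.sigma_pos, hA.R_pos, hx, hy.sub (hxu θs), hA.fourth_exists.integrable_mul_norm_sq,
    hA.noise_exists.integrable_mul_norm_sq, fun u => ?_,
    integral_weighted_le_of_posSemidef hx hA.noise_exists hA.noise_le,
    integral_weighted_le_of_posSemidef hx hA.fourth_exists hA.fourth_le⟩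
  -- The normal equation, paired with `u`: it makes the residual orthogonal to every linear function
  -- of `x`.
  have h1 : ∫ z, z.2 * inner ℝ z.1 u ∂P = hForm P u θs := by
    rw [hForm_eq_dotProduct hx, hθs]
    simp_rw [inner_eq_sum, Finset.mul_sum, dotProduct]
    rw [integral_finsetSum]
    · refine Finset.sum_congr rfl fun i _ => ?_
      rw [← integral_const_mul]
      exact integral_congr_ae (.of_forall fun z => by simp only; ring)
    · intro i _
      have := (hy.integrable_mul (memLp_coord hx i)).mul_const (u i)
      refine this.congr (.of_forall fun z => ?_)
      simp only [Pi.mul_apply]; ring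
  have h2 : Integrable (fun z : Vec d × ℝ => z.2 * inner ℝ z.1 u) P := hy.integrable_mul (hxu u)
  have h3 : Integrable (fun z : Vec d × ℝ => inner ℝ z.1 u * inner ℝ z.1 θs) P :=
    (hxu u).integrable_mul (hxu θs)
  have : ∀ z : Vec d × ℝ, (z.2 - inner ℝ z.1 θs) * inner ℝ z.1 u
      = z.2 * inner ℝ z.1 u - inner ℝ z.1 u * inner ℝ z.1 θs := fun z => by ring
  simp_rw [this]
  rw [integral_sub h2 h3, h1, hForm, sub_self]

theorem lambdaMin_mul_dotProduct_le {A : Matrix (Fin d) (Fin d) ℝ} (hA : A.IsHermitian)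
    (u : Fin d → ℝ) : lambdaMin A * (u ⬝ᵥ u) ≤ u ⬝ᵥ (A *ᵥ u) := by
  have hle : ∀ x ∈ spectrum ℝ A, lambdaMin A ≤ x := fun x hx =>
    csInf_le (by rw [hA.spectrum_real_eq_range_eigenvalues]; exact (Set.finite_range _).bddBelow) hx
  have hpsd : (A - algebraMap ℝ _ (lambdaMin A)).PosSemidef := by
    open scoped MatrixOrder in
    exact Matrix.le_iff.1 (algebraMap_le_of_le_spectrum hle hA.isSelfAdjoint)
  have := hpsd.dotProduct_mulVec_nonneg u
  rw [Matrix.sub_mulVec, dotProduct_sub, star_trivial, Algebra.algebraMap_eq_smul_one,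
    Matrix.smul_mulVec, Matrix.one_mulVec, dotProduct_smul, smul_eq_mul] at this
  linarith

/-- The infimum of the spectrum is attained, hence is an eigenvalue, unless `d = 0`: then the
spectrum is empty and its infimum is the default value 0. -/
theorem lambdaMin_pos {A : Matrix (Fin d) (Fin d) ℝ} (hA : A.PosDef) (hd : d ≠ 0) :
    0 < lambdaMin A := by
  have : Nonempty (Fin d) := ⟨⟨0, Nat.pos_of_ne_zero hd⟩⟩
  have hmem : lambdaMin A ∈ spectrum ℝ A := by
    rw [lambdaMin, hA.1.spectrum_real_eq_range_eigenvalues]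
    exact (Set.range_nonempty _).csInf_mem (Set.finite_range _)
  rw [hA.1.spectrum_real_eq_range_eigenvalues] at hmem
  obtain ⟨i, hi⟩ := hmem
  rw [← hi]
  exact hA.eigenvalues_pos i

theorem lambdaMin_mul_norm_sq_le {P : Measure (Vec d × ℝ)}
    (hx : MemLp (fun z : Vec d × ℝ => z.1) 2 P) (hH : (hessian P).PosDef) (u : Vec d) :
    lambdaMin (hessian P) * ‖u‖ ^ 2 ≤ hForm P u u := by
  rw [hForm_eq_dotProduct hx]
  have : ‖u‖ ^ 2 = u.ofLp ⬝ᵥ u.ofLp := by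
    rw [EuclideanSpace.real_norm_sq_eq]; simp [dotProduct, sq]
  rw [this]
  exact lambdaMin_mul_dotProduct_le hH.1 _

/-- The Hessian as a continuous linear map. -/
noncomputable def hOp (P : Measure (Vec d × ℝ)) : Vec d →L[ℝ] Vec d :=
  Matrix.toEuclideanCLM (n := Fin d) (𝕜 := ℝ) (hessian P)

theorem hForm_eq_inner {P : Measure (Vec d × ℝ)}
    (hx : MemLp (fun z : Vec d × ℝ => z.1) 2 P) (u v : Vec d) :
    hForm P u v = inner ℝ u (hOp P v) := by
  rw [hForm_eq_dotProduct hx, EuclideanSpace.inner_eq_star_dotProduct, hOp,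
    Matrix.ofLp_toEuclideanCLM, star_trivial, dotProduct_comm]

theorem hForm_comm (P : Measure (Vec d × ℝ)) (u v : Vec d) : hForm P u v = hForm P v u := by
  simp only [hForm, mul_comm]

end Moments

/-! ### The noiseless recursion and its transfer operator -/

section Transfer

variable {d : ℕ}

/-- The random linear map `I - γ x xᵀ`. -/
noncomputable def linStep (γ : ℝ) (x : Vec d) : Vec d →ₗ[ℝ] Vec d :=
  LinearMap.id - γ • (innerₛₗ ℝ x).smulRight x

theorem linStep_apply (γ : ℝ) (x u : Vec d) : linStep γ x u = u - (γ * inner ℝ x u) • x := by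
  simp [linStep, smul_smul]

/-- The expected value of `Q` one step of the noiseless recursion later. -/
noncomputable def transfer (P : Measure (Vec d × ℝ)) (γ : ℝ) (Q : Vec d → ℝ≥0∞) (u : Vec d) :
    ℝ≥0∞ := ∫⁻ z, Q (linStep γ z.1 u) ∂P

/-- The squared norm `‖u‖_H²`, as an extended nonnegative real. -/
noncomputable def hSq (P : Measure (Vec d × ℝ)) (u : Vec d) : ℝ≥0∞ :=
  ∫⁻ z, ENNReal.ofReal (inner ℝ z.1 u * inner ℝ z.1 u) ∂P

/-- The squared Euclidean norm, as an extended nonnegative real. -/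
noncomputable def normSq (u : Vec d) : ℝ≥0∞ := ENNReal.ofReal (‖u‖ ^ 2)

theorem measurable_normSq : Measurable (normSq (d := d)) := by
  unfold normSq; fun_prop

theorem measurable_linStep {α : Type*} [MeasurableSpace α] (γ : ℝ) {f g : α → Vec d}
    (hf : Measurable f) (hg : Measurable g) : Measurable fun a => linStep γ (f a) (g a) := by
  simp_rw [linStep_apply]; fun_prop

variable {P : Measure (Vec d × ℝ)} [IsProbabilityMeasure P]

theorem measurable_hSq : Measurable (hSq P) := by
  unfold hSq
  exact Measurable.lintegral_prod_right' (f := fun p : Vec d × (Vec d × ℝ) =>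
    ENNReal.ofReal (inner ℝ p.2.1 p.1 * inner ℝ p.2.1 p.1)) (by fun_prop)

theorem measurable_transfer {γ : ℝ} {Q : Vec d → ℝ≥0∞} (hQ : Measurable Q) :
    Measurable (transfer P γ Q) := by
  unfold transfer
  exact Measurable.lintegral_prod_right' (f := fun p : Vec d × (Vec d × ℝ) =>
    Q (linStep γ p.2.1 p.1)) (hQ.comp (measurable_linStep γ (by fun_prop) (by fun_prop)))

theorem measurable_transfer_iterate {γ : ℝ} {Q : Vec d → ℝ≥0∞} (hQ : Measurable Q) (n : ℕ) :
    Measurable ((transfer P γ)^[n] Q) := by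
  induction n with
  | zero => exact hQ
  | succ n ih => rw [Function.iterate_succ_apply']; exact measurable_transfer ih

theorem transfer_mono (γ : ℝ) : Monotone (transfer P γ) := fun _ _ h _ =>
  lintegral_mono fun _ => h _

theorem transfer_add (γ : ℝ) {Q Q' : Vec d → ℝ≥0∞} (hQ : Measurable Q) :
    transfer P γ (Q + Q') = transfer P γ Q + transfer P γ Q' := by
  funext u
  refine lintegral_add_left (hQ.comp ?_) _
  exact measurable_linStep γ measurable_fst measurable_const

theorem transfer_smul (γ : ℝ) (c : ℝ≥0∞) {Q : Vec d → ℝ≥0∞} (hQ : Measurable Q) :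
    transfer P γ (c • Q) = c • transfer P γ Q := by
  funext u
  refine lintegral_const_mul c (hQ.comp ?_)
  exact measurable_linStep γ measurable_fst measurable_const

variable {θs : Vec d} {σ R γ : ℝ}

theorem MomentBounds.memLp_inner (hM : MomentBounds P θs σ R) (u : Vec d) :
    MemLp (fun z : Vec d × ℝ => inner ℝ z.1 u) 2 P := by
  simpa only [real_inner_comm] using hM.memLp_x.const_inner (𝕜 := ℝ) u

theorem MomentBounds.integrable_inner_mul_inner (hM : MomentBounds P θs σ R) (u v : Vec d) :
    Integrable (fun z : Vec d × ℝ => inner ℝ z.1 u * inner ℝ z.1 v) P :=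
  (hM.memLp_inner u).integrable_mul (hM.memLp_inner v)

theorem MomentBounds.hSq_eq (hM : MomentBounds P θs σ R) (u : Vec d) :
    hSq P u = ENNReal.ofReal (hForm P u u) := by
  rw [hForm, ofReal_integral_eq_lintegral_ofReal (hM.integrable_inner_mul_inner u u)
    (.of_forall fun _ => mul_self_nonneg _), hSq]

theorem hForm_self_nonneg (u : Vec d) : 0 ≤ hForm P u u :=
  integral_nonneg fun _ => mul_self_nonneg _

theorem MomentBounds.integrable_fourth_inner (hM : MomentBounds P θs σ R) (u : Vec d) :
    Integrable (fun z : Vec d × ℝ => ‖z.1‖ ^ 2 * (inner ℝ z.1 u * inner ℝ z.1 u)) P := by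
  refine (hM.integrable_fourth.mul_const (‖u‖ ^ 2)).mono' ?_ (.of_forall fun z => ?_)
  · exact Measurable.aestronglyMeasurable (by fun_prop)
  · rw [Real.norm_of_nonneg (mul_nonneg (sq_nonneg _) (mul_self_nonneg _)), mul_assoc]
    refine mul_le_mul_of_nonneg_left ?_ (sq_nonneg _)
    have := abs_real_inner_le_norm z.1 u
    nlinarith [abs_nonneg (inner ℝ z.1 u), abs_mul_abs_self (inner ℝ z.1 u)]

theorem MomentBounds.integrable_noise_inner (hM : MomentBounds P θs σ R) (u : Vec d) :
    Integrable (fun z : Vec d × ℝ =>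
      (z.2 - inner ℝ z.1 θs) ^ 2 * (inner ℝ z.1 u * inner ℝ z.1 u)) P := by
  refine (hM.integrable_noise.mul_const (‖u‖ ^ 2)).mono' ?_ (.of_forall fun z => ?_)
  · exact Measurable.aestronglyMeasurable (by fun_prop)
  · rw [Real.norm_of_nonneg (mul_nonneg (sq_nonneg _) (mul_self_nonneg _)), mul_assoc]
    refine mul_le_mul_of_nonneg_left ?_ (sq_nonneg _)
    have := abs_real_inner_le_norm z.1 u
    nlinarith [abs_nonneg (inner ℝ z.1 u), abs_mul_abs_self (inner ℝ z.1 u)]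

theorem norm_linStep_sq (γ : ℝ) (x u : Vec d) : ‖linStep γ x u‖ ^ 2
    = ‖u‖ ^ 2 - 2 * γ * (inner ℝ x u * inner ℝ x u)
      + γ ^ 2 * (‖x‖ ^ 2 * (inner ℝ x u * inner ℝ x u)) := by
  rw [linStep_apply, norm_sub_sq_real, real_inner_smul_right, norm_smul, real_inner_comm, mul_pow,
    Real.norm_eq_abs, sq_abs]
  ring

theorem MomentBounds.integrable_norm_linStep_sq (hM : MomentBounds P θs σ R) (γ : ℝ) (u : Vec d) :
    Integrable (fun z : Vec d × ℝ => ‖linStep γ z.1 u‖ ^ 2) P := by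
  simp_rw [norm_linStep_sq]
  exact ((integrable_const _).sub ((hM.integrable_inner_mul_inner u u).const_mul _)).add
    ((hM.integrable_fourth_inner u).const_mul _)

/-- In `‖u - γ⟨x,u⟩x‖²` the linear term contributes `-2γ‖u‖_H²`, and the quadratic one at most
`γ²R²‖u‖_H²` by the fourth-moment assumption. -/
theorem MomentBounds.integral_norm_linStep_sq_le (hM : MomentBounds P θs σ R) (γ : ℝ)
    (u : Vec d) : ∫ z, ‖linStep γ z.1 u‖ ^ 2 ∂P
      ≤ ‖u‖ ^ 2 - γ * (2 - γ * R ^ 2) * hForm P u u := by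
  simp_rw [norm_linStep_sq]
  rw [integral_add (f := fun z : Vec d × ℝ => ‖u‖ ^ 2 - 2 * γ * (inner ℝ z.1 u * inner ℝ z.1 u))
    ((integrable_const _).sub ((hM.integrable_inner_mul_inner u u).const_mul _))
    ((hM.integrable_fourth_inner u).const_mul _), integral_sub (integrable_const _)
    ((hM.integrable_inner_mul_inner u u).const_mul _), integral_const_mul, integral_const_mul]
  have := mul_le_mul_of_nonneg_left (hM.fourth_le u) (sq_nonneg γ)
  simp only [integral_const, probReal_univ, smul_eq_mul, one_mul]
  change _ - 2 * γ * hForm P u u + _ ≤ _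
  linarith

theorem MomentBounds.transfer_normSq (hM : MomentBounds P θs σ R) (γ : ℝ) (u : Vec d) :
    transfer P γ normSq u = ENNReal.ofReal (∫ z, ‖linStep γ z.1 u‖ ^ 2 ∂P) := by
  rw [ofReal_integral_eq_lintegral_ofReal (hM.integrable_norm_linStep_sq γ u)
    (.of_forall fun z => sq_nonneg _)]
  rfl

/-- The basic dissipation inequality. It is kept in additive form because subtraction in `ℝ≥0∞` is
truncated. -/
theorem MomentBounds.transfer_normSq_add_le (hM : MomentBounds P θs σ R)
    (hκ : 0 ≤ γ * (2 - γ * R ^ 2)) :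
    transfer P γ normSq + ENNReal.ofReal (γ * (2 - γ * R ^ 2)) • hSq P ≤ normSq := by
  intro u
  simp only [Pi.add_apply, Pi.smul_apply, smul_eq_mul]
  rw [hM.transfer_normSq, hM.hSq_eq, ← ENNReal.ofReal_mul hκ, ← ENNReal.ofReal_add
    (integral_nonneg fun z => sq_nonneg _) (mul_nonneg hκ (hForm_self_nonneg u))]
  exact ENNReal.ofReal_le_ofReal (by linarith [hM.integral_norm_linStep_sq_le γ u])

/-- Under the noiseless recursion, the sum of the expected excess risks is bounded by the squared
distance to the minimizer. -/
theorem MomentBounds.sum_iterate_transfer_le (hM : MomentBounds P θs σ R)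
    (hκ : 0 ≤ γ * (2 - γ * R ^ 2)) (n : ℕ) :
    (transfer P γ)^[n] normSq + ENNReal.ofReal (γ * (2 - γ * R ^ 2)) •
      ∑ b ∈ Finset.range n, (transfer P γ)^[b] (hSq P) ≤ normSq := by
  induction n with
  | zero => simp
  | succ n ih =>
    refine le_trans ?_ ih
    rw [Finset.sum_range_succ_comm, smul_add, ← add_assoc]
    gcongr
    rw [Function.iterate_succ_apply]
    -- The one-step dissipation inequality is pushed through `n` applications of the monotone,
    -- additive operator `transfer`.
    clear ih
    induction n with
    | zero => exact hM.transfer_normSq_add_le hκ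
    | succ n ih =>
      have := transfer_mono (P := P) γ ih
      rw [transfer_add γ (measurable_transfer_iterate (measurable_transfer measurable_normSq) n),
        transfer_smul γ _ (measurable_transfer_iterate measurable_hSq n)] at this
      simpa only [← Function.iterate_succ_apply'] using this

/-- Each step multiplies the squared norm by at most `1 - ξ ≤ exp(-ξ)` in mean, since the dissipated
amount is at least `ξ‖u‖²`. -/
theorem MomentBounds.iterate_transfer_normSq_le (hM : MomentBounds P θs σ R) {ξ : ℝ}
    (hξ : ∀ u, ξ * ‖u‖ ^ 2 ≤ γ * (2 - γ * R ^ 2) * hForm P u u) (n : ℕ) :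
    (transfer P γ)^[n] normSq ≤ ENNReal.ofReal (Real.exp (-ξ * n)) • normSq := by
  induction n with
  | zero => simp
  | succ n ih =>
    rw [Function.iterate_succ_apply']
    refine (transfer_mono γ ih).trans ?_
    rw [transfer_smul γ _ measurable_normSq]
    intro u
    simp only [Pi.smul_apply, smul_eq_mul]
    rw [hM.transfer_normSq, normSq, ← ENNReal.ofReal_mul (Real.exp_nonneg _),
      ← ENNReal.ofReal_mul (Real.exp_nonneg _)]
    refine ENNReal.ofReal_le_ofReal ?_
    have h1 : Real.exp (-ξ * (n + 1 : ℕ)) = Real.exp (-ξ * n) * Real.exp (-ξ) := by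
      rw [← Real.exp_add]; push_cast; ring_nf
    rw [h1, mul_assoc]
    refine mul_le_mul_of_nonneg_left ?_ (Real.exp_nonneg _)
    have h2 := mul_le_mul_of_nonneg_right (Real.add_one_le_exp (-ξ)) (sq_nonneg ‖u‖)
    linarith [hM.integral_norm_linStep_sq_le γ u, hξ u]

/-- Applying `transfer` `s` times to the bound on the whole sum shifts the summation to start at `s`
and replaces the right-hand side by the expected squared norm at time `s`, which has decayed
exponentially. -/
theorem MomentBounds.sum_Ico_iterate_transfer_le (hM : MomentBounds P θs σ R)
    (hκ : 0 ≤ γ * (2 - γ * R ^ 2)) {ξ : ℝ}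
    (hξ : ∀ u, ξ * ‖u‖ ^ 2 ≤ γ * (2 - γ * R ^ 2) * hForm P u u) (s e : ℕ) (u : Vec d) :
    ENNReal.ofReal (γ * (2 - γ * R ^ 2)) *
      ∑ b ∈ Finset.Ico s e, (transfer P γ)^[b] (hSq P) u
        ≤ ENNReal.ofReal (Real.exp (-ξ * s)) * normSq u := by
  suffices h : ∀ s n, ENNReal.ofReal (γ * (2 - γ * R ^ 2)) •
      ∑ b ∈ Finset.range n, (transfer P γ)^[s + b] (hSq P) ≤ (transfer P γ)^[s] normSq by
    have := (h s (e - s)).trans (hM.iterate_transfer_normSq_le hξ s) u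
    rw [Finset.sum_Ico_eq_sum_range]
    simpa using this
  intro s n
  induction s with
  | zero =>
    simp only [zero_add]
    exact le_trans le_add_self (hM.sum_iterate_transfer_le hκ n)
  | succ s ih =>
    have := transfer_mono (P := P) γ ih
    have hsum : ∀ n, transfer P γ (∑ b ∈ Finset.range n, (transfer P γ)^[s + b] (hSq P))
        = ∑ b ∈ Finset.range n, (transfer P γ)^[s + 1 + b] (hSq P) := fun n => by
      induction n with
      | zero => funext u; simp [transfer]
      | succ n ihn =>
        rw [Finset.sum_range_succ_comm, transfer_add γ
          (measurable_transfer_iterate measurable_hSq _), ihn, Finset.sum_range_succ_comm,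
          ← Function.iterate_succ_apply' (transfer P γ)]
        congr 3; omega
    rw [transfer_smul γ _ (by
      rw [Finset.sum_fn]
      exact Finset.measurable_sum _ fun b _ =>
        measurable_transfer_iterate (P := P) (γ := γ) (measurable_hSq (P := P)) (s + b)),
      hsum, ← Function.iterate_succ_apply' (transfer P γ)] at this
    exact this

/-- If the second moment matrix of `ν` is at most `a I`, the mean under `ν` of a quadratic form
obtained from the recursion is at most `a` times its trace. -/
theorem lintegral_iterate_transfer_le {ν : Measure (Vec d)} [SFinite ν] {a : ℝ≥0∞}
    (hν : ∀ u : Vec d, ∫⁻ v, ENNReal.ofReal (inner ℝ u v * inner ℝ u v) ∂ν ≤ a * normSq u)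
    (n : ℕ) (A : Vec d →ₗ[ℝ] Vec d) :
    ∫⁻ v, (transfer P γ)^[n] (hSq P) (A v) ∂ν
      ≤ a * ∑ i, (transfer P γ)^[n] (hSq P) (A (EuclideanSpace.single i 1)) := by
  induction n generalizing A with
  | zero =>
    have hAm : Measurable A := A.continuous_of_finiteDimensional.measurable
    simp only [Function.iterate_zero, id_eq, hSq]
    rw [lintegral_lintegral_swap (by
      refine Measurable.aemeasurable ?_
      refine ENNReal.measurable_ofReal.comp ?_
      have : Measurable fun p : Vec d × (Vec d × ℝ) => inner ℝ p.2.1 (A p.1) :=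
        (by fun_prop : Measurable fun p : Vec d × (Vec d × ℝ) => p.2.1).inner
          (hAm.comp measurable_fst)
      exact this.mul this)]
    have hm : ∀ w : Vec d, Measurable fun z : Vec d × ℝ =>
        ENNReal.ofReal (inner ℝ z.1 w * inner ℝ z.1 w) := fun w => by fun_prop
    rw [← lintegral_finsetSum _ fun i _ => hm _, ← lintegral_const_mul a
      (Finset.measurable_sum _ fun i _ => hm _)]
    refine lintegral_mono fun z => ?_
    -- For a fixed sample, `⟨x, Av⟩ = ⟨Aᵀx, v⟩`, so the covariance bound applies with `u = Aᵀx`;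
    -- then `‖Aᵀx‖² = Σ ⟨x, A eᵢ⟩²`.
    simp_rw [← LinearMap.adjoint_inner_left]
    refine (hν _).trans_eq ?_
    rw [normSq, EuclideanSpace.real_norm_sq_eq, ENNReal.ofReal_sum_of_nonneg
      fun i _ => sq_nonneg _]
    simp [EuclideanSpace.inner_single_right, sq]
  | succ n ih =>
    have hAm : Measurable A := A.continuous_of_finiteDimensional.measurable
    have hB := measurable_transfer_iterate (P := P) (γ := γ) (measurable_hSq (P := P)) n
    simp_rw [Function.iterate_succ_apply']
    generalize (transfer P γ)^[n] (hSq P) = B at hB ih ⊢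
    unfold transfer
    rw [lintegral_lintegral_swap (by
      refine Measurable.aemeasurable (hB.comp ?_)
      exact measurable_linStep γ (by fun_prop : Measurable fun p : Vec d × (Vec d × ℝ) => p.2.1)
        (hAm.comp measurable_fst))]
    have hm : ∀ w : Vec d, Measurable fun z : Vec d × ℝ =>
        B (linStep γ z.1 w) := fun w =>
      hB.comp (measurable_linStep γ measurable_fst measurable_const)
    rw [← lintegral_finsetSum _ fun i _ => hm _, ← lintegral_const_mul a
      (Finset.measurable_sum _ fun i _ => hm _)]
    -- The random step is absorbed into the linear map; this is why the induction is over all `A`.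
    exact lintegral_mono (μ := P) fun z => ih (linStep γ z.1 ∘ₗ A)

end Transfer

end LeastSquares

/-! ### Fubini for independent variables -/

section Independence

variable {Ω E F : Type*} [MeasurableSpace Ω] [MeasurableSpace E] [MeasurableSpace F]
  {μ : Measure Ω} [IsProbabilityMeasure μ] {X : Ω → E} {Y : Ω → F}

namespace ProbabilityTheory.IndepFun

/-- The joint law is a product. Both integrals are pulled back to the original space, so that
conditioning on `X` amounts to freezing it. -/
theorem lintegral_eq_lintegral_lintegral (h : IndepFun X Y μ) (hX : Measurable X)
    (hY : Measurable Y) {g : E × F → ℝ≥0∞} (hg : Measurable g) :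
    ∫⁻ ω, g (X ω, Y ω) ∂μ = ∫⁻ ω, ∫⁻ ω', g (X ω, Y ω') ∂μ ∂μ := by
  have := Measure.isProbabilityMeasure_map (μ := μ) hY.aemeasurable
  rw [← lintegral_map (f := g) hg (hX.prodMk hY),
    (indepFun_iff_map_prod_eq_prod_map_map hX.aemeasurable hY.aemeasurable).1 h,
    lintegral_prod _ hg.aemeasurable, lintegral_map hg.lintegral_prod_right' hX]
  refine lintegral_congr fun ω => ?_
  exact lintegral_map (hg.comp measurable_prodMk_left) hY

variable {G : Type*} [NormedAddCommGroup G] [NormedSpace ℝ G] [MeasurableSpace G] [BorelSpace G]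
  [SecondCountableTopology G]

theorem integrable_prod_map (h : IndepFun X Y μ) (hX : Measurable X) (hY : Measurable Y)
    {g : E × F → G} (hg : Measurable g) (hi : Integrable (fun ω => g (X ω, Y ω)) μ) :
    Integrable g ((μ.map X).prod (μ.map Y)) := by
  rw [← (indepFun_iff_map_prod_eq_prod_map_map hX.aemeasurable hY.aemeasurable).1 h]
  exact (integrable_map_measure hg.aestronglyMeasurable (hX.prodMk hY).aemeasurable).2 hi

theorem integral_eq_integral_integral (h : IndepFun X Y μ) (hX : Measurable X)
    (hY : Measurable Y) {g : E × F → G} (hg : Measurable g)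
    (hi : Integrable (fun ω => g (X ω, Y ω)) μ) :
    ∫ ω, g (X ω, Y ω) ∂μ = ∫ ω, ∫ ω', g (X ω, Y ω') ∂μ ∂μ := by
  have := Measure.isProbabilityMeasure_map (μ := μ) hX.aemeasurable
  have := Measure.isProbabilityMeasure_map (μ := μ) hY.aemeasurable
  rw [← integral_map (f := g) (hX.prodMk hY).aemeasurable hg.aestronglyMeasurable,
    (indepFun_iff_map_prod_eq_prod_map_map hX.aemeasurable hY.aemeasurable).1 h,
    integral_prod _ (h.integrable_prod_map hX hY hg hi), integral_map hX.aemeasurable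
      hg.stronglyMeasurable.integral_prod_right'.aestronglyMeasurable]
  refine integral_congr_ae (.of_forall fun ω => ?_)
  exact integral_map hY.aemeasurable (hg.comp measurable_prodMk_left).aestronglyMeasurable

end ProbabilityTheory.IndepFun

end Independence

namespace LeastSquares

/-! ### The chain as a Markov recursion, coupling and stationarity of its law -/

section Chain

variable {d : ℕ} {P : Measure (Vec d × ℝ)} [IsProbabilityMeasure P]
  {Ω : Type*} [MeasurableSpace Ω] {μ : Measure Ω} [IsProbabilityMeasure μ]
  {D : ℤ → Ω → Vec d × ℝ} {θs : Vec d} {σ R γ : ℝ}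

/-- The `D t` are independent copies of a variable with law `P`. -/
structure IsSample (P : Measure (Vec d × ℝ)) (μ : Measure Ω) (D : ℤ → Ω → Vec d × ℝ) : Prop where
  measurable : ∀ t, Measurable (D t)
  hasLaw : ∀ t, HasLaw (D t) P μ
  indep : iIndepFun D μ

/-- The `σ`-algebra generated by the samples before time `t`. -/
abbrev past (D : ℤ → Ω → Vec d × ℝ) (t : ℤ) : MeasurableSpace Ω :=
  ⨆ j ∈ Set.Iio t, MeasurableSpace.comap (D j) inferInstance

theorem past_mono {t t' : ℤ} (h : t ≤ t') : past D t ≤ past D t' :=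
  biSup_mono fun _ hj => lt_of_lt_of_le hj h

theorem measurable_past {j t : ℤ} (h : j < t) : Measurable[past D t] (D j) :=
  Measurable.mono (comap_measurable (D j))
    (le_iSup₂ (f := fun j (_ : j ∈ Set.Iio t) =>
      MeasurableSpace.comap (D j) (inferInstance : MeasurableSpace (Vec d × ℝ))) j h) le_rfl

theorem IsSample.past_le (hD : IsSample P μ D) (t : ℤ) : past D t ≤ ‹MeasurableSpace Ω› :=
  iSup₂_le fun j _ => (hD.measurable j).comap_le

theorem IsSample.indepFun_of_past (hD : IsSample P μ D) {E : Type*} [MeasurableSpace E] {t : ℤ}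
    {X : Ω → E} (hX : Measurable[past D t] X) : IndepFun X (D t) μ := by
  have h := indep_iSup_of_disjoint (fun j => (hD.measurable j).comap_le) hD.indep.iIndep
    (S := Set.Iio t) (T := {t}) (by simp)
  rw [IndepFun_iff_Indep]
  refine indep_of_indep_of_le_left (indep_of_indep_of_le_right h ?_) hX.comap_le
  simp

theorem IsSample.lintegral_step (hD : IsSample P μ D) {E : Type*} [MeasurableSpace E] {t : ℤ}
    {X : Ω → E} (hX : Measurable[past D t] X) {g : E × (Vec d × ℝ) → ℝ≥0∞} (hg : Measurable g) :
    ∫⁻ ω, g (X ω, D t ω) ∂μ = ∫⁻ ω, ∫⁻ z, g (X ω, z) ∂P ∂μ := by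
  rw [(hD.indepFun_of_past hX).lintegral_eq_lintegral_lintegral (hX.mono (hD.past_le t) le_rfl)
    (hD.measurable t) hg]
  refine lintegral_congr fun ω => ?_
  exact (hD.hasLaw t).lintegral_comp (hg.comp measurable_prodMk_left).aemeasurable

theorem IsSample.integral_step (hD : IsSample P μ D) {E : Type*} [MeasurableSpace E] {t : ℤ}
    {X : Ω → E} (hX : Measurable[past D t] X) {g : E × (Vec d × ℝ) → ℝ} (hg : Measurable g)
    (hi : Integrable (fun ω => g (X ω, D t ω)) μ) :
    ∫ ω, g (X ω, D t ω) ∂μ = ∫ ω, ∫ z, g (X ω, z) ∂P ∂μ := by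
  rw [(hD.indepFun_of_past hX).integral_eq_integral_integral (hX.mono (hD.past_le t) le_rfl)
    (hD.measurable t) hg hi]
  refine integral_congr_ae (.of_forall fun ω => ?_)
  exact (hD.hasLaw t).integral_comp (hg.comp measurable_prodMk_left).aestronglyMeasurable

/-- The past is averaged first, with the new sample frozen. In this order a centered past variable
kills the cross terms of a step. -/
theorem IsSample.integral_step_swap (hD : IsSample P μ D) {E : Type*} [MeasurableSpace E] {t : ℤ}
    {X : Ω → E} (hX : Measurable[past D t] X) {g : E × (Vec d × ℝ) → ℝ} (hg : Measurable g)
    (hi : Integrable (fun ω => g (X ω, D t ω)) μ) :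
    ∫ ω, g (X ω, D t ω) ∂μ = ∫ z, ∫ ω, g (X ω, z) ∂μ ∂P := by
  have hX' : Measurable X := hX.mono (hD.past_le t) le_rfl
  have hgs : Measurable fun p : (Vec d × ℝ) × E => g (p.2, p.1) := by fun_prop
  have := (hD.indepFun_of_past hX).symm.integral_eq_integral_integral (hD.measurable t) hX'
    (g := fun p => g (p.2, p.1)) hgs hi
  rw [this]
  refine (hD.hasLaw t).integral_comp (f := fun z => ∫ ω, g (X ω, z) ∂μ) ?_
  have hm : Measurable fun p : (Vec d × ℝ) × Ω => g (X p.2, p.1) := by fun_prop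
  exact hm.stronglyMeasurable.integral_prod_right'.aestronglyMeasurable

theorem sgdStep_sub_sgdStep (γ : ℝ) (z : Vec d × ℝ) (θ θ' : Vec d) :
    sgdStep γ z θ - sgdStep γ z θ' = linStep γ z.1 (θ - θ') := by
  rw [linStep_apply, sgdStep, sgdStep, inner_sub_right]
  module

theorem sgdStep_sub (γ : ℝ) (z : Vec d × ℝ) (θ θs : Vec d) :
    sgdStep γ z θ - θs
      = linStep γ z.1 (θ - θs) + (γ * (z.2 - inner ℝ z.1 θs)) • z.1 := by
  rw [linStep_apply, sgdStep, inner_sub_right]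
  module

theorem inner_linStep (γ : ℝ) (x u v : Vec d) :
    inner ℝ u (linStep γ x v) = inner ℝ (linStep γ x u) v := by
  rw [linStep_apply, linStep_apply, inner_sub_left, inner_sub_right, real_inner_smul_left,
    real_inner_smul_right, real_inner_comm x u]
  ring

theorem measurable_sgdStep {α : Type*} {_ : MeasurableSpace α} (γ : ℝ) {f : α → Vec d × ℝ}
    {g : α → Vec d} (hf : Measurable f) (hg : Measurable g) :
    Measurable fun a => sgdStep γ (f a) (g a) := by
  unfold sgdStep; fun_prop

theorem measurable_past_chain {m t : ℤ} {X : Ω → Vec d} (hX : Measurable[past D m] X)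
    (n : ℕ) (h : m + n ≤ t) :
    Measurable[past D t] fun ω => chain γ (X ω) (fun j => D j ω) m n := by
  induction n generalizing t with
  | zero => exact hX.mono (past_mono (by simpa using h)) le_rfl
  | succ n ih =>
    push_cast at h
    exact measurable_sgdStep γ (measurable_past (by lia)) (ih (by lia))

theorem measurable_chain (γ : ℝ) (θ₀ : Vec d) (m : ℤ) (n : ℕ) :
    Measurable fun D : ℤ → Vec d × ℝ => chain γ θ₀ D m n := by
  induction n with
  | zero => exact measurable_const
  | succ n ih => exact measurable_sgdStep γ (measurable_pi_apply _) ih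

theorem chain_add (γ : ℝ) (θ₀ : Vec d) (D : ℤ → Vec d × ℝ) (m : ℤ) (i j : ℕ) :
    chain γ θ₀ D m (i + j) = chain γ (chain γ θ₀ D m i) D (m + i) j := by
  induction j with
  | zero => rfl
  | succ j ih =>
    rw [← add_assoc, chain, ih, chain]
    push_cast
    rw [add_assoc]

/-- Two chains driven by the same samples differ by the noiseless recursion. -/
theorem IsSample.lintegral_chain_sub_chain (hD : IsSample P μ D) {m : ℤ} {X Y : Ω → Vec d}
    (hX : Measurable[past D m] X) (hY : Measurable[past D m] Y) {Q : Vec d → ℝ≥0∞}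
    (hQ : Measurable Q) (n : ℕ) :
    ∫⁻ ω, Q (chain γ (X ω) (fun j => D j ω) m n - chain γ (Y ω) (fun j => D j ω) m n) ∂μ
      = ∫⁻ ω, (transfer P γ)^[n] Q (X ω - Y ω) ∂μ := by
  induction n generalizing Q with
  | zero => rfl
  | succ n ih =>
    -- The last step is averaged given the past, which replaces `Q` by `transfer Q` for the shorter
    -- chain.
    rw [Function.iterate_succ_apply, ← ih (measurable_transfer hQ)]
    simp_rw [chain, sgdStep_sub_sgdStep]
    exact hD.lintegral_step (g := fun p : Vec d × (Vec d × ℝ) => Q (linStep γ p.2.1 p.1))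
      ((measurable_past_chain hX n le_rfl).sub (measurable_past_chain hY n le_rfl))
      (hQ.comp (measurable_linStep γ (by fun_prop) (by fun_prop)))

/-- The law of the chain does not depend on the starting time. -/
theorem IsSample.map_chain_eq (hD : IsSample P μ D) (γ : ℝ) (θ₀ : Vec d) (m m' : ℤ) (n : ℕ) :
    μ.map (fun ω => chain γ θ₀ (fun j => D j ω) m n)
      = μ.map (fun ω => chain γ θ₀ (fun j => D j ω) m' n) := by
  induction n with
  | zero => rfl
  | succ n ih =>
    have hstep : ∀ m : ℤ, μ.map (fun ω => chain γ θ₀ (fun j => D j ω) m (n + 1))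
        = ((μ.map (fun ω => chain γ θ₀ (fun j => D j ω) m n)).prod P).map
          (fun p => sgdStep γ p.2 p.1) := fun m => by
      have hp : Measurable[past D (m + n)] fun ω => chain γ θ₀ (fun j => D j ω) m n :=
        measurable_past_chain (X := fun _ => θ₀) measurable_const n le_rfl
      have hm := hp.mono (hD.past_le _) le_rfl
      have := (indepFun_iff_map_prod_eq_prod_map_map hm.aemeasurable
        (hD.measurable (m + n)).aemeasurable).1 (hD.indepFun_of_past hp)
      rw [(hD.hasLaw _).map_eq] at this
      rw [← this, Measure.map_map (measurable_sgdStep γ measurable_snd measurable_fst)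
        (hm.prodMk (hD.measurable _))]
      rfl
    rw [hstep, hstep, ih]

end Chain

/-! ### Square-integrability and covariance of the chain started at the minimizer -/

section Noise

variable {d : ℕ} {P : Measure (Vec d × ℝ)} [IsProbabilityMeasure P]
  {Ω : Type*} [MeasurableSpace Ω] {μ : Measure Ω} [IsProbabilityMeasure μ]
  {D : ℤ → Ω → Vec d × ℝ} {θs : Vec d} {σ R γ : ℝ}

theorem memLp_two_iff {X : Ω → Vec d} (hX : Measurable X) :
    MemLp X 2 μ ↔ ∫⁻ ω, normSq (X ω) ∂μ < ∞ := by
  rw [memLp_two_iff_integrable_sq_norm hX.aestronglyMeasurable, Integrable,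
    hasFiniteIntegral_iff_ofReal (.of_forall fun _ => sq_nonneg _)]
  exact ⟨fun h => h.2, fun h => ⟨(hX.norm.pow_const 2).aestronglyMeasurable, h⟩⟩

theorem IsSample.memLp_linStep (hD : IsSample P μ D) (hM : MomentBounds P θs σ R)
    (hκ : 0 ≤ γ * (2 - γ * R ^ 2)) {t : ℤ} {Y : Ω → Vec d} (hYm : Measurable[past D t] Y)
    (hY : MemLp Y 2 μ) : MemLp (fun ω => linStep γ (D t ω).1 (Y ω)) 2 μ := by
  have hYm' : Measurable Y := hYm.mono (hD.past_le t) le_rfl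
  rw [memLp_two_iff (measurable_linStep γ (hD.measurable t).fst hYm'),
    hD.lintegral_step (g := fun p : Vec d × (Vec d × ℝ) => normSq (linStep γ p.2.1 p.1)) hYm
      (measurable_normSq.comp (measurable_linStep γ (by fun_prop) (by fun_prop)))]
  refine lt_of_le_of_lt (lintegral_mono fun ω => ?_) ((memLp_two_iff hYm').1 hY)
  exact le_trans le_self_add (hM.transfer_normSq_add_le hκ (Y ω))

theorem IsSample.memLp_noise (hD : IsSample P μ D) (hM : MomentBounds P θs σ R) (γ : ℝ) (t : ℤ) :
    MemLp (fun ω => (γ * ((D t ω).2 - inner ℝ (D t ω).1 θs)) • (D t ω).1) 2 μ := by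
  have hg : Measurable fun z : Vec d × ℝ => (γ * (z.2 - inner ℝ z.1 θs)) • z.1 := by fun_prop
  have hgD : Measurable fun ω => (γ * ((D t ω).2 - inner ℝ (D t ω).1 θs)) • (D t ω).1 :=
    hg.comp (hD.measurable t)
  rw [memLp_two_iff_integrable_sq_norm hgD.aestronglyMeasurable]
  have : Integrable (fun z : Vec d × ℝ => ‖(γ * (z.2 - inner ℝ z.1 θs)) • z.1‖ ^ 2) P := by
    refine (hM.integrable_noise.const_mul (γ ^ 2)).congr (.of_forall fun z => ?_)
    simp only [norm_smul, Real.norm_eq_abs, mul_pow, sq_abs]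
    ring
  rw [← (hD.hasLaw t).map_eq] at this
  exact this.comp_measurable (hD.measurable t)

theorem IsSample.memLp_sgdStep (hD : IsSample P μ D) (hM : MomentBounds P θs σ R)
    (hκ : 0 ≤ γ * (2 - γ * R ^ 2)) {t : ℤ} {X : Ω → Vec d} (hXm : Measurable[past D t] X)
    (hX : MemLp X 2 μ) : MemLp (fun ω => sgdStep γ (D t ω) (X ω)) 2 μ := by
  have h := ((hD.memLp_linStep hM hκ (Y := fun ω => X ω - θs) (hXm.sub measurable_const)
    (hX.sub (memLp_const θs))).add (hD.memLp_noise hM γ t)).add (memLp_const θs)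
  refine h.ae_eq (.of_forall fun ω => ?_)
  simp only [Pi.add_apply]
  rw [← sgdStep_sub, sub_add_cancel]

theorem IsSample.memLp_chain (hD : IsSample P μ D) (hM : MomentBounds P θs σ R)
    (hκ : 0 ≤ γ * (2 - γ * R ^ 2)) {m : ℤ} {X : Ω → Vec d} (hXm : Measurable[past D m] X)
    (hX : MemLp X 2 μ) (n : ℕ) :
    MemLp (fun ω => chain γ (X ω) (fun j => D j ω) m n) 2 μ := by
  induction n with
  | zero => exact hX
  | succ n ih => exact hD.memLp_sgdStep hM hκ (measurable_past_chain hXm n le_rfl) ih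

/-- `Y` is centered and square-integrable with covariance matrix at most `a I`. -/
structure CovBound (μ : Measure Ω) (a : ℝ) (Y : Ω → Vec d) : Prop where
  memLp : MemLp Y 2 μ
  mean : ∀ u : Vec d, ∫ ω, inner ℝ u (Y ω) ∂μ = 0
  cov_le : ∀ u : Vec d, ∫ ω, inner ℝ u (Y ω) ^ 2 ∂μ ≤ a * ‖u‖ ^ 2

/-- With `A = I - γxxᵀ`, the new covariance is at most `a E(A²) + γ²σ²H ≤ aI - aκH + γ²σ²H`, where
`κ = γ(2 - γR²)`. The condition `haκ` says exactly that the `H` terms do not increase it. -/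
theorem IsSample.covBound_step (hD : IsSample P μ D) (hM : MomentBounds P θs σ R)
    (hκ : 0 ≤ γ * (2 - γ * R ^ 2)) {a : ℝ} (ha : 0 ≤ a)
    (haκ : γ ^ 2 * σ ^ 2 ≤ a * (γ * (2 - γ * R ^ 2))) {t : ℤ}
    {Y : Ω → Vec d} (hYm : Measurable[past D t] Y) (hY : CovBound μ a Y) :
    CovBound μ a fun ω => linStep γ (D t ω).1 (Y ω)
      + (γ * ((D t ω).2 - inner ℝ (D t ω).1 θs)) • (D t ω).1 := by
  have hmem := (hD.memLp_linStep hM hκ hYm hY.memLp).add (hD.memLp_noise hM γ t)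
  have hYi : ∀ v : Vec d, MemLp (fun ω => inner ℝ v (Y ω)) 2 μ := fun v => hY.memLp.const_inner v
  have hYi1 : ∀ v : Vec d, Integrable (fun ω => inner ℝ v (Y ω)) μ := fun v =>
    (hYi v).integrable one_le_two
  have hgm : ∀ u : Vec d, Measurable fun p : Vec d × (Vec d × ℝ) =>
      inner ℝ u (linStep γ p.2.1 p.1 + (γ * (p.2.2 - inner ℝ p.2.1 θs)) • p.2.1) := fun u =>
    measurable_const.inner ((measurable_linStep γ (by fun_prop) (by fun_prop)).add (by fun_prop))
  have hsplit : ∀ (u y : Vec d) (z : Vec d × ℝ),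
      inner ℝ u (linStep γ z.1 y + (γ * (z.2 - inner ℝ z.1 θs)) • z.1)
        = inner ℝ (linStep γ z.1 u) y + γ * ((z.2 - inner ℝ z.1 θs) * inner ℝ z.1 u) :=
    fun u y z => by
      rw [inner_add_right, inner_linStep, real_inner_smul_right, real_inner_comm z.1 u]
      ring
  refine ⟨hmem, fun u => ?_, fun u => ?_⟩
  · have := hD.integral_step_swap hYm (hgm u) ((hmem.const_inner u).integrable one_le_two)
    refine this.trans ?_
    simp_rw [hsplit]
    have h1 : ∀ z : Vec d × ℝ, ∫ ω, (inner ℝ (linStep γ z.1 u) (Y ω)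
        + γ * ((z.2 - inner ℝ z.1 θs) * inner ℝ z.1 u)) ∂μ
        = γ * ((z.2 - inner ℝ z.1 θs) * inner ℝ z.1 u) := fun z => by
      rw [integral_add (hYi1 _) (integrable_const _), hY.mean]
      simp
    simp_rw [h1, integral_const_mul, hM.noise_orth, mul_zero]
  · have := hD.integral_step_swap hYm ((hgm u).pow_const 2) (hmem.const_inner u).integrable_sq
    refine this.trans_le ?_
    simp_rw [hsplit]
    have h1 : ∀ z : Vec d × ℝ, ∫ ω, (inner ℝ (linStep γ z.1 u) (Y ω)
        + γ * ((z.2 - inner ℝ z.1 θs) * inner ℝ z.1 u)) ^ 2 ∂μ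
        ≤ a * ‖linStep γ z.1 u‖ ^ 2
          + γ ^ 2 * ((z.2 - inner ℝ z.1 θs) ^ 2 * (inner ℝ z.1 u * inner ℝ z.1 u)) := fun z => by
      set e := γ * ((z.2 - inner ℝ z.1 θs) * inner ℝ z.1 u) with he
      -- With the sample frozen, `e` is constant, so the cross term is a multiple of the mean of `Y`
      -- and vanishes, even though noise and `x` may be dependent.
      have hexp : ∀ ω, (inner ℝ (linStep γ z.1 u) (Y ω) + e) ^ 2
          = inner ℝ (linStep γ z.1 u) (Y ω) ^ 2
            + (2 * e * inner ℝ (linStep γ z.1 u) (Y ω) + e ^ 2) := fun ω => by ring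
      simp_rw [hexp]
      rw [integral_add (g := fun ω => 2 * e * inner ℝ (linStep γ z.1 u) (Y ω) + e ^ 2)
        (hYi _).integrable_sq (((hYi1 _).const_mul _).add (integrable_const _)), integral_add ((hYi1 _).const_mul _) (integrable_const _), integral_const_mul, hY.mean]
      simp only [mul_zero, integral_const, probReal_univ, smul_eq_mul, one_mul, zero_add]
      refine add_le_add (hY.cov_le _) (le_of_eq ?_)
      rw [he]; ring
    have hI1 := (hM.integrable_norm_linStep_sq γ u).const_mul a
    have hI2 := (hM.integrable_noise_inner u).const_mul (γ ^ 2)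
    refine (integral_mono_of_nonneg (.of_forall fun z => integral_nonneg fun ω => sq_nonneg _)
      (hI1.add hI2) (.of_forall h1)).trans ?_
    rw [integral_add' hI1 hI2, integral_const_mul, integral_const_mul]
    have h2 := mul_le_mul_of_nonneg_left (hM.integral_norm_linStep_sq_le γ u) ha
    have h3 := mul_le_mul_of_nonneg_left (hM.noise_le u) (sq_nonneg γ)
    have h4 := mul_le_mul_of_nonneg_right haκ (hForm_self_nonneg (P := P) u)
    nlinarith

/-- The covariance matrix of the chain started at the minimizer is bounded uniformly in time. -/
theorem IsSample.covBound_chain (hD : IsSample P μ D) (hM : MomentBounds P θs σ R)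
    (hκ : 0 ≤ γ * (2 - γ * R ^ 2)) {a : ℝ} (ha : 0 ≤ a)
    (haκ : γ ^ 2 * σ ^ 2 ≤ a * (γ * (2 - γ * R ^ 2))) (m : ℤ) (n : ℕ) :
    CovBound μ a fun ω => chain γ θs (fun j => D j ω) m n - θs := by
  induction n with
  | zero =>
    simp only [chain, sub_self]
    exact ⟨memLp_const 0, by simp, fun u => by simp; positivity⟩
  | succ n ih =>
    simp only [chain, sgdStep_sub]
    exact hD.covBound_step hM hκ ha haκ ((measurable_past_chain (X := fun _ => θs)
      measurable_const n le_rfl).sub measurable_const) ih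

theorem CovBound.lintegral_inner_le {a : ℝ} (ha : 0 ≤ a) {Y : Ω → Vec d} (hY : CovBound μ a Y)
    (u : Vec d) : ∫⁻ ω, ENNReal.ofReal (inner ℝ u (Y ω) * inner ℝ u (Y ω)) ∂μ
      ≤ ENNReal.ofReal a * normSq u := by
  simp_rw [← sq]
  rw [← ofReal_integral_eq_lintegral_ofReal ((hY.memLp.const_inner u).integrable_sq)
    (.of_forall fun _ => sq_nonneg _), normSq, ← ENNReal.ofReal_mul ha]
  exact ENNReal.ofReal_le_ofReal (hY.cov_le u)

theorem CovBound.integral_norm_sq_le {a : ℝ} {Y : Ω → Vec d} (hY : CovBound μ a Y) :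
    ∫ ω, ‖Y ω‖ ^ 2 ∂μ ≤ a * d := by
  have h1 : ∀ ω, ‖Y ω‖ ^ 2 = ∑ i : Fin d, inner ℝ (EuclideanSpace.single i (1 : ℝ)) (Y ω) ^ 2 :=
    fun ω => by
      rw [EuclideanSpace.real_norm_sq_eq]
      simp [EuclideanSpace.inner_single_left]
  simp_rw [h1]
  rw [integral_finsetSum _ fun i _ => (hY.memLp.const_inner _).integrable_sq]
  refine (Finset.sum_le_sum fun i _ => hY.cov_le (EuclideanSpace.single i (1 : ℝ))).trans ?_
  simp [mul_comm]

end Noise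

/-! ### Coupling of chains started at different times; the ranges of the random times -/

section Levels

variable {d : ℕ} {P : Measure (Vec d × ℝ)} [IsProbabilityMeasure P]
  {Ω : Type*} [MeasurableSpace Ω] {μ : Measure Ω} [IsProbabilityMeasure μ]
  {D : ℤ → Ω → Vec d × ℝ} {θs : Vec d} {σ R γ : ℝ}

theorem hSq_add_add_le (u v w : Vec d) :
    hSq P (u + v + w) ≤ 3 * (hSq P u + hSq P v + hSq P w) := by
  have hm : ∀ w : Vec d, Measurable fun z : Vec d × ℝ =>
      ENNReal.ofReal (inner ℝ z.1 w * inner ℝ z.1 w) := fun w => by fun_prop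
  unfold hSq
  rw [← lintegral_add_left (hm _), ← lintegral_add_right _ (hm _), ← lintegral_const_mul' _ _ ENNReal.ofNat_ne_top]
  refine lintegral_mono fun z => ?_
  have h3 : (3 : ℝ≥0∞) = ENNReal.ofReal 3 := by simp
  rw [← ENNReal.ofReal_add (mul_self_nonneg _) (mul_self_nonneg _), ← ENNReal.ofReal_add
    (add_nonneg (mul_self_nonneg _) (mul_self_nonneg _)) (mul_self_nonneg _), h3,
    ← ENNReal.ofReal_mul (by norm_num)]
  refine ENNReal.ofReal_le_ofReal ?_
  rw [inner_add_right, inner_add_right]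
  set a := inner ℝ z.1 u
  set b := inner ℝ z.1 v
  set c := inner ℝ z.1 w
  linarith [sq_nonneg (a - b), sq_nonneg (b - c), sq_nonneg (a - c)]

/-- Going from `θ₀` to `θ*` in both chains leaves three differences, each a noiseless recursion: two
with deterministic starts, and one starting at time `-n` from the fluctuation around `θ*`
accumulated since `-m`. The last is bounded by a trace; the factor 3 comes from the square of a sum
of three terms. -/
theorem IsSample.lintegral_hSq_chain_sub_le (hD : IsSample P μ D) (hM : MomentBounds P θs σ R)
    (hκ : 0 ≤ γ * (2 - γ * R ^ 2)) {a : ℝ} (ha : 0 ≤ a)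
    (haκ : γ ^ 2 * σ ^ 2 ≤ a * (γ * (2 - γ * R ^ 2))) (θ₀ : Vec d) {m n : ℕ} (h : n ≤ m) :
    ∫⁻ ω, hSq P (chain γ θ₀ (fun j => D j ω) (-m) m - chain γ θ₀ (fun j => D j ω) (-n) n) ∂μ
      ≤ 3 * ((transfer P γ)^[m] (hSq P) (θ₀ - θs) + (transfer P γ)^[n] (hSq P) (θs - θ₀)
        + ENNReal.ofReal a * ∑ i, (transfer P γ)^[n] (hSq P) (EuclideanSpace.single i 1)) := by
  have hmeas : ∀ (θ : Vec d) (m : ℤ) (n : ℕ),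
      Measurable fun ω => chain γ θ (fun j => D j ω) m n := fun θ m n =>
    (measurable_chain γ θ m n).comp (measurable_pi_lambda _ hD.measurable)
  have hdiff : ∀ (θ θ' : Vec d) (n : ℕ), ∫⁻ ω, hSq P (chain γ θ (fun j => D j ω) (-n) n
      - chain γ θ' (fun j => D j ω) (-n) n) ∂μ = (transfer P γ)^[n] (hSq P) (θ - θ') :=
    fun θ θ' n => by
      rw [hD.lintegral_chain_sub_chain (X := fun _ => θ) (Y := fun _ => θ') measurable_const
        measurable_const measurable_hSq]
      simp
  have hnoise : ∫⁻ ω, hSq P (chain γ θs (fun j => D j ω) (-m) m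
      - chain γ θs (fun j => D j ω) (-n) n) ∂μ
      ≤ ENNReal.ofReal a * ∑ i, (transfer P γ)^[n] (hSq P) (EuclideanSpace.single i 1) := by
    -- The longer chain is restarted at time `-n` from its current value, so that both chains use
    -- the same `n` samples.
    have hsplit : ∀ ω, chain γ θs (fun j => D j ω) (-m) m
        = chain γ (chain γ θs (fun j => D j ω) (-m) (m - n)) (fun j => D j ω) (-n) n := fun ω => by
      have := chain_add γ θs (fun j => D j ω) (-m) (m - n) n
      rw [Nat.sub_add_cancel h] at this
      rw [this]
      congr 1
      lia
    simp_rw [hsplit]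
    rw [hD.lintegral_chain_sub_chain (Y := fun _ => θs)
      (measurable_past_chain (X := fun _ => θs) measurable_const _ (by lia)) measurable_const
      measurable_hSq]
    have hm : Measurable fun ω => chain γ θs (fun j => D j ω) (-m) (m - n) - θs :=
      (hmeas _ _ _).sub measurable_const
    have hν := lintegral_iterate_transfer_le (P := P) (γ := γ)
      (ν := μ.map fun ω => chain γ θs (fun j => D j ω) (-m) (m - n) - θs)
      (a := ENNReal.ofReal a) (fun u => by
        rw [lintegral_map (by fun_prop) hm]
        exact (hD.covBound_chain hM hκ ha haκ (-m) (m - n)).lintegral_inner_le ha u)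
      n LinearMap.id
    simp only [LinearMap.id_apply] at hν
    rwa [lintegral_map (measurable_transfer_iterate measurable_hSq n) hm] at hν
  have hle : ∀ ω, hSq P (chain γ θ₀ (fun j => D j ω) (-m) m
      - chain γ θ₀ (fun j => D j ω) (-n) n) ≤ 3 * (hSq P (chain γ θ₀ (fun j => D j ω) (-m) m
      - chain γ θs (fun j => D j ω) (-m) m) + hSq P (chain γ θs (fun j => D j ω) (-n) n
      - chain γ θ₀ (fun j => D j ω) (-n) n) + hSq P (chain γ θs (fun j => D j ω) (-m) m
      - chain γ θs (fun j => D j ω) (-n) n)) := fun ω => by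
    refine le_trans (le_of_eq ?_) (hSq_add_add_le _ _ _)
    congr 1
    abel
  have hm : ∀ (θ θ' : Vec d) (m n : ℤ) (i j : ℕ), Measurable fun ω =>
      hSq P (chain γ θ (fun j => D j ω) m i - chain γ θ' (fun j => D j ω) n j) :=
    fun θ θ' m n i j => measurable_hSq.comp ((hmeas _ _ _).sub (hmeas _ _ _))
  refine (lintegral_mono hle).trans ?_
  rw [lintegral_const_mul' _ _ ENNReal.ofNat_ne_top, lintegral_add_right _ (hm _ _ _ _ _ _),
    lintegral_add_right _ (hm _ _ _ _ _ _), hdiff, hdiff]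
  gcongr

theorem lintegral_uniformOn_finset (S : Finset ℕ) (φ : ℕ → ℝ≥0∞) :
    ∫⁻ n, φ n ∂(uniformOn (S : Set ℕ)) = (S.card : ℝ≥0∞)⁻¹ * ∑ n ∈ S, φ n := by
  rw [uniformOn, ProbabilityTheory.cond, lintegral_smul_measure, lintegral_finset,
    Measure.count_apply_finset]
  simp

/-- The lower end of the range of `τ(k,l)`; the upper end is `tauLo s k (l + 1)`. -/
def tauLo (s k : ℕ) : ℕ → ℕ
  | 0 => s
  | l + 1 => k * (2 ^ (l + 1) - 1)

theorem tauRange_eq_Ico (s k l : ℕ) :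
    tauRange s k l = Finset.Ico (tauLo s k l) (tauLo s k (l + 1)) := by
  cases l with
  | zero => simp [tauRange, tauLo]
  | succ l => rfl

theorem tauLo_succ_succ (s k l : ℕ) : tauLo s k (l + 2) = tauLo s k (l + 1) + k * 2 ^ (l + 1) := by
  simp only [tauLo]
  rw [← mul_add]
  congr 1
  have := Nat.one_le_two_pow (n := l + 1)
  rw [pow_succ 2 (l + 1)]
  lia

theorem tauLo_lt_succ {s k : ℕ} (h : s < k) (l : ℕ) : tauLo s k l < tauLo s k (l + 1) := by
  cases l with
  | zero => simpa [tauLo] using h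
  | succ l =>
    rw [tauLo_succ_succ]
    have : 0 < k * 2 ^ (l + 1) := Nat.mul_pos (by lia) (by positivity)
    lia

/-- Successive ranges do not get shorter, so the averaged bound at level `l + 1` is no worse than
the one at level `l`. -/
theorem tauLo_gap_mono (s k l : ℕ) :
    tauLo s k (l + 1) - tauLo s k l ≤ tauLo s k (l + 2) - tauLo s k (l + 1) := by
  rw [tauLo_succ_succ]
  cases l with
  | zero => simp [tauLo]; lia
  | succ l =>
    rw [tauLo_succ_succ, pow_succ 2 (l + 1)]
    have : k * 2 ^ (l + 1) ≤ k * (2 ^ (l + 1) * 2) := Nat.mul_le_mul_left _ (by lia)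
    lia

/-- A uniform time converts the bound on a sum over `[s, e)` into a bound on an expectation, smaller
by the factor `1/(e - s)`. -/
theorem lintegral_iterate_uniformOn_le (hM : MomentBounds P θs σ R)
    (hκ : 0 ≤ γ * (2 - γ * R ^ 2)) {ξ : ℝ}
    (hξ : ∀ u, ξ * ‖u‖ ^ 2 ≤ γ * (2 - γ * R ^ 2) * hForm P u u) {T : Ω → ℕ} {s e : ℕ}
    (hT : HasLaw T (uniformOn (Finset.Ico s e : Set ℕ)) μ) (u : Vec d) :
    ENNReal.ofReal (γ * (2 - γ * R ^ 2)) * ∫⁻ ω, (transfer P γ)^[T ω] (hSq P) u ∂μ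
      ≤ ((e - s : ℕ) : ℝ≥0∞)⁻¹ * (ENNReal.ofReal (Real.exp (-ξ * s)) * normSq u) := by
  rw [hT.lintegral_comp (f := fun n => (transfer P γ)^[n] (hSq P) u)
    (measurable_of_countable _).aemeasurable, lintegral_uniformOn_finset, Nat.card_Ico,
    mul_left_comm]
  exact mul_le_mul_right (hM.sum_Ico_iterate_transfer_le hκ hξ s e u) _

theorem measurable_level (γ : ℝ) (θ₀ : Vec d) (l : ℕ) :
    Measurable fun p : (ℤ → Vec d × ℝ) × (ℕ → ℕ) => level γ θ₀ p.1 p.2 l := by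
  have h : Measurable fun p : (ℤ → Vec d × ℝ) × ℕ => chain γ θ₀ p.1 (-(p.2 : ℤ)) p.2 :=
    measurable_from_prod_countable_left fun n => measurable_chain γ θ₀ (-(n : ℤ)) n
  exact h.comp (measurable_fst.prodMk ((measurable_pi_apply l).comp measurable_snd))

theorem HasLaw.mem_of_uniformOn {T : Ω → ℕ} {S : Finset ℕ}
    (hT : HasLaw T (uniformOn (S : Set ℕ)) μ) : ∀ᵐ ω ∂μ, T ω ∈ S := by
  refine (hT.ae_iff (p := fun n => n ∈ S) (measurable_of_countable _)).2 ?_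
  rw [uniformOn]
  exact ae_cond_mem S.measurableSet

end Levels

/-! ### Second moment of the difference of consecutive levels -/

section LevelBound

variable {d : ℕ} {P : Measure (Vec d × ℝ)} [IsProbabilityMeasure P]
  {Ω : Type*} [MeasurableSpace Ω] {μ : Measure Ω} [IsProbabilityMeasure μ]
  {D : ℤ → Ω → Vec d × ℝ} {θs : Vec d} {σ R γ ξ : ℝ}

theorem lintegral_iterate_uniformOn_le_ofReal (hM : MomentBounds P θs σ R)
    (hκ : 0 < γ * (2 - γ * R ^ 2))
    (hξ : ∀ u, ξ * ‖u‖ ^ 2 ≤ γ * (2 - γ * R ^ 2) * hForm P u u) {T : Ω → ℕ} {s e : ℕ}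
    (hse : s < e) (hT : HasLaw T (uniformOn (Finset.Ico s e : Set ℕ)) μ) (u : Vec d) :
    ∫⁻ ω, (transfer P γ)^[T ω] (hSq P) u ∂μ
      ≤ ENNReal.ofReal (Real.exp (-ξ * s) / (e - s : ℕ) * (‖u‖ ^ 2 / (γ * (2 - γ * R ^ 2)))) := by
  have h := lintegral_iterate_uniformOn_le hM hκ.le hξ hT u
  have hpos : (0 : ℝ) < (e - s : ℕ) := by exact_mod_cast Nat.sub_pos_of_lt hse
  rw [normSq, ← ENNReal.ofReal_natCast, ← ENNReal.ofReal_inv_of_pos hpos,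
    ← ENNReal.ofReal_mul (Real.exp_nonneg _), ← ENNReal.ofReal_mul (by positivity)] at h
  have h' := ENNReal.le_div_iff_mul_le (c := ENNReal.ofReal
    ((((e - s : ℕ) : ℝ))⁻¹ * (Real.exp (-ξ * s) * ‖u‖ ^ 2)))
    (b := ENNReal.ofReal (γ * (2 - γ * R ^ 2))) (a := ∫⁻ ω, (transfer P γ)^[T ω] (hSq P) u ∂μ)
    (.inl (by simpa using hκ)) (.inl ENNReal.ofReal_ne_top)
  rw [mul_comm] at h
  refine (h'.2 h).trans_eq ?_
  rw [← ENNReal.ofReal_div_of_pos hκ]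
  congr 1
  field_simp

theorem IsSample.lintegral_hSq_level_sub_le (hD : IsSample P μ D) (hM : MomentBounds P θs σ R)
    (hγ : 0 < γ) (hγR : 0 < 2 - γ * R ^ 2) (hξ0 : 0 ≤ ξ)
    (hξ : ∀ u, ξ * ‖u‖ ^ 2 ≤ γ * (2 - γ * R ^ 2) * hForm P u u) (θ₀ : Vec d)
    {s k : ℕ} (hsk : s < k) {τ : ℕ → Ω → ℕ} (hτm : ∀ l, Measurable (τ l))
    (hτlaw : ∀ l, HasLaw (τ l) (uniformOn (tauRange s k l : Set ℕ)) μ)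
    (hDτ : IndepFun (fun ω t => D t ω) (fun ω l => τ l ω) μ) (l : ℕ) :
    ∫⁻ ω, hSq P (level γ θ₀ (fun t => D t ω) (fun l => τ l ω) (l + 1)
        - level γ θ₀ (fun t => D t ω) (fun l => τ l ω) l) ∂μ
      ≤ ENNReal.ofReal (6 * cConst γ σ R θ₀ θs * (Real.exp (-ξ * tauLo s k l)
          / (tauLo s k (l + 1) - tauLo s k l : ℕ))) := by
  have hκ : 0 < γ * (2 - γ * R ^ 2) := mul_pos hγ hγR
  have hDm : Measurable fun ω t => D t ω := measurable_pi_lambda _ hD.measurable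
  have hτm' : Measurable fun ω l => τ l ω := measurable_pi_lambda _ hτm
  -- The least `a` for which the covariance bound propagates. Divided by `γ(2 - γR²)` and multiplied
  -- by `d`, it is the noise term of `c`.
  set a := γ * σ ^ 2 / (2 - γ * R ^ 2) with ha_def
  have ha : 0 ≤ a := by positivity
  have haκ : a * (γ * (2 - γ * R ^ 2)) = γ ^ 2 * σ ^ 2 := by rw [ha_def]; field_simp
  set n : ℝ := ((tauLo s k (l + 1) - tauLo s k l : ℕ) : ℝ) with hn
  have hnpos : 0 < n := by
    rw [hn]; exact_mod_cast Nat.sub_pos_of_lt (tauLo_lt_succ hsk l)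
  set E := Real.exp (-ξ * tauLo s k l) / n with hE
  have hE0 : 0 ≤ E := by positivity
  have hlaw : ∀ l, HasLaw (τ l)
      (uniformOn (Finset.Ico (tauLo s k l) (tauLo s k (l + 1)) : Set ℕ)) μ := fun l => by
    rw [← tauRange_eq_Ico]; exact hτlaw l
  have hB : ∀ (j : ℕ) (u : Vec d), Measurable fun ω => (transfer P γ)^[τ j ω] (hSq P) u :=
    fun j u => (measurable_of_countable fun n => (transfer P γ)^[n] (hSq P) u).comp (hτm j)
  have hcur : ∀ u, ∫⁻ ω, (transfer P γ)^[τ l ω] (hSq P) u ∂μ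
      ≤ ENNReal.ofReal (E * (‖u‖ ^ 2 / (γ * (2 - γ * R ^ 2)))) := fun u =>
    lintegral_iterate_uniformOn_le_ofReal hM hκ hξ (tauLo_lt_succ hsk l) (hlaw l) u
  have hnext : ∀ u, ∫⁻ ω, (transfer P γ)^[τ (l + 1) ω] (hSq P) u ∂μ
      ≤ ENNReal.ofReal (E * (‖u‖ ^ 2 / (γ * (2 - γ * R ^ 2)))) := fun u => by
    refine (lintegral_iterate_uniformOn_le_ofReal hM hκ hξ (tauLo_lt_succ hsk (l + 1))
      (hlaw (l + 1)) u).trans (ENNReal.ofReal_le_ofReal ?_)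
    refine mul_le_mul_of_nonneg_right ?_ (by positivity)
    refine div_le_div₀ (Real.exp_nonneg _) ?_ hnpos ?_
    · refine Real.exp_le_exp.2 ?_
      have : (tauLo s k l : ℝ) ≤ tauLo s k (l + 1) := by exact_mod_cast (tauLo_lt_succ hsk l).le
      nlinarith
    · rw [hn]; exact_mod_cast tauLo_gap_mono s k l
  have hstep : ∫⁻ ω, hSq P (level γ θ₀ (fun t => D t ω) (fun l => τ l ω) (l + 1)
        - level γ θ₀ (fun t => D t ω) (fun l => τ l ω) l) ∂μ
      ≤ ∫⁻ ω, 3 * ((transfer P γ)^[τ (l + 1) ω] (hSq P) (θ₀ - θs)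
        + (transfer P γ)^[τ l ω] (hSq P) (θs - θ₀) + ENNReal.ofReal a *
          ∑ i, (transfer P γ)^[τ l ω] (hSq P) (EuclideanSpace.single i 1)) ∂μ := by
    have hg : Measurable fun p : (ℕ → ℕ) × (ℤ → Vec d × ℝ) =>
        hSq P (level γ θ₀ p.2 p.1 (l + 1) - level γ θ₀ p.2 p.1 l) :=
      measurable_hSq.comp (((measurable_level γ θ₀ (l + 1)).comp measurable_swap).sub
        ((measurable_level γ θ₀ l).comp measurable_swap))
    refine (hDτ.symm.lintegral_eq_lintegral_lintegral hτm' hDm hg).trans_le ?_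
    refine lintegral_mono_ae ?_
    filter_upwards [HasLaw.mem_of_uniformOn (hlaw l), HasLaw.mem_of_uniformOn (hlaw (l + 1))]
      with ω h1 h2
    refine hD.lintegral_hSq_chain_sub_le hM hκ.le ha haκ.ge θ₀ ?_
    -- The ranges of consecutive levels are adjacent intervals, so `τ l ≤ τ (l + 1)` almost surely.
    exact ((Finset.mem_Ico.1 h1).2.trans_le (Finset.mem_Ico.1 h2).1).le
  refine hstep.trans ?_
  have hms : Measurable fun ω => ENNReal.ofReal a *
      ∑ i, (transfer P γ)^[τ l ω] (hSq P) (EuclideanSpace.single i 1) :=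
    (Finset.measurable_sum _ fun i _ => hB l _).const_mul _
  rw [lintegral_const_mul' _ _ ENNReal.ofNat_ne_top, lintegral_add_right _ hms,
    lintegral_add_right _ (hB _ _), lintegral_const_mul' _ _ ENNReal.ofReal_ne_top,
    lintegral_finsetSum _ fun i _ => hB l _]
  have h3 : (3 : ℝ≥0∞) = ENNReal.ofReal 3 := by simp
  have hsum : ∑ i : Fin d, ∫⁻ ω, (transfer P γ)^[τ l ω] (hSq P) (EuclideanSpace.single i 1) ∂μ
      ≤ ENNReal.ofReal (d * (E / (γ * (2 - γ * R ^ 2)))) := by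
    refine (Finset.sum_le_sum fun i _ => hcur (EuclideanSpace.single i 1)).trans_eq ?_
    rw [← ENNReal.ofReal_sum_of_nonneg fun i _ => by positivity]
    congr 1
    simp [div_eq_mul_inv]
  calc _ ≤ ENNReal.ofReal 3 * (ENNReal.ofReal (E * (‖θ₀ - θs‖ ^ 2 / (γ * (2 - γ * R ^ 2))))
        + ENNReal.ofReal (E * (‖θs - θ₀‖ ^ 2 / (γ * (2 - γ * R ^ 2))))
        + ENNReal.ofReal a * ENNReal.ofReal (d * (E / (γ * (2 - γ * R ^ 2))))) := by
        rw [h3]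
        exact mul_le_mul_right (add_le_add (add_le_add (hnext _) (hcur _))
          (mul_le_mul_right hsum _)) _
    _ ≤ _ := by
        rw [← ENNReal.ofReal_mul ha, ← ENNReal.ofReal_add (by positivity) (by positivity),
          ← ENNReal.ofReal_add (by positivity) (by positivity),
          ← ENNReal.ofReal_mul (by norm_num)]
        refine ENNReal.ofReal_le_ofReal ?_
        rw [norm_sub_rev θs θ₀, cConst]
        have h1 : a * (d * (E / (γ * (2 - γ * R ^ 2)))) = E * (σ ^ 2 * d / (2 - γ * R ^ 2) ^ 2) := by
          rw [ha_def]; field_simp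
        have h2 : 0 ≤ E * (σ ^ 2 * d / (2 - γ * R ^ 2) ^ 2) := by positivity
        rw [h1]
        -- The bias occurs twice and the noise once: `3(2·bias + noise) ≤ 6(bias + noise)`.
        nlinarith

end LevelBound

/-! ### Excess risk of the averaged iterates -/

section Averaging

variable {d : ℕ} {P : Measure (Vec d × ℝ)} [IsProbabilityMeasure P]
  {Ω : Type*} [MeasurableSpace Ω] {μ : Measure Ω} [IsProbabilityMeasure μ]
  {D : ℤ → Ω → Vec d × ℝ} {θs : Vec d} {σ R γ ξ : ℝ}

theorem integrable_inner_of_memLp {X Y : Ω → Vec d} (hX : MemLp X 2 μ) (hY : MemLp Y 2 μ) :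
    Integrable (fun ω => inner ℝ (X ω) (Y ω)) μ := by
  refine (hX.integrable_norm_pow two_ne_zero |>.add
    (hY.integrable_norm_pow two_ne_zero)).mono'
    (hX.aestronglyMeasurable.inner hY.aestronglyMeasurable) (.of_forall fun ω => ?_)
  rw [Real.norm_eq_abs, Pi.add_apply]
  have h1 := abs_real_inner_le_norm (X ω) (Y ω)
  nlinarith [sq_nonneg (‖X ω‖ - ‖Y ω‖), sq_nonneg ‖X ω‖, sq_nonneg ‖Y ω‖]

theorem MomentBounds.integrable_hForm (hM : MomentBounds P θs σ R) {X Y : Ω → Vec d}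
    (hX : MemLp X 2 μ) (hY : MemLp Y 2 μ) : Integrable (fun ω => hForm P (X ω) (Y ω)) μ := by
  simp_rw [hForm_eq_inner hM.memLp_x]
  exact integrable_inner_of_memLp hX ((hOp P).comp_memLp' hY)

theorem MomentBounds.hForm_add_right (hM : MomentBounds P θs σ R) (u v w : Vec d) :
    hForm P u (v + w) = hForm P u v + hForm P u w := by
  simp only [hForm_eq_inner hM.memLp_x, map_add, inner_add_right]

theorem MomentBounds.hForm_smul_right (hM : MomentBounds P θs σ R) (c : ℝ) (u v : Vec d) :
    hForm P u (c • v) = c * hForm P u v := by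
  simp only [hForm_eq_inner hM.memLp_x, map_smul, real_inner_smul_right]

theorem MomentBounds.hForm_add_self (hM : MomentBounds P θs σ R) (u v : Vec d) :
    hForm P (u + v) (u + v) = hForm P u u + 2 * hForm P u v + hForm P v v := by
  rw [hM.hForm_add_right, hForm_comm P (u + v) u, hForm_comm P (u + v) v, hM.hForm_add_right,
    hM.hForm_add_right, hForm_comm P v u]
  ring

theorem MomentBounds.hForm_smul_self (hM : MomentBounds P θs σ R) (c : ℝ) (u : Vec d) :
    hForm P (c • u) (c • u) = c ^ 2 * hForm P u u := by
  rw [hM.hForm_smul_right, hForm_comm P (c • u) u, hM.hForm_smul_right]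
  ring

/-- In expectation, one step decreases the correlation with a past variable by `γ` times the
`H`-correlation. -/
theorem IsSample.integral_inner_sgdStep (hD : IsSample P μ D) (hM : MomentBounds P θs σ R)
    (hκ : 0 ≤ γ * (2 - γ * R ^ 2)) {t : ℤ} {X Y : Ω → Vec d} (hXm : Measurable[past D t] X)
    (hYm : Measurable[past D t] Y) (hX : MemLp X 2 μ) (hY : MemLp Y 2 μ) :
    ∫ ω, inner ℝ (X ω) (sgdStep γ (D t ω) (Y ω) - θs) ∂μ
      = ∫ ω, inner ℝ (X ω) (Y ω - θs) ∂μ - γ * ∫ ω, hForm P (X ω) (Y ω - θs) ∂μ := by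
  have hYs : MemLp (fun ω => Y ω - θs) 2 μ := hY.sub (memLp_const θs)
  have hg : Measurable fun p : (Vec d × Vec d) × (Vec d × ℝ) =>
      inner ℝ p.1.1 (sgdStep γ p.2 p.1.2 - θs) :=
    (by fun_prop : Measurable fun p : (Vec d × Vec d) × (Vec d × ℝ) => p.1.1).inner
      ((measurable_sgdStep γ measurable_snd (by fun_prop)).sub measurable_const)
  have h := hD.integral_step (X := fun ω => (X ω, Y ω)) (hXm.prodMk hYm) hg
    (integrable_inner_of_memLp hX ((hD.memLp_sgdStep hM hκ hYm hY).sub (memLp_const θs)))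
  refine h.trans ?_
  have hz : ∀ u v : Vec d, ∫ z, inner ℝ u (sgdStep γ z v - θs) ∂P
      = inner ℝ u (v - θs) - γ * hForm P u (v - θs) := fun u v => by
    have hexp : ∀ z : Vec d × ℝ, inner ℝ u (sgdStep γ z v - θs)
        = inner ℝ u (v - θs) - (γ * (inner ℝ z.1 u * inner ℝ z.1 (v - θs))
          - γ * ((z.2 - inner ℝ z.1 θs) * inner ℝ z.1 u)) := fun z => by
      rw [sgdStep_sub, linStep_apply, inner_add_right, inner_sub_right, real_inner_smul_right,
        real_inner_smul_right, real_inner_comm z.1 u]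
      ring
    have hi1 := (hM.integrable_inner_mul_inner u (v - θs)).const_mul γ
    have hi2 : Integrable (fun z : Vec d × ℝ => γ * ((z.2 - inner ℝ z.1 θs) * inner ℝ z.1 u)) P :=
      (hM.memLp_noise.integrable_mul (hM.memLp_inner u)).const_mul γ
    simp_rw [hexp]
    rw [integral_sub (g := fun z : Vec d × ℝ => γ * (inner ℝ z.1 u * inner ℝ z.1 (v - θs))
          - γ * ((z.2 - inner ℝ z.1 θs) * inner ℝ z.1 u)) (integrable_const _) (hi1.sub hi2),
      integral_sub hi1 hi2, integral_const_mul, integral_const_mul, hM.noise_orth]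
    simp [hForm]
  simp_rw [hz]
  rw [integral_sub (integrable_inner_of_memLp hX hYs) ((hM.integrable_hForm hX hYs).const_mul γ),
    integral_const_mul]

/-- The chain started at `θ*` serves as reference: the distance to it does not increase in mean
square, and its own fluctuation has trace at most `ad`. The factors 2 come from `(p + q)² ≤ 2p² +
2q²`. -/
theorem IsSample.integral_norm_chain_sub_sq_le (hD : IsSample P μ D) (hM : MomentBounds P θs σ R)
    (hκ : 0 ≤ γ * (2 - γ * R ^ 2)) {a : ℝ} (ha : 0 ≤ a)
    (haκ : γ ^ 2 * σ ^ 2 ≤ a * (γ * (2 - γ * R ^ 2))) (θ₀ : Vec d) (m : ℤ) (n : ℕ) :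
    ∫ ω, ‖chain γ θ₀ (fun j => D j ω) m n - θs‖ ^ 2 ∂μ ≤ 2 * ‖θ₀ - θs‖ ^ 2 + 2 * (a * d) := by
  have hmem : ∀ θ : Vec d, MemLp (fun ω => chain γ θ (fun j => D j ω) m n) 2 μ := fun θ =>
    hD.memLp_chain hM hκ (X := fun _ => θ) measurable_const (memLp_const θ) n
  have hu : MemLp (fun ω => chain γ θ₀ (fun j => D j ω) m n - chain γ θs (fun j => D j ω) m n)
    2 μ := (hmem θ₀).sub (hmem θs)
  have hv := hD.covBound_chain hM hκ ha haκ m n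
  have hbias : ∫ ω, ‖chain γ θ₀ (fun j => D j ω) m n - chain γ θs (fun j => D j ω) m n‖ ^ 2 ∂μ
      ≤ ‖θ₀ - θs‖ ^ 2 := by
    rw [← ENNReal.ofReal_le_ofReal_iff (sq_nonneg _), ofReal_integral_eq_lintegral_ofReal
      (hu.integrable_norm_pow two_ne_zero) (.of_forall fun _ => sq_nonneg _)]
    refine (hD.lintegral_chain_sub_chain (X := fun _ => θ₀) (Y := fun _ => θs) measurable_const
      measurable_const measurable_normSq n).trans_le ?_
    simp only [lintegral_const, measure_univ, mul_one]
    exact le_trans le_self_add (hM.sum_iterate_transfer_le hκ n (θ₀ - θs))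
  have hi1 := (hu.integrable_norm_pow two_ne_zero).const_mul 2
  have hi2 := (hv.memLp.integrable_norm_pow two_ne_zero).const_mul 2
  calc _ ≤ ∫ ω, (2 * ‖chain γ θ₀ (fun j => D j ω) m n - chain γ θs (fun j => D j ω) m n‖ ^ 2
        + 2 * ‖chain γ θs (fun j => D j ω) m n - θs‖ ^ 2) ∂μ := by
        refine integral_mono_of_nonneg (.of_forall fun _ => sq_nonneg _) (hi1.add hi2)
          (.of_forall fun ω => ?_)
        have := norm_sub_le_norm_sub_add_norm_sub (chain γ θ₀ (fun j => D j ω) m n)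
          (chain γ θs (fun j => D j ω) m n) θs
        set p := ‖chain γ θ₀ (fun j => D j ω) m n - chain γ θs (fun j => D j ω) m n‖
        set q := ‖chain γ θs (fun j => D j ω) m n - θs‖
        have h0 := norm_nonneg (chain γ θ₀ (fun j => D j ω) m n - θs)
        change ‖chain γ θ₀ (fun j => D j ω) m n - θs‖ ^ 2 ≤ 2 * p ^ 2 + 2 * q ^ 2
        nlinarith [sq_nonneg (p - q)]
    _ ≤ _ := by
        rw [integral_add hi1 hi2, integral_const_mul, integral_const_mul]
        linarith [hv.integral_norm_sq_le]

/-- Since a step has conditional mean `-γH(θ - θ*)`, the `H`-correlation of `θ_t - θ*` with each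
later error is a difference of consecutive Euclidean correlations; the sum telescopes. -/
theorem IsSample.integral_hForm_chain_sum (hD : IsSample P μ D) (hM : MomentBounds P θs σ R)
    (hκ : 0 ≤ γ * (2 - γ * R ^ 2)) (θ₀ : Vec d) (t n : ℕ) :
    γ * ∫ ω, hForm P (chain γ θ₀ (fun j => D j ω) 0 t - θs)
        (∑ i ∈ Finset.range n, (chain γ θ₀ (fun j => D j ω) 0 (t + i) - θs)) ∂μ
      = ∫ ω, inner ℝ (chain γ θ₀ (fun j => D j ω) 0 t - θs)
          (chain γ θ₀ (fun j => D j ω) 0 t - θs) ∂μ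
        - ∫ ω, inner ℝ (chain γ θ₀ (fun j => D j ω) 0 t - θs)
          (chain γ θ₀ (fun j => D j ω) 0 (t + n) - θs) ∂μ := by
  have hmem : ∀ n, MemLp (fun ω => chain γ θ₀ (fun j => D j ω) 0 n) 2 μ := fun n =>
    hD.memLp_chain hM hκ (X := fun _ => θ₀) measurable_const (memLp_const θ₀) n
  have hmem' : ∀ n, MemLp (fun ω => chain γ θ₀ (fun j => D j ω) 0 n - θs) 2 μ := fun n =>
    (hmem n).sub (memLp_const θs)
  induction n with
  | zero =>
    simp [hForm_eq_inner hM.memLp_x]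
  | succ n ih =>
    simp_rw [Finset.sum_range_succ, hM.hForm_add_right]
    rw [integral_add (hM.integrable_hForm (hmem' t) (memLp_finsetSum _ fun i _ => hmem' (t + i)))
      (hM.integrable_hForm (hmem' t) (hmem' _)), mul_add, ih]
    have hp : ∀ j : ℕ, j ≤ t + n → Measurable[past D ((0 : ℤ) + (t + n : ℕ))]
        fun ω => chain γ θ₀ (fun j => D j ω) 0 j := fun j hj =>
      measurable_past_chain (X := fun _ => θ₀) measurable_const j (by lia)
    have := hD.integral_inner_sgdStep hM hκ
      (X := fun ω => chain γ θ₀ (fun j => D j ω) 0 t - θs) ((hp t (by lia)).sub measurable_const)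
      (hp (t + n) le_rfl) (hmem' t) (hmem (t + n))
    rw [← add_assoc]
    simp only [chain] at this ⊢
    linarith

/-- The averaged iterates have excess risk of order `1 / (k - s)`. -/
theorem IsSample.integral_hForm_sum_chain_le (hD : IsSample P μ D) (hM : MomentBounds P θs σ R)
    (hγ : 0 < γ) (hκ : 0 ≤ γ * (2 - γ * R ^ 2)) {a : ℝ} (ha : 0 ≤ a)
    (haκ : γ ^ 2 * σ ^ 2 ≤ a * (γ * (2 - γ * R ^ 2))) (θ₀ : Vec d) (t n : ℕ) :
    ∫ ω, hForm P (∑ i ∈ Finset.range n, (chain γ θ₀ (fun j => D j ω) 0 (t + i) - θs))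
        (∑ i ∈ Finset.range n, (chain γ θ₀ (fun j => D j ω) 0 (t + i) - θs)) ∂μ
      ≤ n * (4 * (2 * ‖θ₀ - θs‖ ^ 2 + 2 * (a * d)) / γ) := by
  have hmem : ∀ n, MemLp (fun ω => chain γ θ₀ (fun j => D j ω) 0 n - θs) 2 μ := fun n =>
    (hD.memLp_chain hM hκ (X := fun _ => θ₀) measurable_const (memLp_const θ₀) n).sub
      (memLp_const θs)
  have hsum : ∀ t n, MemLp (fun ω => ∑ i ∈ Finset.range n,
      (chain γ θ₀ (fun j => D j ω) 0 (t + i) - θs)) 2 μ := fun t n =>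
    memLp_finsetSum _ fun i _ => hmem (t + i)
  induction n generalizing t with
  | zero => simp [hForm_eq_inner hM.memLp_x]
  | succ n ih =>
    have hsplit : ∀ ω, ∑ i ∈ Finset.range (n + 1), (chain γ θ₀ (fun j => D j ω) 0 (t + i) - θs)
        = (chain γ θ₀ (fun j => D j ω) 0 t - θs)
          + ∑ i ∈ Finset.range n, (chain γ θ₀ (fun j => D j ω) 0 (t + 1 + i) - θs) := fun ω => by
      rw [Finset.sum_range_succ', add_comm, add_zero]
      congr 1
      exact Finset.sum_congr rfl fun i _ => by rw [add_assoc, add_comm 1 i]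
    have hpt : ∀ ω, hForm P
        (∑ i ∈ Finset.range (n + 1), (chain γ θ₀ (fun j => D j ω) 0 (t + i) - θs))
        (∑ i ∈ Finset.range (n + 1), (chain γ θ₀ (fun j => D j ω) 0 (t + i) - θs))
        ≤ 2 * hForm P (chain γ θ₀ (fun j => D j ω) 0 t - θs)
          (∑ i ∈ Finset.range (n + 1), (chain γ θ₀ (fun j => D j ω) 0 (t + i) - θs))
        + hForm P (∑ i ∈ Finset.range n, (chain γ θ₀ (fun j => D j ω) 0 (t + 1 + i) - θs))
          (∑ i ∈ Finset.range n, (chain γ θ₀ (fun j => D j ω) 0 (t + 1 + i) - θs)) := fun ω => by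
      -- With first error `u` and remaining sum `v`, `‖u + v‖² = 2⟨u, u + v⟩ - ‖u‖² + ‖v‖²` in the
      -- `H`-form. The first term telescopes and the last is handled by induction, from a start one
      -- step later.
      rw [hsplit, hM.hForm_add_self, hM.hForm_add_right]
      linarith [hForm_self_nonneg (P := P) (chain γ θ₀ (fun j => D j ω) 0 t - θs)]
    have hi1 := (hM.integrable_hForm (hmem t) (hsum t (n + 1))).const_mul 2
    have hi2 := hM.integrable_hForm (hsum (t + 1) n) (hsum (t + 1) n)
    have h1 : ∫ ω, hForm P
        (∑ i ∈ Finset.range (n + 1), (chain γ θ₀ (fun j => D j ω) 0 (t + i) - θs))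
        (∑ i ∈ Finset.range (n + 1), (chain γ θ₀ (fun j => D j ω) 0 (t + i) - θs)) ∂μ
        ≤ 2 * ∫ ω, hForm P (chain γ θ₀ (fun j => D j ω) 0 t - θs)
          (∑ i ∈ Finset.range (n + 1), (chain γ θ₀ (fun j => D j ω) 0 (t + i) - θs)) ∂μ
        + ∫ ω, hForm P (∑ i ∈ Finset.range n, (chain γ θ₀ (fun j => D j ω) 0 (t + 1 + i) - θs))
          (∑ i ∈ Finset.range n, (chain γ θ₀ (fun j => D j ω) 0 (t + 1 + i) - θs)) ∂μ := by
      rw [← integral_const_mul, ← integral_add hi1 hi2]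
      exact integral_mono (hM.integrable_hForm (hsum t (n + 1)) (hsum t (n + 1))) (hi1.add hi2) hpt
    have h2 := hD.integral_hForm_chain_sum hM hκ θ₀ t (n + 1)
    have hK := fun n => hD.integral_norm_chain_sub_sq_le hM hκ ha haκ θ₀ 0 n
    have h3 : -∫ ω, inner ℝ (chain γ θ₀ (fun j => D j ω) 0 t - θs)
        (chain γ θ₀ (fun j => D j ω) 0 (t + (n + 1)) - θs) ∂μ
        ≤ 2 * ‖θ₀ - θs‖ ^ 2 + 2 * (a * d) := by
      have hj1 := ((hmem t).integrable_norm_pow two_ne_zero).div_const 2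
      have hj2 := ((hmem (t + (n + 1))).integrable_norm_pow two_ne_zero).div_const 2
      rw [← integral_neg]
      calc _ ≤ ∫ ω, (‖chain γ θ₀ (fun j => D j ω) 0 t - θs‖ ^ 2 / 2
            + ‖chain γ θ₀ (fun j => D j ω) 0 (t + (n + 1)) - θs‖ ^ 2 / 2) ∂μ := by
            refine integral_mono (integrable_inner_of_memLp (hmem t) (hmem _)).neg
              (hj1.add hj2) fun ω => ?_
            have := norm_add_sq_real (chain γ θ₀ (fun j => D j ω) 0 t - θs)
              (chain γ θ₀ (fun j => D j ω) 0 (t + (n + 1)) - θs)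
            change -_ ≤ _
            simp only at this ⊢
            nlinarith [sq_nonneg ‖(chain γ θ₀ (fun j => D j ω) 0 t - θs)
              + (chain γ θ₀ (fun j => D j ω) 0 (t + (n + 1)) - θs)‖]
        _ ≤ _ := by
            rw [integral_add hj1 hj2, integral_div, integral_div]
            linarith [hK t, hK (t + (n + 1))]
    have h4 : ∫ ω, inner ℝ (chain γ θ₀ (fun j => D j ω) 0 t - θs)
        (chain γ θ₀ (fun j => D j ω) 0 t - θs) ∂μ ≤ 2 * ‖θ₀ - θs‖ ^ 2 + 2 * (a * d) := by
      simp_rw [real_inner_self_eq_norm_sq]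
      exact hK t
    have h5 : ∫ ω, hForm P (chain γ θ₀ (fun j => D j ω) 0 t - θs)
          (∑ i ∈ Finset.range (n + 1), (chain γ θ₀ (fun j => D j ω) 0 (t + i) - θs)) ∂μ
        -- Both Euclidean correlations left by the telescoping are controlled by the uniform
        -- second-moment bound, so the correlation with the whole sum does not grow with `n`.
        ≤ 2 * (2 * ‖θ₀ - θs‖ ^ 2 + 2 * (a * d)) / γ := by
      rw [le_div_iff₀ hγ]
      linarith
    have h6 := ih (t + 1)
    have h7 : 4 * (2 * ‖θ₀ - θs‖ ^ 2 + 2 * (a * d)) / γ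
        = 2 * (2 * (2 * ‖θ₀ - θs‖ ^ 2 + 2 * (a * d)) / γ) := by ring
    push_cast
    linarith

theorem thetaBar_sub (γ : ℝ) (θ₀ θs : Vec d) {s k : ℕ} (hsk : s < k) (D : ℤ → Vec d × ℝ) :
    thetaBar γ θ₀ s k D - θs
      = ((k - s : ℕ) : ℝ)⁻¹ • ∑ i ∈ Finset.range (k - s), (chain γ θ₀ D 0 (s + i) - θs) := by
  have hne : ((k - s : ℕ) : ℝ) ≠ 0 := by exact_mod_cast (Nat.sub_pos_of_lt hsk).ne'
  rw [thetaBar, Finset.sum_Ico_eq_sum_range, ← Nat.cast_sub hsk.le, Finset.sum_sub_distrib,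
    Finset.sum_const, Finset.card_range, smul_sub, ← Nat.cast_smul_eq_nsmul ℝ,
    inv_smul_smul₀ hne]

theorem IsSample.memLp_thetaBar (hD : IsSample P μ D) (hM : MomentBounds P θs σ R)
    (hκ : 0 ≤ γ * (2 - γ * R ^ 2)) (θ₀ : Vec d) (s k : ℕ) :
    MemLp (fun ω => thetaBar γ θ₀ s k (fun j => D j ω)) 2 μ := by
  have h : MemLp (fun ω => ∑ t ∈ Finset.Ico s k, chain γ θ₀ (fun j => D j ω) 0 t) 2 μ :=
    memLp_finsetSum _ fun i _ =>
      hD.memLp_chain hM hκ (X := fun _ => θ₀) measurable_const (memLp_const θ₀) i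
  exact h.const_smul ((k : ℝ) - s)⁻¹

theorem IsSample.integral_hForm_thetaBar_le (hD : IsSample P μ D) (hM : MomentBounds P θs σ R)
    (hγ : 0 < γ) (hγR : 0 < 2 - γ * R ^ 2) (θ₀ : Vec d) {s k : ℕ} (hsk : s < k) :
    ∫ ω, hForm P (thetaBar γ θ₀ s k (fun j => D j ω) - θs)
        (thetaBar γ θ₀ s k (fun j => D j ω) - θs) ∂μ
      ≤ 16 * cConst γ σ R θ₀ θs / (k - s : ℕ) := by
  have hκ : 0 < γ * (2 - γ * R ^ 2) := mul_pos hγ hγR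
  set a := γ * σ ^ 2 / (2 - γ * R ^ 2) with ha_def
  have ha : 0 ≤ a := by positivity
  have haκ : a * (γ * (2 - γ * R ^ 2)) = γ ^ 2 * σ ^ 2 := by rw [ha_def]; field_simp
  have hpos : (0 : ℝ) < (k - s : ℕ) := by exact_mod_cast Nat.sub_pos_of_lt hsk
  have h := hD.integral_hForm_sum_chain_le hM hγ hκ.le ha haκ.ge θ₀ s (k - s)
  simp_rw [thetaBar_sub γ θ₀ θs hsk, hM.hForm_smul_self]
  rw [integral_const_mul]
  -- The left side equals `8(2 - γR²)c`, and `2 - γR² ≤ 2`.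
  have hc : 4 * (2 * ‖θ₀ - θs‖ ^ 2 + 2 * (a * d)) / γ ≤ 16 * cConst γ σ R θ₀ θs := by
    have h1 : 4 * (2 * ‖θ₀ - θs‖ ^ 2 + 2 * (a * d)) / γ
        = 8 * (2 - γ * R ^ 2) * cConst γ σ R θ₀ θs := by
      rw [cConst, ha_def]; field_simp; ring
    have hc0 : 0 ≤ cConst γ σ R θ₀ θs := by unfold cConst; positivity
    rw [h1]
    have : 2 - γ * R ^ 2 ≤ 2 := by nlinarith [sq_nonneg R]
    nlinarith
  calc _ ≤ (((k - s : ℕ) : ℝ)⁻¹) ^ 2 * ((k - s : ℕ) * (16 * cConst γ σ R θ₀ θs)) := by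
        refine mul_le_mul_of_nonneg_left (h.trans ?_) (sq_nonneg _)
        exact mul_le_mul_of_nonneg_left hc hpos.le
    _ = _ := by field_simp

end Averaging

/-! ### Level probabilities and numerical series -/

section Series

/-- The subtracted term of `p_l` is at most half of the first one. -/
theorem half_rpow_le_levelProb {δ : ℝ} (hδ : 0 ≤ δ) (l : ℕ) :
    (2 ^ (l + 1) * ((l : ℝ) + 1) ^ δ)⁻¹ ≤ levelProb δ l := by
  have h1 : (0 : ℝ) < ((l : ℝ) + 1) ^ δ := Real.rpow_pos_of_pos (by positivity) _
  have h2 : ((l : ℝ) + 1) ^ δ ≤ ((l : ℝ) + 2) ^ δ :=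
    Real.rpow_le_rpow (by positivity) (by linarith) hδ
  have h3 : 1 / (2 ^ (l + 1) * ((l : ℝ) + 2) ^ δ) ≤ 1 / (2 ^ (l + 1) * ((l : ℝ) + 1) ^ δ) := by
    gcongr
  have h4 : 1 / (2 ^ l * ((l : ℝ) + 1) ^ δ) = 2 * (1 / (2 ^ (l + 1) * ((l : ℝ) + 1) ^ δ)) := by
    rw [pow_succ]; field_simp
  rw [levelProb, h4, inv_eq_one_div]
  linarith

theorem levelProb_pos {δ : ℝ} (hδ : 0 ≤ δ) (l : ℕ) : 0 < levelProb δ l :=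
  lt_of_lt_of_le (inv_pos.2 (mul_pos (by positivity) (Real.rpow_pos_of_pos (by positivity) _)))
    (half_rpow_le_levelProb hδ l)

theorem inv_levelProb_le {δ : ℝ} (hδ : 0 ≤ δ) (l : ℕ) :
    (levelProb δ l)⁻¹ ≤ 2 ^ (l + 1) * ((l : ℝ) + 1) ^ δ :=
  inv_le_of_inv_le₀ (mul_pos (by positivity) (Real.rpow_pos_of_pos (by positivity) _))
    (half_rpow_le_levelProb hδ l)

theorem two_pow_mul_levelProb (δ : ℝ) (l : ℕ) :
    2 ^ l * levelProb δ l = ((l : ℝ) + 1) ^ (-δ) - ((l : ℝ) + 2) ^ (-δ) / 2 := by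
  rw [levelProb, Real.rpow_neg (by positivity), Real.rpow_neg (by positivity), pow_succ]
  have h1 : (0 : ℝ) < ((l : ℝ) + 1) ^ δ := Real.rpow_pos_of_pos (by positivity) _
  have h2 : (0 : ℝ) < ((l : ℝ) + 2) ^ δ := Real.rpow_pos_of_pos (by positivity) _
  field_simp

/-- Comparison of `(x + 1)^(-δ)` with a telescoping difference. -/
theorem rpow_neg_le_sub {δ : ℝ} (hδ : 1 < δ) {x : ℝ} (hx : 0 < x) :
    (x + 1) ^ (-δ) ≤ (x ^ (1 - δ) - (x + 1) ^ (1 - δ)) / (δ - 1) := by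
  rw [le_div_iff₀ (by linarith)]
  have hx1 : 0 < x + 1 := by linarith
  -- Bernoulli's inequality for the negative exponent `1 - δ`, obtained from `exp y ≥ 1 + y` and
  -- `log y ≥ 1 - 1/y`.
  have hb : 1 + (1 - δ) * (-(1 / (x + 1))) ≤ (1 + -(1 / (x + 1))) ^ (1 - δ) := by
    have hs : 1 + -(1 / (x + 1)) = x / (x + 1) := by field_simp; ring
    have h1 := Real.one_sub_inv_le_log_of_pos (x := (x + 1) / x) (by positivity)
    have h2 := Real.add_one_le_exp (Real.log (x / (x + 1)) * (1 - δ))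
    rw [hs, Real.rpow_def_of_pos (by positivity)]
    refine le_trans ?_ h2
    have h3 : Real.log (x / (x + 1)) = -Real.log ((x + 1) / x) := by
      rw [← Real.log_inv, inv_div]
    have h4 : 1 - ((x + 1) / x)⁻¹ = 1 / (x + 1) := by field_simp; ring
    rw [h3]
    rw [h4] at h1
    nlinarith
  have hs : 1 + -(1 / (x + 1)) = x / (x + 1) := by field_simp; ring
  rw [hs, Real.div_rpow hx.le hx1.le, le_div_iff₀ (Real.rpow_pos_of_pos hx1 _)] at hb
  have h5 : (x + 1) ^ (1 - δ) = (x + 1) ^ (-δ) * (x + 1) := by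
    rw [sub_eq_neg_add, Real.rpow_add hx1, Real.rpow_one]
  have h6 : (1 + (1 - δ) * (-(1 / (x + 1)))) * ((x + 1) ^ (-δ) * (x + 1))
      = (x + 1) ^ (-δ) * (x + 1) + (δ - 1) * (x + 1) ^ (-δ) := by field_simp; ring
  rw [h5, h6] at hb
  rw [h5]
  linarith

/-- A discrete integral comparison: the first term is 1 and the others telescope to at most `1/(δ -
1)`. The induction keeps the remainder `(n + 1)^(1 - δ)/(δ - 1)`. -/
theorem sum_rpow_neg_le {δ : ℝ} (hδ : 1 < δ) (n : ℕ) :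
    ∑ l ∈ Finset.range n, ((l : ℝ) + 1) ^ (-δ) ≤ δ / (δ - 1) := by
  have hδ' : 0 < δ - 1 := by linarith
  have h : ∀ n : ℕ, ∑ l ∈ Finset.range (n + 1), ((l : ℝ) + 1) ^ (-δ)
      ≤ δ / (δ - 1) - ((n : ℝ) + 1) ^ (1 - δ) / (δ - 1) := fun n => by
    induction n with
    | zero =>
      simp only [zero_add, Finset.range_one, Finset.sum_singleton, Nat.cast_zero, Real.one_rpow]
      rw [← sub_div, div_self hδ'.ne']
    | succ n ih =>
      rw [Finset.sum_range_succ]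
      have := rpow_neg_le_sub hδ (x := (n : ℝ) + 1) (by positivity)
      rw [sub_div] at this
      push_cast
      linarith
  cases n with
  | zero => simp only [Finset.range_zero, Finset.sum_empty]; positivity
  | succ n =>
    refine (h n).trans (sub_le_self _ ?_)
    have := Real.rpow_nonneg (by positivity : (0 : ℝ) ≤ (n : ℝ) + 1) (1 - δ)
    positivity

/-- Half of each `(l + 1)^(-δ)` telescopes, leaving half of the series plus at most `1/2`; and `1 ≤
δ/(δ - 1)`. -/
theorem sum_two_pow_mul_levelProb_le {δ : ℝ} (hδ : 1 < δ) (n : ℕ) :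
    ∑ l ∈ Finset.range n, 2 ^ l * levelProb δ l ≤ δ / (δ - 1) := by
  have h : ∀ n : ℕ, ∑ l ∈ Finset.range n, 2 ^ l * levelProb δ l
      = (∑ l ∈ Finset.range n, ((l : ℝ) + 1) ^ (-δ)) / 2 + (1 - ((n : ℝ) + 1) ^ (-δ)) / 2 :=
    fun n => by
      induction n with
      | zero => simp
      | succ n ih =>
        rw [Finset.sum_range_succ, ih, Finset.sum_range_succ, two_pow_mul_levelProb]
        push_cast
        ring_nf
  have h1 := sum_rpow_neg_le hδ n
  have h2 := Real.rpow_nonneg (by positivity : (0 : ℝ) ≤ (n : ℝ) + 1) (-δ)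
  have h3 : 1 ≤ δ / (δ - 1) := by rw [le_div_iff₀ (by linarith)]; linarith
  rw [h]
  linarith

/-- The number of levels that contribute to the variance is logarithmic. -/
theorem sum_rpow_mul_exp_le {δ ξ : ℝ} (hδ : 0 ≤ δ) (hξ : 0 < ξ) {L : ℕ}
    (hL : (4 * δ + 8) / ξ ≤ 2 ^ L) (n : ℕ) :
    ∑ m ∈ Finset.range n, ((m : ℝ) + 1) ^ δ * Real.exp (-ξ * 2 ^ m) ≤ ((L : ℝ) + 1) ^ (δ + 1) := by
  have hL1 : (0 : ℝ) < ((L : ℝ) + 1) ^ δ := Real.rpow_pos_of_pos (by positivity) _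
  rw [div_le_iff₀ hξ] at hL
  -- Below the cutoff `L` the exponential is bounded by 1. Beyond it, with `m = L + j`, the growth
  -- `(m + 1)^δ ≤ (L + 1)^δ exp(jδ)` is beaten by `ξ2^m ≥ (4δ + 8)(j + 1)`, leaving a geometric tail
  -- of total mass 1.
  have hterm : ∀ m : ℕ, ((m : ℝ) + 1) ^ δ * Real.exp (-ξ * 2 ^ m)
      ≤ ((L : ℝ) + 1) ^ δ * if m < L then 1 else (1 / 2) ^ (m - L + 1) := fun m => by
    split_ifs with hm
    · have h1 : ((m : ℝ) + 1) ^ δ ≤ ((L : ℝ) + 1) ^ δ := by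
        have : (m : ℝ) ≤ L := by exact_mod_cast hm.le
        exact Real.rpow_le_rpow (by positivity) (by linarith) hδ
      have h2 : Real.exp (-ξ * 2 ^ m) ≤ 1 := by
        rw [Real.exp_le_one_iff, neg_mul, neg_nonpos]; positivity
      exact mul_le_mul h1 h2 (Real.exp_nonneg _) hL1.le
    · obtain ⟨j, rfl⟩ := Nat.exists_eq_add_of_le (not_lt.1 hm)
      have hj : (j : ℝ) + 1 ≤ Real.exp j := Real.add_one_le_exp _
      have h1 : (((L + j : ℕ) : ℝ) + 1) ^ δ ≤ ((L : ℝ) + 1) ^ δ * Real.exp (j * δ) := by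
        rw [Real.exp_mul, ← Real.mul_rpow (by positivity) (Real.exp_nonneg _)]
        refine Real.rpow_le_rpow (by positivity) ?_ hδ
        push_cast
        nlinarith [(Nat.cast_nonneg L : (0 : ℝ) ≤ L), (Nat.cast_nonneg j : (0 : ℝ) ≤ j)]
      have h2 : (j : ℝ) + 1 ≤ 2 ^ j := by
        exact_mod_cast Nat.lt_two_pow_self
      have h3 : -ξ * 2 ^ (L + j) ≤ -(4 * δ + 8) * (j + 1) := by
        rw [pow_add]
        have : (4 * δ + 8) * (j + 1) ≤ 2 ^ L * ξ * 2 ^ j :=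
          mul_le_mul hL h2 (by positivity) (by positivity)
        nlinarith
      have h4 : Real.exp (j * δ) * Real.exp (-ξ * 2 ^ (L + j)) ≤ (1 / 2) ^ (j + 1) := by
        rw [← Real.exp_add]
        have h5 : (1 / 2 : ℝ) = Real.exp (-Real.log 2) := by
          rw [Real.exp_neg, Real.exp_log (by norm_num)]; norm_num
        rw [h5, ← Real.exp_nat_mul]
        refine Real.exp_le_exp.2 ?_
        have := Real.log_two_lt_d9
        push_cast
        have hj0 : (0 : ℝ) ≤ j := Nat.cast_nonneg j
        nlinarith [mul_nonneg hj0 hδ]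
      rw [Nat.add_sub_cancel_left]
      calc _ ≤ ((L : ℝ) + 1) ^ δ * Real.exp (j * δ) * Real.exp (-ξ * 2 ^ (L + j)) :=
            mul_le_mul_of_nonneg_right h1 (Real.exp_nonneg _)
        _ ≤ _ := by
            rw [mul_assoc]
            exact mul_le_mul_of_nonneg_left h4 hL1.le
  have hsum : ∀ n : ℕ, ∑ m ∈ Finset.range n, (if m < L then (1 : ℝ) else (1 / 2) ^ (m - L + 1))
      ≤ min n L + 1 - (1 / 2) ^ (n - L) := fun n => by
    induction n with
    | zero => simp
    | succ n ih =>
      rw [Finset.sum_range_succ]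
      split_ifs with hn
      · rw [min_eq_left (by exact_mod_cast hn.le), Nat.sub_eq_zero_of_le hn.le] at ih
        rw [min_eq_left (by exact_mod_cast hn), Nat.sub_eq_zero_of_le hn]
        push_cast
        linarith
      · have hn' : L ≤ n := not_lt.1 hn
        rw [min_eq_right (by exact_mod_cast hn')] at ih
        rw [min_eq_right (by exact_mod_cast hn'.trans n.le_succ), Nat.sub_add_comm hn', pow_succ]
        linarith
  calc _ ≤ ∑ m ∈ Finset.range n,
        ((L : ℝ) + 1) ^ δ * (if m < L then 1 else (1 / 2) ^ (m - L + 1)) :=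
        Finset.sum_le_sum fun m _ => hterm m
    _ = ((L : ℝ) + 1) ^ δ *
        ∑ m ∈ Finset.range n, (if m < L then (1 : ℝ) else (1 / 2) ^ (m - L + 1)) := by
        rw [Finset.mul_sum]
    _ ≤ ((L : ℝ) + 1) ^ δ * ((L : ℝ) + 1) := by
        refine mul_le_mul_of_nonneg_left ((hsum n).trans ?_) hL1.le
        have h1 : ((min n L : ℕ) : ℝ) ≤ L := by exact_mod_cast min_le_right n L
        have h2 : (0 : ℝ) ≤ (1 / 2) ^ (n - L) := by positivity
        linarith
    _ = _ := by rw [Real.rpow_add (by positivity), Real.rpow_one]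

/-- `L` is the ceiling of `r = log₂ u`, `u = (4δ + 8)/ξ`. As `ξ ≤ 1`, `u ≥ 8` and `r ≥ 3`; as `α ≤
1/2`, the final logarithm is at least `log(2u) = (r + 1) log 2`. With `log 2 > 0.69` this gives `L +
1 ≤ r + 2 ≤ 2(r + 1) log 2` and `4 log 2 ≥ 5/2`. -/
theorem exists_level_cutoff {δ ξ α : ℝ} (hδ : 0 ≤ δ) (hξ : 0 < ξ) (hξ1 : ξ ≤ 1) (hα : 0 < α)
    (hα2 : α ≤ 1 / 2) : ∃ L : ℕ, (4 * δ + 8) / ξ ≤ 2 ^ L ∧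
      (L : ℝ) + 1 ≤ 2 * Real.log ((4 * δ + 8) / (α * ξ)) ∧
      5 / 2 ≤ Real.log ((4 * δ + 8) / (α * ξ)) := by
  set u := (4 * δ + 8) / ξ with hu
  have hu8 : 8 ≤ u := by rw [hu, le_div_iff₀ hξ]; linarith
  have hu0 : 0 < u := by linarith
  set r := Real.logb 2 u with hr
  have hr3 : 3 ≤ r := by
    rw [hr, Real.le_logb_iff_rpow_le (by norm_num) hu0]
    norm_num
    exact hu8
  have hlog : Real.log u = r * Real.log 2 := by
    rw [hr, Real.logb, div_mul_cancel₀ _ (Real.log_pos (by norm_num)).ne']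
  have hΛ : (r + 1) * Real.log 2 ≤ Real.log ((4 * δ + 8) / (α * ξ)) := by
    have : 2 * u ≤ (4 * δ + 8) / (α * ξ) := by
      rw [hu, mul_comm α, ← div_div, le_div_iff₀ hα]
      nlinarith
    refine le_trans (le_of_eq ?_) (Real.log_le_log (by positivity) this)
    rw [Real.log_mul (by norm_num) hu0.ne', hlog]
    ring
  have hl2 := Real.log_two_gt_d9
  refine ⟨⌈r⌉₊, ?_, ?_, ?_⟩
  · rw [← Real.rpow_natCast, ← Real.logb_le_iff_le_rpow (by norm_num) hu0]
    exact Nat.le_ceil _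
  · have := Nat.ceil_lt_add_one (by linarith : 0 ≤ r)
    nlinarith
  · nlinarith

end Series

/-! ### Second moment of the randomized multilevel estimator -/

section Estimator

variable {d : ℕ} {P : Measure (Vec d × ℝ)} [IsProbabilityMeasure P]
  {Ω : Type*} [MeasurableSpace Ω] {μ : Measure Ω} [IsProbabilityMeasure μ]
  {D : ℤ → Ω → Vec d × ℝ} {θs : Vec d} {σ R γ ξ δ : ℝ}
  {s k : ℕ} {τ : ℕ → Ω → ℕ} {N : Ω → ℕ}

theorem lintegral_comp_nat (hN : Measurable N) (φ : ℕ → ℝ≥0∞) :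
    ∫⁻ ω, φ (N ω) ∂μ = ∑' l, φ l * μ {ω | N ω = l} := by
  rw [← lintegral_map (measurable_of_countable φ) hN, lintegral_countable']
  refine tsum_congr fun l => ?_
  rw [Measure.map_apply hN (measurableSet_singleton l)]
  rfl

theorem MomentBounds.hSq_smul (hM : MomentBounds P θs σ R) (c : ℝ) (u : Vec d) :
    hSq P (c • u) = ENNReal.ofReal (c ^ 2) * hSq P u := by
  rw [hM.hSq_eq, hM.hForm_smul_self, ENNReal.ofReal_mul (sq_nonneg c), hM.hSq_eq]

/-- Gives square-integrability in the Euclidean norm from a finite second moment in the `H`-norm. -/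
theorem MomentBounds.normSq_le (hM : MomentBounds P θs σ R) (hκ : 0 < γ * (2 - γ * R ^ 2))
    (hξ0 : 0 < ξ) (hξ : ∀ u, ξ * ‖u‖ ^ 2 ≤ γ * (2 - γ * R ^ 2) * hForm P u u) (u : Vec d) :
    normSq u ≤ ENNReal.ofReal (γ * (2 - γ * R ^ 2) / ξ) * hSq P u := by
  rw [hM.hSq_eq, ← ENNReal.ofReal_mul (by positivity), normSq]
  refine ENNReal.ofReal_le_ofReal ?_
  rw [div_mul_eq_mul_div, le_div_iff₀ hξ0, mul_comm]
  exact hξ u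

theorem measurable_zEst (γ δ : ℝ) (θ₀ : Vec d) :
    Measurable fun p : ℕ × ((ℤ → Vec d × ℝ) × (ℕ → ℕ)) => zEst γ δ θ₀ p.2.1 p.2.2 p.1 := by
  refine measurable_from_prod_countable_right fun l => ?_
  exact ((measurable_level γ θ₀ (l + 1)).sub (measurable_level γ θ₀ l)).const_smul
    (levelProb δ l)⁻¹

/-- The second moment of the randomized multilevel estimator. -/
theorem IsSample.lintegral_hSq_zEst_le (hD : IsSample P μ D) (hM : MomentBounds P θs σ R)
    (hγ : 0 < γ) (hγR : 0 < 2 - γ * R ^ 2) (hξ0 : 0 < ξ)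
    (hξ : ∀ u, ξ * ‖u‖ ^ 2 ≤ γ * (2 - γ * R ^ 2) * hForm P u u) (hδ : 0 ≤ δ) (θ₀ : Vec d)
    (hk : 2 ≤ k) (hsk : s < k) (hsk3 : k ≤ 3 * (k - s)) (hτm : ∀ l, Measurable (τ l))
    (hτlaw : ∀ l, HasLaw (τ l) (uniformOn (tauRange s k l : Set ℕ)) μ)
    (hDτ : IndepFun (fun ω t => D t ω) (fun ω l => τ l ω) μ) (hNm : Measurable N)
    (hNlaw : ∀ l, μ {ω | N ω = l} = ENNReal.ofReal (levelProb δ l))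
    (hNind : IndepFun N (fun ω => ((fun t => D t ω), (fun l => τ l ω))) μ) {S : ℝ}
    (hS : ∀ n, ∑ m ∈ Finset.range n, ((m : ℝ) + 1) ^ δ * Real.exp (-ξ * 2 ^ m) ≤ S) :
    ∫⁻ ω, hSq P (zEst γ δ θ₀ (fun t => D t ω) (fun l => τ l ω) (N ω)) ∂μ
      ≤ ENNReal.ofReal (12 * cConst γ σ R θ₀ θs * (3 + S) / k) := by
  have hDm : Measurable fun ω t => D t ω := measurable_pi_lambda _ hD.measurable
  have hτm' : Measurable fun ω l => τ l ω := measurable_pi_lambda _ hτm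
  have hc : 0 ≤ cConst γ σ R θ₀ θs := by unfold cConst; positivity
  have hk0 : (0 : ℝ) < k := by exact_mod_cast (by lia : 0 < k)
  have hp := levelProb_pos hδ
  set w : ℕ → ℝ := fun m => ((m : ℝ) + 1) ^ δ * Real.exp (-ξ * 2 ^ m) with hw
  have hw0 : ∀ m, 0 ≤ w m := fun m =>
    mul_nonneg (Real.rpow_nonneg (by positivity) _) (Real.exp_nonneg _)
  -- On `N = l` the weight is `p_l⁻²` and the probability `p_l`, so `p_l⁻¹ ≤ 2^(l+1) (l+1)^δ`
  -- remains. For `l ≥ 1` the range has length `k2^l` and starts at `k(2^l - 1) ≥ 2^l` because `k ≥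
  -- 2`, which leaves `w l`. For `l = 0` the length is `k - s ≥ k/3`, whence the constant 3.
  have hlevel : ∀ l, ENNReal.ofReal ((levelProb δ l)⁻¹ ^ 2) *
      (∫⁻ ω, hSq P (level γ θ₀ (fun t => D t ω) (fun l => τ l ω) (l + 1)
        - level γ θ₀ (fun t => D t ω) (fun l => τ l ω) l) ∂μ) * μ {ω | N ω = l}
      ≤ ENNReal.ofReal ((if l = 0 then 3 else w l) * (12 * cConst γ σ R θ₀ θs / k)) := fun l => by
    rw [hNlaw, mul_right_comm, ← ENNReal.ofReal_mul (by positivity)]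
    refine (mul_le_mul_right (hD.lintegral_hSq_level_sub_le hM hγ hγR hξ0.le hξ θ₀ hsk hτm hτlaw
      hDτ l) _).trans ?_
    have hpp : (levelProb δ l)⁻¹ ^ 2 * levelProb δ l = (levelProb δ l)⁻¹ := by
      have := (hp l).ne'
      field_simp
    rw [hpp, ← ENNReal.ofReal_mul (inv_nonneg.2 (hp l).le)]
    refine ENNReal.ofReal_le_ofReal ?_
    have hinv := inv_levelProb_le hδ l
    have hgap : (0 : ℝ) < (tauLo s k (l + 1) - tauLo s k l : ℕ) := by
      exact_mod_cast Nat.sub_pos_of_lt (tauLo_lt_succ hsk l)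
    refine (mul_le_mul_of_nonneg_right hinv (by positivity)).trans ?_
    cases l with
    | zero =>
      have h3 : (k : ℝ) ≤ 3 * (k - s : ℕ) := by exact_mod_cast hsk3
      have h0 : (0 : ℝ) < (k - s : ℕ) := by linarith
      have hexp : Real.exp (-ξ * s) ≤ 1 := by
        rw [Real.exp_le_one_iff, neg_mul, neg_nonpos]; positivity
      have h1 : Real.exp (-ξ * s) / (k - s : ℕ) ≤ 3 / k := by
        rw [div_le_div_iff₀ h0 hk0]
        nlinarith
      have h2 : 0 ≤ 12 * cConst γ σ R θ₀ θs := by positivity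
      have := mul_le_mul_of_nonneg_left h1 h2
      simp only [tauLo, zero_add, pow_one, Nat.cast_zero, Real.one_rpow, if_true, mul_one,
        Nat.add_one_sub_one]
      calc _ = 12 * cConst γ σ R θ₀ θs * (Real.exp (-ξ * s) / (k - s : ℕ)) := by ring
        _ ≤ 12 * cConst γ σ R θ₀ θs * (3 / k) := this
        _ = _ := by ring
    | succ l =>
      have hg : tauLo s k (l + 1 + 1) - tauLo s k (l + 1) = k * 2 ^ (l + 1) := by
        rw [tauLo_succ_succ]; lia
      have hlo : (2 : ℝ) ^ (l + 1) ≤ tauLo s k (l + 1) := by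
        have h1 : 2 ^ (l + 1) ≤ tauLo s k (l + 1) := by
          simp only [tauLo]
          have : 2 * (2 ^ (l + 1) - 1) ≤ k * (2 ^ (l + 1) - 1) := Nat.mul_le_mul_right _ hk
          have h2 : 2 ≤ 2 ^ (l + 1) := by rw [pow_succ]; have := Nat.one_le_two_pow (n := l); lia
          lia
        exact_mod_cast h1
      have hexp : Real.exp (-ξ * tauLo s k (l + 1)) ≤ Real.exp (-ξ * 2 ^ (l + 1)) :=
        Real.exp_le_exp.2 (by nlinarith)
      rw [hg, if_neg (Nat.succ_ne_zero l), hw]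
      have hr : 0 ≤ (((l + 1 : ℕ) : ℝ) + 1) ^ δ := Real.rpow_nonneg (by positivity) _
      have := mul_le_mul_of_nonneg_left hexp
        (by positivity : 0 ≤ (((l + 1 : ℕ) : ℝ) + 1) ^ δ * (12 * cConst γ σ R θ₀ θs / k))
      calc _ = (((l + 1 : ℕ) : ℝ) + 1) ^ δ * (12 * cConst γ σ R θ₀ θs / k)
            * Real.exp (-ξ * tauLo s k (l + 1)) := by
            push_cast
            rw [pow_succ 2 (l + 1)]
            field_simp
            ring
        _ ≤ _ := this
        _ = _ := by ring
  have hg : Measurable fun p : ℕ × ((ℤ → Vec d × ℝ) × (ℕ → ℕ)) =>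
      hSq P (zEst γ δ θ₀ p.2.1 p.2.2 p.1) := measurable_hSq.comp (measurable_zEst γ δ θ₀)
  refine (hNind.lintegral_eq_lintegral_lintegral hNm (hDm.prodMk hτm') hg).trans_le ?_
  rw [lintegral_comp_nat hNm fun l => ∫⁻ ω, hSq P (zEst γ δ θ₀ (fun t => D t ω)
    (fun l => τ l ω) l) ∂μ]
  simp_rw [zEst, hM.hSq_smul, lintegral_const_mul' _ _ ENNReal.ofReal_ne_top]
  refine (ENNReal.tsum_le_tsum hlevel).trans (ENNReal.tsum_le_of_sum_range_le fun n => ?_)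
  have hite : ∀ l, 0 ≤ if l = 0 then 3 else w l := fun l => by
    split_ifs
    · norm_num
    · exact hw0 l
  rw [← ENNReal.ofReal_sum_of_nonneg fun l _ => mul_nonneg (hite l) (by positivity),
    ← Finset.sum_mul]
  refine ENNReal.ofReal_le_ofReal ?_
  have hsum : ∑ l ∈ Finset.range n, (if l = 0 then 3 else w l) ≤ 3 + S := by
    refine le_trans ?_ (add_le_add_right (hS n) 3)
    calc _ ≤ ∑ l ∈ Finset.range n, ((if l = 0 then 3 else 0) + w l) :=
          Finset.sum_le_sum fun l _ => by
            split_ifs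
            · linarith [hw0 l]
            · linarith
      _ ≤ _ := by
          rw [Finset.sum_add_distrib, Finset.sum_ite_eq']
          refine add_le_add_left ?_ _
          split_ifs <;> norm_num
  calc _ ≤ (3 + S) * (12 * cConst γ σ R θ₀ θs / k) :=
        mul_le_mul_of_nonneg_right hsum (by positivity)
    _ = _ := by ring

end Estimator

end LeastSquares

theorem ProbabilityTheory.IndepFun.integrable_integral {Ω E F G : Type*} [MeasurableSpace Ω]
    [MeasurableSpace E] [MeasurableSpace F] {μ : Measure Ω} [IsProbabilityMeasure μ] {X : Ω → E}
    {Y : Ω → F} [NormedAddCommGroup G] [NormedSpace ℝ G] [MeasurableSpace G] [BorelSpace G]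
    [SecondCountableTopology G] (h : IndepFun X Y μ) (hX : Measurable X) (hY : Measurable Y)
    {g : E × F → G} (hg : Measurable g) (hi : Integrable (fun ω => g (X ω, Y ω)) μ) :
    Integrable (fun ω => ∫ ω', g (X ω, Y ω') ∂μ) μ := by
  have := Measure.isProbabilityMeasure_map (μ := μ) hX.aemeasurable
  have := Measure.isProbabilityMeasure_map (μ := μ) hY.aemeasurable
  have h1 := (h.integrable_prod_map hX hY hg hi).integral_prod_left.comp_measurable hX
  refine h1.congr (.of_forall fun ω => ?_)
  exact integral_map hY.aemeasurable (hg.comp measurable_prodMk_left).aestronglyMeasurable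

namespace LeastSquares

/-! ### Bias of the chain and expectation of the multilevel estimator -/

section Mean

variable {d : ℕ} {P : Measure (Vec d × ℝ)} [IsProbabilityMeasure P]
  {Ω : Type*} [MeasurableSpace Ω] {μ : Measure Ω} [IsProbabilityMeasure μ]
  {D : ℤ → Ω → Vec d × ℝ} {θs : Vec d} {σ R γ ξ δ : ℝ}
  {s k : ℕ} {τ : ℕ → Ω → ℕ} {N : Ω → ℕ}

theorem IsSample.integral_chain_eq (hD : IsSample P μ D) (γ : ℝ) (θ₀ : Vec d) (m m' : ℤ) (n : ℕ) :
    ∫ ω, chain γ θ₀ (fun j => D j ω) m n ∂μ = ∫ ω, chain γ θ₀ (fun j => D j ω) m' n ∂μ := by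
  have hm : ∀ m, Measurable fun ω => chain γ θ₀ (fun j => D j ω) m n := fun m =>
    (measurable_chain γ θ₀ m n).comp (measurable_pi_lambda _ hD.measurable)
  have h := congrArg (fun ν => ∫ v, id v ∂ν) (hD.map_chain_eq γ θ₀ m m' n)
  rwa [integral_map (hm m).aemeasurable aestronglyMeasurable_id,
    integral_map (hm m').aemeasurable aestronglyMeasurable_id] at h

theorem norm_integral_sq_le {U : Ω → Vec d} (hU : MemLp U 2 μ) :
    ‖∫ ω, U ω ∂μ‖ ^ 2 ≤ ∫ ω, ‖U ω‖ ^ 2 ∂μ := by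
  set m := ∫ ω, U ω ∂μ with hm
  have hi := hU.integrable_norm_pow two_ne_zero
  have h1 : ‖m‖ ^ 2 = ∫ ω, inner ℝ m (U ω) ∂μ := by
    rw [integral_inner (hU.integrable one_le_two), ← hm, real_inner_self_eq_norm_sq]
  have h2 : ∫ ω, inner ℝ m (U ω) ∂μ ≤ ∫ ω, (2⁻¹ * ‖m‖ ^ 2 + 2⁻¹ * ‖U ω‖ ^ 2) ∂μ := by
    refine integral_mono ((hU.const_inner m).integrable one_le_two)
      ((integrable_const _).add (hi.const_mul 2⁻¹)) fun ω => ?_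
    have := real_inner_le_norm m (U ω)
    simp only
    nlinarith [sq_nonneg (‖m‖ - ‖U ω‖)]
  rw [integral_add (integrable_const _) (hi.const_mul 2⁻¹), integral_const_mul] at h2
  simp only [integral_const_mul, integral_const, probReal_univ, smul_eq_mul, one_mul] at h2
  linarith

/-- The bias of the chain decays exponentially. -/
theorem IsSample.norm_integral_chain_sub_sq_le (hD : IsSample P μ D) (hM : MomentBounds P θs σ R)
    (hγ : 0 < γ) (hγR : 0 < 2 - γ * R ^ 2)
    (hξ : ∀ u, ξ * ‖u‖ ^ 2 ≤ γ * (2 - γ * R ^ 2) * hForm P u u) (θ₀ : Vec d) (m : ℤ) (n : ℕ) :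
    ‖∫ ω, chain γ θ₀ (fun j => D j ω) m n ∂μ - θs‖ ^ 2
      ≤ Real.exp (-ξ * n) * ‖θ₀ - θs‖ ^ 2 := by
  have hκ : 0 < γ * (2 - γ * R ^ 2) := mul_pos hγ hγR
  have hmem : ∀ θ : Vec d, MemLp (fun ω => chain γ θ (fun j => D j ω) m n) 2 μ := fun θ =>
    hD.memLp_chain hM hκ.le (X := fun _ => θ) measurable_const (memLp_const θ) n
  have hu : MemLp (fun ω => chain γ θ₀ (fun j => D j ω) m n - chain γ θs (fun j => D j ω) m n)
    2 μ := (hmem θ₀).sub (hmem θs)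
  have hcov := hD.covBound_chain hM hκ.le (a := γ * σ ^ 2 / (2 - γ * R ^ 2)) (by positivity)
    (by field_simp; exact le_rfl) m n
  -- Started at `θ*`, the chain has mean `θ*` at all times, so the bias from `θ₀` is the mean of a
  -- noiseless difference.
  have hstat : ∫ ω, chain γ θs (fun j => D j ω) m n ∂μ = θs := by
    have h0 : ∫ ω, (chain γ θs (fun j => D j ω) m n - θs) ∂μ = 0 := by
      refine ext_inner_left ℝ fun u => ?_
      rw [← integral_inner (hcov.memLp.integrable one_le_two), hcov.mean, inner_zero_right]
    rw [integral_sub ((hmem θs).integrable one_le_two) (integrable_const _)] at h0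
    simpa [sub_eq_zero] using h0
  have h1 : ∫ ω, chain γ θ₀ (fun j => D j ω) m n ∂μ - θs
      = ∫ ω, (chain γ θ₀ (fun j => D j ω) m n - chain γ θs (fun j => D j ω) m n) ∂μ := by
    rw [integral_sub ((hmem θ₀).integrable one_le_two) ((hmem θs).integrable one_le_two), hstat]
  rw [h1]
  refine (norm_integral_sq_le hu).trans ?_
  rw [← ENNReal.ofReal_le_ofReal_iff (by positivity), ofReal_integral_eq_lintegral_ofReal
    (hu.integrable_norm_pow two_ne_zero) (.of_forall fun _ => sq_nonneg _)]
  refine (hD.lintegral_chain_sub_chain (X := fun _ => θ₀) (Y := fun _ => θs) measurable_const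
    measurable_const measurable_normSq n).trans_le ?_
  simp only [lintegral_const, measure_univ, mul_one]
  rw [ENNReal.ofReal_mul (Real.exp_nonneg _)]
  exact hM.iterate_transfer_normSq_le hξ n (θ₀ - θs)

theorem IsSample.memLp_level (hD : IsSample P μ D) (hM : MomentBounds P θs σ R)
    (hγ : 0 < γ) (hγR : 0 < 2 - γ * R ^ 2) (θ₀ : Vec d) (hτm : ∀ l, Measurable (τ l))
    (hDτ : IndepFun (fun ω t => D t ω) (fun ω l => τ l ω) μ) (l : ℕ) :
    MemLp (fun ω => level γ θ₀ (fun t => D t ω) (fun l => τ l ω) l) 2 μ := by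
  have hκ : 0 < γ * (2 - γ * R ^ 2) := mul_pos hγ hγR
  have hDm : Measurable fun ω t => D t ω := measurable_pi_lambda _ hD.measurable
  have hτm' : Measurable fun ω l => τ l ω := measurable_pi_lambda _ hτm
  have hg : Measurable fun p : (ℕ → ℕ) × (ℤ → Vec d × ℝ) => level γ θ₀ p.2 p.1 l - θs :=
    ((measurable_level γ θ₀ l).comp measurable_swap).sub measurable_const
  have h : MemLp (fun ω => level γ θ₀ (fun t => D t ω) (fun l => τ l ω) l - θs) 2 μ := by
    refine (memLp_two_iff (hg.comp (hτm'.prodMk hDm))).2 ?_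
    refine (hDτ.symm.lintegral_eq_lintegral_lintegral hτm' hDm
      (measurable_normSq.comp hg)).trans_lt ?_
    refine lt_of_le_of_lt (b := ∫⁻ _, ENNReal.ofReal
      (2 * ‖θ₀ - θs‖ ^ 2 + 2 * (γ * σ ^ 2 / (2 - γ * R ^ 2) * d)) ∂μ)
      (lintegral_mono fun ω => ?_) (by simp)
    have hmem : MemLp (fun ω' => chain γ θ₀ (fun t => D t ω') (-(τ l ω : ℤ)) (τ l ω) - θs) 2 μ :=
      (hD.memLp_chain hM hκ.le (X := fun _ => θ₀) measurable_const (memLp_const θ₀) _).sub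
        (memLp_const θs)
    refine le_trans (le_of_eq ?_) (ENNReal.ofReal_le_ofReal (hD.integral_norm_chain_sub_sq_le hM
      hκ.le (by positivity) (by field_simp; exact le_rfl) θ₀ (-(τ l ω : ℤ)) (τ l ω)))
    rw [ofReal_integral_eq_lintegral_ofReal (hmem.integrable_norm_pow two_ne_zero)
      (.of_forall fun _ => sq_nonneg _)]
    rfl
  refine (h.add (memLp_const θs)).ae_eq (.of_forall fun ω => ?_)
  simp

/-- Given `τ`, the law of the chain depends only on its length, so its start may be moved from `-τ`
to 0. Integrability of the inner mean is recorded for subtracting `θ*` under the integral. -/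
theorem IsSample.integral_level (hD : IsSample P μ D) (hM : MomentBounds P θs σ R)
    (hγ : 0 < γ) (hγR : 0 < 2 - γ * R ^ 2) (θ₀ : Vec d) (hτm : ∀ l, Measurable (τ l))
    (hDτ : IndepFun (fun ω t => D t ω) (fun ω l => τ l ω) μ) (l : ℕ) :
    Integrable (fun ω => ∫ ω', chain γ θ₀ (fun j => D j ω') 0 (τ l ω) ∂μ) μ ∧
    ∫ ω, level γ θ₀ (fun t => D t ω) (fun l => τ l ω) l ∂μ
      = ∫ ω, ∫ ω', chain γ θ₀ (fun j => D j ω') 0 (τ l ω) ∂μ ∂μ := by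
  have hDm : Measurable fun ω t => D t ω := measurable_pi_lambda _ hD.measurable
  have hτm' : Measurable fun ω l => τ l ω := measurable_pi_lambda _ hτm
  have hg : Measurable fun p : (ℕ → ℕ) × (ℤ → Vec d × ℝ) => level γ θ₀ p.2 p.1 l :=
    (measurable_level γ θ₀ l).comp measurable_swap
  have hi := (hD.memLp_level hM hγ hγR θ₀ hτm hDτ l).integrable one_le_two
  have heq : ∀ ω, ∫ ω', level γ θ₀ (fun t => D t ω') (fun l => τ l ω) l ∂μ
      = ∫ ω', chain γ θ₀ (fun j => D j ω') 0 (τ l ω) ∂μ := fun ω =>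
    hD.integral_chain_eq γ θ₀ _ _ _
  have h1 := hDτ.symm.integrable_integral hτm' hDm hg hi
  have h2 := hDτ.symm.integral_eq_integral_integral hτm' hDm hg hi
  simp only [heq] at h1 h2
  exact ⟨h1, h2⟩

theorem integral_uniformOn_finset (S : Finset ℕ) (φ : ℕ → Vec d) :
    ∫ n, φ n ∂(uniformOn (S : Set ℕ)) = (S.card : ℝ)⁻¹ • ∑ n ∈ S, φ n := by
  rw [uniformOn, ProbabilityTheory.cond, integral_smul_measure, Measure.count_apply_finset]
  rw [setIntegral_finset]
  · simp [measureReal_def]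
  · refine ⟨(measurable_of_countable φ).aestronglyMeasurable, ?_⟩
    rw [hasFiniteIntegral_iff_enorm, lintegral_finset]
    exact ENNReal.sum_lt_top.2 fun n _ => by simp

theorem tendsto_tauLo (s : ℕ) (hk : 0 < k) :
    Filter.Tendsto (fun l => (tauLo s k l : ℝ)) Filter.atTop Filter.atTop := by
  refine tendsto_natCast_atTop_atTop.comp ?_
  rw [← Filter.tendsto_add_atTop_iff_nat 1]
  refine Filter.tendsto_atTop_mono (fun l => ?_) Filter.tendsto_id
  simp only [tauLo, id]
  have h1 : l + 1 < 2 ^ (l + 1) := Nat.lt_two_pow_self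
  have h2 : 1 * (2 ^ (l + 1) - 1) ≤ k * (2 ^ (l + 1) - 1) := Nat.mul_le_mul_right _ hk
  lia

theorem IsSample.tendsto_integral_level (hD : IsSample P μ D) (hM : MomentBounds P θs σ R)
    (hγ : 0 < γ) (hγR : 0 < 2 - γ * R ^ 2) (hξ0 : 0 < ξ)
    (hξ : ∀ u, ξ * ‖u‖ ^ 2 ≤ γ * (2 - γ * R ^ 2) * hForm P u u) (θ₀ : Vec d)
    (hsk : s < k) (hτm : ∀ l, Measurable (τ l))
    (hτlaw : ∀ l, HasLaw (τ l) (uniformOn (tauRange s k l : Set ℕ)) μ)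
    (hDτ : IndepFun (fun ω t => D t ω) (fun ω l => τ l ω) μ) :
    Filter.Tendsto (fun l => ∫ ω, level γ θ₀ (fun t => D t ω) (fun l => τ l ω) l ∂μ)
      Filter.atTop (nhds θs) := by
  rw [tendsto_iff_norm_sub_tendsto_zero]
  have hb : ∀ l, ‖∫ ω, level γ θ₀ (fun t => D t ω) (fun l => τ l ω) l ∂μ - θs‖
      ≤ √(Real.exp (-ξ * tauLo s k l) * ‖θ₀ - θs‖ ^ 2) := fun l => by
    obtain ⟨h1, h2⟩ := hD.integral_level hM hγ hγR θ₀ hτm hDτ l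
    have h3 : ∫ ω, level γ θ₀ (fun t => D t ω) (fun l => τ l ω) l ∂μ - θs
        = ∫ ω, (∫ ω', chain γ θ₀ (fun j => D j ω') 0 (τ l ω) ∂μ - θs) ∂μ := by
      rw [integral_sub h1 (integrable_const _), h2]; simp
    rw [h3]
    have h4 := norm_integral_le_of_norm_le_const (μ := μ)
      (f := fun ω => ∫ ω', chain γ θ₀ (fun j => D j ω') 0 (τ l ω) ∂μ - θs)
      (C := √(Real.exp (-ξ * tauLo s k l) * ‖θ₀ - θs‖ ^ 2)) (by
        filter_upwards [HasLaw.mem_of_uniformOn (hτlaw l)] with ω hω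
        rw [tauRange_eq_Ico, Finset.mem_Ico] at hω
        refine Real.le_sqrt_of_sq_le ((hD.norm_integral_chain_sub_sq_le hM hγ hγR hξ θ₀ 0
          (τ l ω)).trans ?_)
        refine mul_le_mul_of_nonneg_right (Real.exp_le_exp.2 ?_) (sq_nonneg _)
        have : (tauLo s k l : ℝ) ≤ τ l ω := by exact_mod_cast hω.1
        nlinarith)
    simpa using h4
  refine squeeze_zero (fun _ => norm_nonneg _) hb ?_
  have h5 : Filter.Tendsto (fun l => -ξ * (tauLo s k l : ℝ)) Filter.atTop Filter.atBot :=
    (tendsto_tauLo s (by lia)).const_mul_atTop_of_neg (by linarith)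
  have h6 := ((Real.tendsto_exp_atBot.comp h5).mul_const (‖θ₀ - θs‖ ^ 2)).sqrt
  simpa using h6

/-- Averaging over a uniform time in `[s, k)` and taking the time average have the same mean. -/
theorem IsSample.integral_level_zero (hD : IsSample P μ D) (hM : MomentBounds P θs σ R)
    (hγ : 0 < γ) (hγR : 0 < 2 - γ * R ^ 2) (θ₀ : Vec d) (hsk : s < k)
    (hτm : ∀ l, Measurable (τ l))
    (hτlaw : ∀ l, HasLaw (τ l) (uniformOn (tauRange s k l : Set ℕ)) μ)
    (hDτ : IndepFun (fun ω t => D t ω) (fun ω l => τ l ω) μ) :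
    ∫ ω, level γ θ₀ (fun t => D t ω) (fun l => τ l ω) 0 ∂μ
      = ∫ ω, thetaBar γ θ₀ s k (fun j => D j ω) ∂μ := by
  have hκ : 0 < γ * (2 - γ * R ^ 2) := mul_pos hγ hγR
  have h := (hτlaw 0).integral_comp (f := fun n => ∫ ω', chain γ θ₀ (fun j => D j ω') 0 n ∂μ)
    (measurable_of_countable _).aestronglyMeasurable
  rw [(hD.integral_level hM hγ hγR θ₀ hτm hDτ 0).2]
  refine h.trans ?_
  unfold thetaBar
  rw [integral_smul, integral_finsetSum _ fun i _ => (hD.memLp_chain hM hκ.le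
    (X := fun _ => θ₀) measurable_const (memLp_const θ₀) i).integrable one_le_two,
    integral_uniformOn_finset, tauRange, Nat.card_Ico, Nat.cast_sub hsk.le]

/-- On each event `N = l` the probability cancels `1/p_l`, so the integral is a telescoping series
of means of levels: their limit is `θ*`, and level 0 has the mean of `θ̄_k`. Integrability of `Z_k`
justifies the summation over `N`. -/
theorem IsSample.integral_zEst (hD : IsSample P μ D) (hM : MomentBounds P θs σ R)
    (hγ : 0 < γ) (hγR : 0 < 2 - γ * R ^ 2) (hξ0 : 0 < ξ)
    (hξ : ∀ u, ξ * ‖u‖ ^ 2 ≤ γ * (2 - γ * R ^ 2) * hForm P u u) (hδ : 0 ≤ δ) (θ₀ : Vec d)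
    (hsk : s < k) (hτm : ∀ l, Measurable (τ l))
    (hτlaw : ∀ l, HasLaw (τ l) (uniformOn (tauRange s k l : Set ℕ)) μ)
    (hDτ : IndepFun (fun ω t => D t ω) (fun ω l => τ l ω) μ) (hNm : Measurable N)
    (hNlaw : ∀ l, μ {ω | N ω = l} = ENNReal.ofReal (levelProb δ l))
    (hNind : IndepFun N (fun ω => ((fun t => D t ω), (fun l => τ l ω))) μ)
    (hZ : MemLp (fun ω => zEst γ δ θ₀ (fun t => D t ω) (fun l => τ l ω) (N ω)) 2 μ) :
    ∫ ω, zEst γ δ θ₀ (fun t => D t ω) (fun l => τ l ω) (N ω) ∂μ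
      = θs - ∫ ω, thetaBar γ θ₀ s k (fun j => D j ω) ∂μ := by
  have hDm : Measurable fun ω t => D t ω := measurable_pi_lambda _ hD.measurable
  have hτm' : Measurable fun ω l => τ l ω := measurable_pi_lambda _ hτm
  set f : ℕ → Vec d := fun l => ∫ ω, level γ θ₀ (fun t => D t ω) (fun l => τ l ω) l ∂μ with hf
  set ψ : ℕ → Vec d := fun l => ∫ ω, zEst γ δ θ₀ (fun t => D t ω) (fun l => τ l ω) l ∂μ with hψ
  have hψf : ∀ l, ψ l = (levelProb δ l)⁻¹ • (f (l + 1) - f l) := fun l => by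
    simp only [hψ, zEst, hf]
    rw [integral_smul, integral_sub
      ((hD.memLp_level hM hγ hγR θ₀ hτm hDτ (l + 1)).integrable one_le_two)
      ((hD.memLp_level hM hγ hγR θ₀ hτm hDτ l).integrable one_le_two)]
  have hi := hZ.integrable one_le_two
  have h1 : ∫ ω, zEst γ δ θ₀ (fun t => D t ω) (fun l => τ l ω) (N ω) ∂μ = ∫ ω, ψ (N ω) ∂μ :=
    hNind.integral_eq_integral_integral hNm (hDm.prodMk hτm') (measurable_zEst γ δ θ₀) hi
  have h2 : Integrable (fun ω => ψ (N ω)) μ :=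
    hNind.integrable_integral hNm (hDm.prodMk hτm') (measurable_zEst γ δ θ₀) hi
  have hset : ∀ l, MeasurableSet {ω | N ω = l} := fun l => hNm (measurableSet_singleton l)
  have hunion : ⋃ l, {ω | N ω = l} = Set.univ := by ext ω; simp
  have h3 := hasSum_integral_iUnion (μ := μ) (f := fun ω => ψ (N ω)) hset
    (fun i j hij => Set.disjoint_left.2 fun ω hi hj => hij (hi.symm.trans hj)) h2.integrableOn
  rw [hunion, setIntegral_univ] at h3
  have h4 : ∀ l, ∫ ω in {ω | N ω = l}, ψ (N ω) ∂μ = f (l + 1) - f l := fun l => by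
    rw [setIntegral_congr_fun (g := fun _ => ψ l) (hset l) fun ω hω => by
      simp only [Set.mem_ofPred_eq] at hω; simp only [hω], setIntegral_const, hψf,
      measureReal_def, hNlaw, ENNReal.toReal_ofReal (levelProb_pos hδ l).le,
      smul_inv_smul₀ (levelProb_pos hδ l).ne']
  simp_rw [h4] at h3
  have h5 := h3.tendsto_sum_nat
  simp_rw [Finset.sum_range_sub] at h5
  have h6 := (hD.tendsto_integral_level hM hγ hγR hξ0 hξ θ₀ hsk hτm hτlaw hDτ).sub_const (f 0)
  rw [h1, tendsto_nhds_unique h5 h6]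
  congr 1
  exact hD.integral_level_zero hM hγ hγR θ₀ hsk hτm hτlaw hDτ

end Mean

/-! ### Expected running times -/

section RunningTime

variable {d : ℕ} {Ω : Type*} [MeasurableSpace Ω] {μ : Measure Ω} [IsProbabilityMeasure μ]

theorem chainProg_reads (γ : ℝ) (θ₀ : Vec d) (D : ℤ → Vec d × ℝ) (m : ℤ) (n : ℕ) :
    (chainProg γ θ₀ D m n).reads = Finset.Ico m (m + n) := by
  induction n with
  | zero => simp only [Nat.cast_zero, add_zero, Finset.Ico_self]; rfl
  | succ n ih =>
    change (chainProg γ θ₀ D m n).reads ∪ ({m + (n : ℤ)} ∪ ∅) = _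
    rw [ih]
    ext j
    simp only [Finset.mem_union, Finset.mem_Ico, Finset.mem_singleton, Finset.notMem_empty]
    push_cast
    lia

/-- Both chains end at time 0, so the samples of the shorter one are among those of the longer one.
-/
theorem zProg_time_le (γ δ : ℝ) (θ₀ : Vec d) (D : ℤ → Vec d × ℝ) (τ : ℕ → ℕ) (N : ℕ) :
    (zProg γ δ θ₀ D τ N).time ≤ max (τ (N + 1)) (τ N) := by
  change ((chainProg γ θ₀ D (-(τ (N + 1) : ℤ)) (τ (N + 1))).reads
    ∪ ((chainProg γ θ₀ D (-(τ N : ℤ)) (τ N)).reads ∪ ∅)).card ≤ _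
  rw [chainProg_reads, chainProg_reads]
  refine (Finset.card_le_card (t := Finset.Ico (-(max (τ (N + 1)) (τ N) : ℤ)) 0) ?_).trans ?_
  · intro j
    simp only [Finset.mem_union, Finset.mem_Ico, Finset.notMem_empty]
    lia
  · simp only [Int.card_Ico]
    lia

theorem thetaBarProg_time_le (γ : ℝ) (θ₀ : Vec d) {s k : ℕ} (h : s ≤ k) (D : ℤ → Vec d × ℝ) :
    (thetaBarProg γ θ₀ s k D).time ≤ k := by
  have hsum : ∀ n, (sumProg γ θ₀ s D n).reads ⊆ Finset.Ico 0 ((s : ℤ) + n) := fun n => by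
    induction n with
    | zero => exact Finset.empty_subset _
    | succ n ih =>
      change (sumProg γ θ₀ s D n).reads ∪ ((chainProg γ θ₀ D 0 (s + n)).reads ∪ ∅) ⊆ _
      rw [chainProg_reads]
      intro j hj
      simp only [Finset.mem_union, Finset.mem_Ico, Finset.notMem_empty] at hj
      rw [Finset.mem_Ico]
      rcases hj with hj | hj
      · have := Finset.mem_Ico.1 (ih hj)
        push_cast
        lia
      · push_cast at hj ⊢
        lia
  change ((sumProg γ θ₀ s D (k - s)).reads ∪ ∅).card ≤ k
  rw [Finset.union_empty]
  refine (Finset.card_le_card (hsum _)).trans ?_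
  rw [Int.card_Ico]
  lia

/-- Both random times are below the upper end of the range of level `N + 1`, which is less than
`4k2^N`; averaging over `N` gives `4kΣ 2^l p_l`. -/
theorem lintegral_zProg_time_le (γ : ℝ) {δ : ℝ} (hδ : 1 < δ) (θ₀ : Vec d)
    {D : ℤ → Ω → Vec d × ℝ} {s k : ℕ} (hsk : s < k) {τ : ℕ → Ω → ℕ} {N : Ω → ℕ}
    (hτlaw : ∀ l, HasLaw (τ l) (uniformOn (tauRange s k l : Set ℕ)) μ) (hNm : Measurable N)
    (hNlaw : ∀ l, μ {ω | N ω = l} = ENNReal.ofReal (levelProb δ l)) :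
    ∫⁻ ω, ((zProg γ δ θ₀ (fun t => D t ω) (fun l => τ l ω) (N ω)).time : ℝ≥0∞) ∂μ
      ≤ ENNReal.ofReal (4 * δ * k / (δ - 1)) := by
  have hmem : ∀ᵐ ω ∂μ, ∀ l, τ l ω ∈ tauRange s k l :=
    ae_all_iff.2 fun l => HasLaw.mem_of_uniformOn (hτlaw l)
  calc _ ≤ ∫⁻ ω, ENNReal.ofReal (4 * k * 2 ^ N ω) ∂μ := by
        refine lintegral_mono_ae ?_
        filter_upwards [hmem] with ω hω
        rw [← ENNReal.ofReal_natCast]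
        refine ENNReal.ofReal_le_ofReal ?_
        have h1 := zProg_time_le γ δ θ₀ (fun t => D t ω) (fun l => τ l ω) (N ω)
        have h2 := hω (N ω)
        have h3 := hω (N ω + 1)
        rw [tauRange_eq_Ico, Finset.mem_Ico] at h2 h3
        have h4 : tauLo s k (N ω + 1 + 1) ≤ 4 * k * 2 ^ N ω := by
          simp only [tauLo]
          calc k * (2 ^ (N ω + 1 + 1) - 1) ≤ k * 2 ^ (N ω + 1 + 1) :=
                Nat.mul_le_mul_left _ (Nat.sub_le _ _)
            _ = _ := by rw [pow_succ, pow_succ]; ring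
        have h5 := tauLo_lt_succ hsk (N ω + 1)
        have h6 : (zProg γ δ θ₀ (fun t => D t ω) (fun l => τ l ω) (N ω)).time
            ≤ 4 * k * 2 ^ N ω := by
          lia
        exact_mod_cast h6
    _ ≤ _ := by
        rw [lintegral_comp_nat hNm fun l => ENNReal.ofReal (4 * k * 2 ^ l)]
        refine ENNReal.tsum_le_of_sum_range_le fun n => ?_
        simp_rw [hNlaw]
        have hp := fun l => (levelProb_pos (δ := δ) (by linarith) l).le
        have : ∀ l ∈ Finset.range n, ENNReal.ofReal (4 * k * 2 ^ l)
            * ENNReal.ofReal (levelProb δ l)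
            = ENNReal.ofReal (4 * k * (2 ^ l * levelProb δ l)) := fun l _ => by
          rw [← ENNReal.ofReal_mul (by positivity), mul_assoc]
        rw [Finset.sum_congr rfl this, ← ENNReal.ofReal_sum_of_nonneg fun l _ =>
          mul_nonneg (by positivity) (mul_nonneg (by positivity) (hp l)), ← Finset.mul_sum]
        refine ENNReal.ofReal_le_ofReal ?_
        refine (mul_le_mul_of_nonneg_left (sum_two_pow_mul_levelProb_le hδ n)
          (by positivity)).trans_eq ?_
        ring

theorem lintegral_fHatTime_le (γ : ℝ) (θ₀ : Vec d) {D : ℤ → Ω → Vec d × ℝ} {s k : ℕ}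
    (hsk : s ≤ k) {Q : Ω → Bool} (hQm : Measurable Q) {C' : Ω → ℕ} (hC'm : Measurable C')
    (hind : IndepFun Q C' μ) :
    ∫⁻ ω, (fHatTime γ θ₀ s k (fun t => D t ω) (Q ω) (C' ω) : ℝ≥0∞) ∂μ
      ≤ k + μ {ω | Q ω = true} * ∫⁻ ω, (C' ω : ℝ≥0∞) ∂μ := by
  have hg : Measurable fun p : Bool × ℕ => if p.1 then (p.2 : ℝ≥0∞) else 0 :=
    measurable_of_countable _
  calc _ ≤ ∫⁻ ω, ((k : ℝ≥0∞) + if Q ω then (C' ω : ℝ≥0∞) else 0) ∂μ := by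
        refine lintegral_mono fun ω => ?_
        rw [fHatTime]
        push_cast
        refine add_le_add ?_ le_rfl
        exact_mod_cast thetaBarProg_time_le γ θ₀ hsk _
    _ = k + ∫⁻ ω, ∫⁻ ω', (if Q ω then (C' ω' : ℝ≥0∞) else 0) ∂μ ∂μ := by
        rw [lintegral_add_left measurable_const]
        congr 1
        · simp
        · exact hind.lintegral_eq_lintegral_lintegral hQm hC'm hg
    _ = k + ∫⁻ ω, {ω | Q ω = true}.indicator (fun _ => ∫⁻ ω', (C' ω' : ℝ≥0∞) ∂μ) ω ∂μ := by
        congr 1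
        refine lintegral_congr fun ω => ?_
        by_cases h : Q ω <;> simp [h]
    _ = _ := by
        have hset : MeasurableSet {ω | Q ω = true} := hQm (measurableSet_singleton true)
        rw [lintegral_indicator_const hset, mul_comm]

end RunningTime

/-! ### Mean and risk of the debiased estimator -/

section Debiasing

variable {d : ℕ} {P : Measure (Vec d × ℝ)} [IsProbabilityMeasure P]
  {Ω : Type*} [MeasurableSpace Ω] {μ : Measure Ω} [IsProbabilityMeasure μ]
  {θs : Vec d} {σ R q : ℝ} {bar Z : Ω → Vec d} {Q : Ω → Bool}

theorem integral_inv_mul_toNat (hq : 0 < q) (hQm : Measurable Q)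
    (hQlaw : μ {ω | Q ω = true} = ENNReal.ofReal q) :
    ∫ ω, q⁻¹ * ((Q ω).toNat : ℝ) ∂μ = 1 := by
  have h : ∀ ω, q⁻¹ * ((Q ω).toNat : ℝ) = {ω | Q ω = true}.indicator (fun _ => q⁻¹) ω :=
    fun ω => by by_cases h : Q ω <;> simp [h]
  have hset : MeasurableSet {ω | Q ω = true} := hQm (measurableSet_singleton true)
  simp_rw [h]
  rw [integral_indicator_const _ hset, measureReal_def, hQlaw,
    ENNReal.toReal_ofReal hq.le, smul_eq_mul, mul_inv_cancel₀ hq.ne']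

theorem inv_mul_toNat_bounds (hq : 0 < q) (b : Bool) :
    0 ≤ q⁻¹ * (b.toNat : ℝ) ∧ q⁻¹ * (b.toNat : ℝ) ≤ q⁻¹ := by
  have := inv_pos.2 hq
  cases b <;> simp [this.le]

theorem inv_mul_toNat_sq (b : Bool) :
    (q⁻¹ * (b.toNat : ℝ)) ^ 2 = q⁻¹ * (q⁻¹ * (b.toNat : ℝ)) := by
  cases b <;> simp [sq]

theorem memLp_inv_mul_toNat_smul (hq : 0 < q) (hQm : Measurable Q) (hZm : Measurable Z)
    (hZ : MemLp Z 2 μ) : MemLp (fun ω => (q⁻¹ * ((Q ω).toNat : ℝ)) • Z ω) 2 μ := by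
  refine MemLp.of_le_mul (c := q⁻¹) hZ ?_ (.of_forall fun ω => ?_)
  · exact (((measurable_of_countable fun b : Bool => q⁻¹ * (b.toNat : ℝ)).comp
      hQm).smul hZm).aestronglyMeasurable
  · obtain ⟨h0, h1⟩ := inv_mul_toNat_bounds hq (Q ω)
    rw [norm_smul, Real.norm_of_nonneg h0]
    exact mul_le_mul_of_nonneg_right h1 (norm_nonneg _)

theorem integral_fHat (hq : 0 < q) (hQm : Measurable Q)
    (hQlaw : μ {ω | Q ω = true} = ENNReal.ofReal q) (hbar : MemLp bar 2 μ)
    (hZm : Measurable Z) (hZ : MemLp Z 2 μ) (hind : IndepFun Q Z μ) :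
    ∫ ω, fHat q (bar ω) (Q ω) (Z ω) ∂μ = ∫ ω, bar ω ∂μ + ∫ ω, Z ω ∂μ := by
  have hbZ := memLp_inv_mul_toNat_smul hq hQm hZm hZ
  have hb : Measurable fun b : Bool => q⁻¹ * (b.toNat : ℝ) := measurable_of_countable _
  have hg : Measurable fun p : Bool × Vec d => (q⁻¹ * (p.1.toNat : ℝ)) • p.2 :=
    (hb.comp measurable_fst).smul measurable_snd
  unfold fHat
  rw [integral_add (hbar.integrable one_le_two) (hbZ.integrable one_le_two)]
  congr 1
  refine (hind.integral_eq_integral_integral hQm hZm hg (hbZ.integrable one_le_two)).trans ?_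
  simp_rw [integral_smul]
  rw [integral_smul_const, integral_inv_mul_toNat hq hQm hQlaw, one_smul]

/-- The excess risk of the debiased estimator. -/
theorem MomentBounds.integral_hForm_fHat_le (hM : MomentBounds P θs σ R) (hq : 0 < q)
    (hQm : Measurable Q) (hQlaw : μ {ω | Q ω = true} = ENNReal.ofReal q)
    (hbarm : Measurable bar) (hbar : MemLp bar 2 μ) (hZm : Measurable Z) (hZ : MemLp Z 2 μ)
    (hQind : IndepFun Q bar μ) (hZind : IndepFun Z (fun ω => (bar ω, Q ω)) μ)
    (hmean : ∫ ω, Z ω ∂μ = θs - ∫ ω, bar ω ∂μ) :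
    ∫ ω, hForm P (fHat q (bar ω) (Q ω) (Z ω) - θs) (fHat q (bar ω) (Q ω) (Z ω) - θs) ∂μ
      ≤ ∫ ω, hForm P (bar ω - θs) (bar ω - θs) ∂μ + q⁻¹ * ∫ ω, hForm P (Z ω) (Z ω) ∂μ := by
  have hbZ := memLp_inv_mul_toNat_smul hq hQm hZm hZ
  have hb : Measurable fun b : Bool => q⁻¹ * (b.toNat : ℝ) := measurable_of_countable _
  have hA : MemLp (fun ω => bar ω - θs) 2 μ := hbar.sub (memLp_const θs)
  have hZi := hZ.integrable one_le_two
  set v := ∫ ω, Z ω ∂μ with hv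
  have hAv : ∫ ω, (bar ω - θs) ∂μ = -v := by
    rw [integral_sub (hbar.integrable one_le_two) (integrable_const _), hmean]; simp
  have hHm : Measurable (hOp P) := (hOp P).continuous.measurable
  -- By independence and `E(Q/q) = 1`, the correlation factors as `⟨E θ̄_k - θ*, E Z⟩_H`. The mean
  -- of `Z` is minus the bias of `θ̄_k`, so this is `-‖E Z‖_H²`.
  have hcross : ∫ ω, hForm P (bar ω - θs) ((q⁻¹ * ((Q ω).toNat : ℝ)) • Z ω) ∂μ ≤ 0 := by
    have hi := hM.integrable_hForm hA hbZ
    simp_rw [hM.hForm_smul_right, hForm_eq_inner hM.memLp_x] at hi ⊢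
    have hg : Measurable fun p : (Vec d × Bool) × Vec d =>
        q⁻¹ * (p.1.2.toNat : ℝ) * inner ℝ (p.1.1 - θs) (hOp P p.2) :=
      (hb.comp (by fun_prop : Measurable fun p : (Vec d × Bool) × Vec d => p.1.2)).mul
        ((by fun_prop : Measurable fun p : (Vec d × Bool) × Vec d => p.1.1 - θs).inner
          (hHm.comp measurable_snd))
    have h1 := hZind.symm.integral_eq_integral_integral (hbarm.prodMk hQm) hZm hg hi
    refine h1.trans_le ?_
    have h2 : ∀ ω, ∫ ω', q⁻¹ * ((Q ω).toNat : ℝ) * inner ℝ (bar ω - θs) (hOp P (Z ω')) ∂μ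
        = q⁻¹ * ((Q ω).toNat : ℝ) * inner ℝ (bar ω - θs) (hOp P v) := fun ω => by
      rw [integral_const_mul, integral_inner ((hOp P).integrable_comp hZi),
        (hOp P).integral_comp_comm hZi]
    simp only [h2]
    have hAi := integrable_inner_of_memLp hA (memLp_const (μ := μ) (hOp P v))
    have hg2 : Measurable fun p : Bool × Vec d =>
        q⁻¹ * (p.1.toNat : ℝ) * inner ℝ (p.2 - θs) (hOp P v) :=
      (hb.comp measurable_fst).mul (by fun_prop)
    have hi2 : Integrable (fun ω => q⁻¹ * ((Q ω).toNat : ℝ) * inner ℝ (bar ω - θs) (hOp P v)) μ :=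
      hAi.bdd_mul (c := q⁻¹) (hb.comp hQm).aestronglyMeasurable (.of_forall fun ω => by
        obtain ⟨h0, h1⟩ := inv_mul_toNat_bounds hq (Q ω)
        rw [Real.norm_of_nonneg h0]
        exact h1)
    refine (hQind.integral_eq_integral_integral hQm hbarm hg2 hi2).trans_le ?_
    simp only [integral_const_mul, integral_mul_const]
    have h3 : ∫ ω, inner ℝ (bar ω - θs) (hOp P v) ∂μ = -hForm P v v := by
      simp_rw [real_inner_comm (hOp P v)]
      rw [integral_inner (hA.integrable one_le_two), hAv, inner_neg_right, real_inner_comm,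
        hForm_eq_inner hM.memLp_x]
    have h4 := integral_inv_mul_toNat (μ := μ) hq hQm hQlaw
    rw [integral_const_mul] at h4
    rw [h3, h4, one_mul, neg_nonpos]
    exact hForm_self_nonneg v
  -- As `Q² = Q`, the factor `(Q/q)²` is `q⁻¹(Q/q)`, of mean `q⁻¹`.
  have hsq : ∫ ω, hForm P ((q⁻¹ * ((Q ω).toNat : ℝ)) • Z ω) ((q⁻¹ * ((Q ω).toNat : ℝ)) • Z ω) ∂μ
      = q⁻¹ * ∫ ω, hForm P (Z ω) (Z ω) ∂μ := by
    have hi := hM.integrable_hForm hbZ hbZ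
    simp_rw [hM.hForm_smul_self, inv_mul_toNat_sq, hForm_eq_inner hM.memLp_x] at hi ⊢
    have hg : Measurable fun p : Bool × Vec d =>
        q⁻¹ * (q⁻¹ * (p.1.toNat : ℝ)) * inner ℝ p.2 (hOp P p.2) :=
      ((hb.comp measurable_fst).const_mul q⁻¹).mul
        (measurable_snd.inner (hHm.comp measurable_snd))
    have hQZ : IndepFun Q Z μ := (hZind.comp measurable_id measurable_snd).symm
    refine (hQZ.integral_eq_integral_integral hQm hZm hg hi).trans ?_
    have h4 := integral_inv_mul_toNat (μ := μ) hq hQm hQlaw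
    rw [integral_const_mul] at h4
    simp only [integral_const_mul, integral_mul_const]
    rw [h4, mul_one]
  have hexp : ∀ ω, hForm P (fHat q (bar ω) (Q ω) (Z ω) - θs) (fHat q (bar ω) (Q ω) (Z ω) - θs)
      = hForm P (bar ω - θs) (bar ω - θs)
        + 2 * hForm P (bar ω - θs) ((q⁻¹ * ((Q ω).toNat : ℝ)) • Z ω)
        + hForm P ((q⁻¹ * ((Q ω).toNat : ℝ)) • Z ω) ((q⁻¹ * ((Q ω).toNat : ℝ)) • Z ω) := fun ω => by
    rw [← hM.hForm_add_self, fHat, add_sub_right_comm]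
  simp_rw [hexp]
  have hi1 := hM.integrable_hForm hA hA
  have hi2 := (hM.integrable_hForm hA hbZ).const_mul 2
  rw [integral_add (f := fun ω => hForm P (bar ω - θs) (bar ω - θs)
      + 2 * hForm P (bar ω - θs) ((q⁻¹ * ((Q ω).toNat : ℝ)) • Z ω)) (hi1.add hi2)
    (hM.integrable_hForm hbZ hbZ), integral_add hi1 hi2, integral_const_mul, hsq]
  linarith

/-- Pythagoras: the residual at `θ*` is orthogonal to linear functions of `x`. -/
theorem MomentBounds.risk_eq (hM : MomentBounds P θs σ R) (θ : Vec d) :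
    risk P θ = risk P θs + (1 / 2) * hForm P (θ - θs) (θ - θs) := by
  have hexp : ∀ z : Vec d × ℝ, (z.2 - inner ℝ z.1 θ) ^ 2 = (z.2 - inner ℝ z.1 θs) ^ 2
      + (inner ℝ z.1 (θ - θs) * inner ℝ z.1 (θ - θs)
        - 2 * ((z.2 - inner ℝ z.1 θs) * inner ℝ z.1 (θ - θs))) := fun z => by
    rw [inner_sub_right]; ring
  have hi1 := hM.memLp_noise.integrable_sq
  have hi2 := hM.integrable_inner_mul_inner (θ - θs) (θ - θs)
  have hi3 : Integrable (fun z : Vec d × ℝ =>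
      2 * ((z.2 - inner ℝ z.1 θs) * inner ℝ z.1 (θ - θs))) P :=
    (hM.memLp_noise.integrable_mul (hM.memLp_inner (θ - θs))).const_mul 2
  simp_rw [risk, hexp]
  rw [integral_add (g := fun z : Vec d × ℝ => inner ℝ z.1 (θ - θs) * inner ℝ z.1 (θ - θs)
    - 2 * ((z.2 - inner ℝ z.1 θs) * inner ℝ z.1 (θ - θs))) hi1 (hi2.sub hi3),
    integral_sub hi2 hi3, integral_const_mul, hM.noise_orth, hForm]
  ring

end Debiasing

/-! ### Numerical constants of the final bound -/

section Constants

variable {d : ℕ} {P : Measure (Vec d × ℝ)} [IsProbabilityMeasure P] {θs : Vec d} {σ R γ ξ : ℝ}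

/-- For a unit vector `u`, the expected squared norm after one step is nonnegative and at most `1 -
ξ`. -/
theorem MomentBounds.contraction_le_one (hM : MomentBounds P θs σ R)
    (hξ : ∀ u, ξ * ‖u‖ ^ 2 ≤ γ * (2 - γ * R ^ 2) * hForm P u u) (hd : d ≠ 0) : ξ ≤ 1 := by
  let u : Vec d := EuclideanSpace.single ⟨0, Nat.pos_of_ne_zero hd⟩ 1
  have hu : ‖u‖ ^ 2 = 1 := by simp [u]
  have h1 := hM.integral_norm_linStep_sq_le γ u
  have h2 : 0 ≤ ∫ z, ‖linStep γ z.1 u‖ ^ 2 ∂P := integral_nonneg fun z => sq_nonneg _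
  have h3 := hξ u
  rw [hu] at h1 h3
  linarith

/-- Either rounding gives `2s ≤ k + 1`. For `k ≥ 3` this implies `3s ≤ 2k`, and for `k = 2` it
forces `s ≤ 1`. -/
theorem three_mul_sub_ge {α : ℝ} (hα2 : α ≤ 1 / 2) {k s : ℕ} (hk : 2 ≤ k)
    (hs : |(s : ℝ) - α * k| < 1) : s < k ∧ k ≤ 3 * (k - s) := by
  have h1 := (abs_lt.1 hs).2
  have h2 : (2 * s : ℝ) < k + 2 := by
    have : α * k ≤ 1 / 2 * k := mul_le_mul_of_nonneg_right hα2 (Nat.cast_nonneg k)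
    linarith
  have h3 : 2 * s < k + 2 := by exact_mod_cast h2
  lia

/-- The left bracket is `84c + 12cS ≤ 84c + 3cX`, and the right one at least `54c + 6cX`; the
condition `X ≥ 10` closes the gap of `30c`. -/
theorem variance_constant_le {c X S α q k : ℝ} (hc : 0 ≤ c) (hα : 0 < α) (hα2 : α ≤ 1 / 2)
    (hq : 0 < q) (hk : 0 < k) (hX : 10 ≤ X) (hS : S ≤ X / 4) :
    1 / (2 * q * k) * (48 * c + 12 * c * (3 + S)) ≤ 1 / (2 * q * k) * (27 * c / α + 6 * c * X) := by
  refine mul_le_mul_of_nonneg_left ?_ (by positivity)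
  have h1 : 54 * c ≤ 27 * c / α := by
    rw [le_div_iff₀ hα]
    nlinarith
  nlinarith

theorem rpow_log_bounds {Λ δ : ℝ} (hδ : 1 < δ) (hΛ : 5 / 2 ≤ Λ) :
    10 ≤ (4 * Λ) ^ (δ + 1) ∧ (2 * Λ) ^ (δ + 1) ≤ (4 * Λ) ^ (δ + 1) / 4 := by
  constructor
  · calc (10 : ℝ) ≤ (4 * Λ) ^ (1 : ℝ) := by rw [Real.rpow_one]; linarith
      _ ≤ _ := Real.rpow_le_rpow_of_exponent_le (by linarith) (by linarith)
  · have h1 : (4 * Λ) ^ (δ + 1) = 2 ^ (δ + 1) * (2 * Λ) ^ (δ + 1) := by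
      rw [← Real.mul_rpow (by norm_num) (by linarith)]
      ring_nf
    have h2 : (4 : ℝ) ≤ 2 ^ (δ + 1) := by
      calc (4 : ℝ) = 2 ^ (2 : ℝ) := by norm_num
        _ ≤ _ := Real.rpow_le_rpow_of_exponent_le (by norm_num) (by linarith)
    have h3 := Real.rpow_nonneg (by linarith : 0 ≤ 2 * Λ) (δ + 1)
    rw [h1]
    nlinarith

end Constants

/-! ### Assembly -/

section Main

theorem measurable_thetaBar {d : ℕ} (γ : ℝ) (θ₀ : Vec d) (s k : ℕ) :
    Measurable fun D : ℤ → Vec d × ℝ => thetaBar γ θ₀ s k D := by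
  have h : Measurable fun D : ℤ → Vec d × ℝ => ∑ t ∈ Finset.Ico s k, chain γ θ₀ D 0 t :=
    Finset.measurable_sum _ fun t _ => measurable_chain γ θ₀ 0 t
  exact h.const_smul ((k : ℝ) - s)⁻¹

variable {d : ℕ} {P : Measure (Vec d × ℝ)} [IsProbabilityMeasure P] {θs : Vec d}
  {σ R γ ξ δ q : ℝ} {Ω : Type*} [MeasurableSpace Ω] {μ : Measure Ω} [IsProbabilityMeasure μ]
  {D : ℤ → Ω → Vec d × ℝ} {s k : ℕ} {τ : ℕ → Ω → ℕ} {N : Ω → ℕ} {Q : Ω → Bool}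
  {Z' : Ω → Vec d}

/-- Square-integrability, unbiasedness and risk of the debiased estimator, in terms of a bound on
the series over the levels. -/
theorem IsSample.fHat_properties (hD : IsSample P μ D) (hM : MomentBounds P θs σ R)
    (hγ : 0 < γ) (hγR : 0 < 2 - γ * R ^ 2) (hξ0 : 0 < ξ)
    (hξ : ∀ u, ξ * ‖u‖ ^ 2 ≤ γ * (2 - γ * R ^ 2) * hForm P u u) (hδ : 0 ≤ δ)
    (hq : 0 < q) (hq1 : q ≤ 1) (θ₀ : Vec d)
    (hk : 2 ≤ k) (hsk : s < k) (hsk3 : k ≤ 3 * (k - s)) (hτm : ∀ l, Measurable (τ l))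
    (hτlaw : ∀ l, HasLaw (τ l) (uniformOn (tauRange s k l : Set ℕ)) μ)
    (hDτ : IndepFun (fun ω t => D t ω) (fun ω l => τ l ω) μ) (hNm : Measurable N)
    (hNlaw : ∀ l, μ {ω | N ω = l} = ENNReal.ofReal (levelProb δ l))
    (hNind : IndepFun N (fun ω => ((fun t => D t ω), (fun l => τ l ω))) μ)
    (hQm : Measurable Q) (hQlaw : μ {ω | Q ω = true} = ENNReal.ofReal q)
    (hQind : IndepFun Q (fun ω => thetaBar γ θ₀ s k (fun t => D t ω)) μ)
    (hZ'm : Measurable Z')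
    (hcopy : IdentDistrib Z'
      (fun ω => zEst γ δ θ₀ (fun t => D t ω) (fun l => τ l ω) (N ω)) μ μ)
    (hZ'ind : IndepFun Z' (fun ω => (thetaBar γ θ₀ s k (fun t => D t ω), Q ω)) μ) {S : ℝ}
    (hS : ∀ n, ∑ m ∈ Finset.range n, ((m : ℝ) + 1) ^ δ * Real.exp (-ξ * 2 ^ m) ≤ S) :
    MemLp (fun ω => fHat q (thetaBar γ θ₀ s k (fun t => D t ω)) (Q ω) (Z' ω)) 2 μ ∧
    ∫ ω, fHat q (thetaBar γ θ₀ s k (fun t => D t ω)) (Q ω) (Z' ω) ∂μ = θs ∧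
    Integrable (fun ω => risk P (fHat q (thetaBar γ θ₀ s k (fun t => D t ω)) (Q ω) (Z' ω))) μ ∧
    ∫ ω, risk P (fHat q (thetaBar γ θ₀ s k (fun t => D t ω)) (Q ω) (Z' ω)) ∂μ - risk P θs
      ≤ 1 / (2 * q * k) *
        (48 * cConst γ σ R θ₀ θs + 12 * cConst γ σ R θ₀ θs * (3 + S)) := by
  have hκ : 0 < γ * (2 - γ * R ^ 2) := mul_pos hγ hγR
  have hc : 0 ≤ cConst γ σ R θ₀ θs := by unfold cConst; positivity
  have hS0 : 0 ≤ S := by simpa using hS 0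
  have hk0 : (0 : ℝ) < k := by exact_mod_cast (by lia : 0 < k)
  have hDm : Measurable fun ω t => D t ω := measurable_pi_lambda _ hD.measurable
  have hτm' : Measurable fun ω l => τ l ω := measurable_pi_lambda _ hτm
  have hbarm : Measurable fun ω => thetaBar γ θ₀ s k (fun t => D t ω) :=
    (measurable_thetaBar γ θ₀ s k).comp hDm
  have hbar := hD.memLp_thetaBar (γ := γ) hM hκ.le θ₀ s k
  have hzm : Measurable fun ω => zEst γ δ θ₀ (fun t => D t ω) (fun l => τ l ω) (N ω) :=
    (measurable_zEst γ δ θ₀).comp (f := fun ω => (N ω, ((fun t => D t ω), fun l => τ l ω)))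
      (hNm.prodMk (hDm.prodMk hτm'))
  have hzH := hD.lintegral_hSq_zEst_le hM hγ hγR hξ0 hξ hδ θ₀ hk hsk hsk3 hτm hτlaw hDτ hNm hNlaw
    hNind hS
  have hz : MemLp (fun ω => zEst γ δ θ₀ (fun t => D t ω) (fun l => τ l ω) (N ω)) 2 μ := by
    rw [memLp_two_iff hzm]
    refine (lintegral_mono fun ω => hM.normSq_le hκ hξ0 hξ _).trans_lt ?_
    rw [lintegral_const_mul' _ _ ENNReal.ofReal_ne_top]
    exact ENNReal.mul_lt_top ENNReal.ofReal_lt_top (hzH.trans_lt ENNReal.ofReal_lt_top)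
  have hZ' : MemLp Z' 2 μ := hcopy.memLp_iff.2 hz
  have hmean : ∫ ω, Z' ω ∂μ = θs - ∫ ω, thetaBar γ θ₀ s k (fun t => D t ω) ∂μ := by
    rw [hcopy.integral_eq]
    exact hD.integral_zEst hM hγ hγR hξ0 hξ hδ θ₀ hsk hτm hτlaw hDτ hNm hNlaw hNind hz
  have hZ'H : ∫ ω, hForm P (Z' ω) (Z' ω) ∂μ ≤ 12 * cConst γ σ R θ₀ θs * (3 + S) / k := by
    rw [← ENNReal.ofReal_le_ofReal_iff (by positivity), ofReal_integral_eq_lintegral_ofReal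
      (hM.integrable_hForm hZ' hZ') (.of_forall fun _ => hForm_self_nonneg _)]
    simp_rw [← hM.hSq_eq]
    refine le_trans (le_of_eq ?_) hzH
    exact (hcopy.comp measurable_hSq).lintegral_eq
  have hf : MemLp (fun ω => fHat q (thetaBar γ θ₀ s k (fun t => D t ω)) (Q ω) (Z' ω)) 2 μ :=
    hbar.add (memLp_inv_mul_toNat_smul hq hQm hZ'm hZ')
  have hfs : MemLp (fun ω => fHat q (thetaBar γ θ₀ s k (fun t => D t ω)) (Q ω) (Z' ω) - θs) 2 μ :=
    hf.sub (memLp_const θs)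
  have hfi := (hM.integrable_hForm hfs hfs).const_mul (1 / 2)
  have hQZ : IndepFun Q Z' μ := (hZ'ind.comp measurable_id measurable_snd).symm
  have hrisk : ∀ ω, risk P (fHat q (thetaBar γ θ₀ s k (fun t => D t ω)) (Q ω) (Z' ω))
      = risk P θs + 1 / 2 * hForm P (fHat q (thetaBar γ θ₀ s k (fun t => D t ω)) (Q ω) (Z' ω) - θs)
        (fHat q (thetaBar γ θ₀ s k (fun t => D t ω)) (Q ω) (Z' ω) - θs) := fun ω => hM.risk_eq _
  refine ⟨hf, ?_, ?_, ?_⟩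
  · rw [integral_fHat hq hQm hQlaw hbar hZ'm hZ' hQZ, hmean, add_sub_cancel]
  · simp_rw [hrisk]
    exact (integrable_const _).add hfi
  · simp_rw [hrisk]
    rw [integral_add (integrable_const _) hfi, integral_const_mul]
    simp only [integral_const, probReal_univ, one_smul]
    have h1 := hM.integral_hForm_fHat_le hq hQm hQlaw hbarm hbar hZ'm hZ' hQind hZ'ind hmean
    have h2 := hD.integral_hForm_thetaBar_le hM hγ hγR θ₀ hsk
    -- Both `k - s ≥ k/3` and `q ≤ 1` are spent here, to give the two contributions the common
    -- factor `1/(qk)`.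
    have h3 : 16 * cConst γ σ R θ₀ θs / (k - s : ℕ) ≤ q⁻¹ * (48 * cConst γ σ R θ₀ θs / k) := by
      have hks : (k : ℝ) ≤ 3 * (k - s : ℕ) := by exact_mod_cast hsk3
      have hks0 : (0 : ℝ) < (k - s : ℕ) := by linarith
      have h4 : 16 * cConst γ σ R θ₀ θs / (k - s : ℕ) ≤ 48 * cConst γ σ R θ₀ θs / k := by
        rw [div_le_div_iff₀ hks0 hk0]
        nlinarith
      have h5 : 1 ≤ q⁻¹ := (one_le_inv₀ hq).2 hq1
      have h6 : 0 ≤ 48 * cConst γ σ R θ₀ θs / k := by positivity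
      nlinarith
    have h7 := mul_le_mul_of_nonneg_left hZ'H (inv_nonneg.2 hq.le)
    have h8 : 1 / (2 * q * k) * (48 * cConst γ σ R θ₀ θs + 12 * cConst γ σ R θ₀ θs * (3 + S))
        = 1 / 2 * (q⁻¹ * (48 * cConst γ σ R θ₀ θs / k)
          + q⁻¹ * (12 * cConst γ σ R θ₀ θs * (3 + S) / k)) := by
      field_simp
    rw [h8]
    linarith

end Main

end LeastSquares

theorem mainTheorem1
    {d : ℕ}
    -- the law of `(x, y)`, which is square-integrable
    (P : Measure (LeastSquares.Vec d × ℝ)) [IsProbabilityMeasure P]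
    (hP : MemLp (fun z : LeastSquares.Vec d × ℝ => z) 2 P)
    (hH : (LeastSquares.hessian P).PosDef)
    (θs : LeastSquares.Vec d) (hθs : LeastSquares.NormalEq P θs)
    (σ R : ℝ) (hA : LeastSquares.Assumption1 P θs σ R)
    -- parameters
    (θ₀ : LeastSquares.Vec d) (γ α δ q : ℝ)
    (hγ : 0 < γ) (hγR : γ < 2 / R ^ 2) (hα : 0 < α) (hα2 : α ≤ 1 / 2) (hδ : 1 < δ)
    (hq : 0 < q) (hq1 : q ≤ 1)
    (k : ℕ) (hk : 2 ≤ k)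
    -- the burn-in period `s(k)` is `αk`, rounded to an integer in either direction
    (s : ℕ) (hs : |(s : ℝ) - α * k| < 1)
    {Ω : Type*} [MeasurableSpace Ω] (μ : Measure Ω) [IsProbabilityMeasure μ]
    -- independent copies of `(x, y)`
    (D : ℤ → Ω → LeastSquares.Vec d × ℝ) (hDm : ∀ t, Measurable (D t))
    (hDlaw : ∀ t, HasLaw (D t) P μ) (hDind : iIndepFun D μ)
    -- the random times `τ(k,l)`
    (τ : ℕ → Ω → ℕ) (hτm : ∀ l, Measurable (τ l))
    (hτlaw : ∀ l, HasLaw (τ l) (uniformOn (LeastSquares.tauRange s k l : Set ℕ)) μ)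
    (hτind : iIndepFun τ μ)
    (hDτ : IndepFun (fun ω t => D t ω) (fun ω l => τ l ω) μ)
    -- the random level `N`
    (N : Ω → ℕ) (hNm : Measurable N)
    (hNlaw : ∀ l, μ {ω | N ω = l} = ENNReal.ofReal (LeastSquares.levelProb δ l))
    (hNind : IndepFun N (fun ω => ((fun t => D t ω), (fun l => τ l ω))) μ)
    -- the Bernoulli variable `Q`, independent of `θ̄_k`
    (Q : Ω → Bool) (hQm : Measurable Q) (hQlaw : μ {ω | Q ω = true} = ENNReal.ofReal q)
    (hQind : IndepFun Q (fun ω => LeastSquares.thetaBar γ θ₀ s k (fun t => D t ω)) μ)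
    -- a copy `Z'_k` of `Z_k`, with its sampling time, independent of `(θ̄_k, Q)`
    (Z' : Ω → LeastSquares.Vec d) (C' : Ω → ℕ) (hZ'm : Measurable Z') (hC'm : Measurable C')
    (hcopy : IdentDistrib (fun ω => (Z' ω, C' ω))
      (fun ω => (LeastSquares.zEst γ δ θ₀ (fun t => D t ω) (fun l => τ l ω) (N ω),
        (LeastSquares.zProg γ δ θ₀ (fun t => D t ω) (fun l => τ l ω) (N ω)).time)) μ μ)
    (hZ'ind : IndepFun (fun ω => (Z' ω, C' ω))
      (fun ω => (LeastSquares.thetaBar γ θ₀ s k (fun t => D t ω), Q ω)) μ)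
    -- the estimator and the expected sampling times of `Z_k` and of the estimator
    (fhat : Ω → LeastSquares.Vec d)
    (hfhat : ∀ ω, fhat ω = LeastSquares.fHat q
      (LeastSquares.thetaBar γ θ₀ s k (fun t => D t ω)) (Q ω) (Z' ω))
    (T That : ℝ≥0∞)
    (hT : T = ∫⁻ ω,
      ((LeastSquares.zProg γ δ θ₀ (fun t => D t ω) (fun l => τ l ω) (N ω)).time : ℝ≥0∞) ∂μ)
    (hThat : That = ∫⁻ ω,
      (LeastSquares.fHatTime γ θ₀ s k (fun t => D t ω) (Q ω) (C' ω) : ℝ≥0∞) ∂μ) :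
    T ≤ ENNReal.ofReal (4 * δ * k / (δ - 1)) ∧
    That ≤ k + ENNReal.ofReal q * T ∧
    MemLp fhat 2 μ ∧
    ∫ ω, fhat ω ∂μ = θs ∧
    Integrable (fun ω => LeastSquares.risk P (fhat ω)) μ ∧
    ∫ ω, LeastSquares.risk P (fhat ω) ∂μ - LeastSquares.risk P θs ≤
      1 / (2 * q * k) *
        (27 * LeastSquares.cConst γ σ R θ₀ θs / α +
          6 * LeastSquares.cConst γ σ R θ₀ θs *
            (4 * Real.log ((4 * δ + 8) / (α * LeastSquares.xiConst P γ R))) ^ (δ + 1)) := by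
  open LeastSquares in
  have hM := momentBounds_of_assumption hP hθs hA
  have hD : IsSample P μ D := ⟨hDm, hDlaw, hDind⟩
  have hγR' : 0 < 2 - γ * R ^ 2 := by
    have := (lt_div_iff₀ (pow_pos hA.R_pos 2)).1 hγR
    linarith
  have hκ : 0 < γ * (2 - γ * R ^ 2) := mul_pos hγ hγR'
  obtain ⟨hsk, hsk3⟩ := three_mul_sub_ge hα2 hk hs
  have hδ0 : 0 ≤ δ := by linarith
  have hk0 : (0 : ℝ) < k := by exact_mod_cast (by lia : 0 < k)
  have hcopyZ := hcopy.comp measurable_fst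
  have hcopyC := hcopy.comp
    ((measurable_of_countable fun n : ℕ => (n : ℝ≥0∞)).comp
      (measurable_snd : Measurable fun p : Vec d × ℕ => p.2))
  have hindZ := hZ'ind.comp measurable_fst measurable_id
  have hindC := (hZ'ind.comp measurable_snd measurable_snd).symm
  have hfun : fhat = fun ω => fHat q (thetaBar γ θ₀ s k (fun t => D t ω)) (Q ω) (Z' ω) :=
    funext hfhat
  subst hfun hT hThat
  refine ⟨lintegral_zProg_time_le γ hδ θ₀ hsk hτlaw hNm hNlaw, ?_, ?_⟩
  · refine (lintegral_fHatTime_le γ θ₀ hsk.le hQm hC'm hindC).trans_eq ?_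
    rw [hQlaw]
    congr 2
    exact hcopyC.lintegral_eq
  -- The rate `ξ` is left free because `xiConst` is not positive when `d = 0`.
  have main : ∀ ξ : ℝ, 0 < ξ →
      (∀ u : Vec d, ξ * ‖u‖ ^ 2 ≤ γ * (2 - γ * R ^ 2) * hForm P u u) → ∀ S : ℝ,
      (∀ n, ∑ m ∈ Finset.range n, ((m : ℝ) + 1) ^ δ * Real.exp (-ξ * 2 ^ m) ≤ S) → _ :=
    fun ξ hξ0 hξ S hS => hD.fHat_properties hM hγ hγR' hξ0 hξ hδ0 hq hq1 θ₀ hk hsk hsk3 hτm hτlaw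
      hDτ hNm hNlaw hNind hQm hQlaw hQind hZ'm hcopyZ hindZ hS
  -- In dimension 0 every norm vanishes, so any rate is admissible, and `c = 0` makes both bounds
  -- zero whatever the value of the logarithm.
  by_cases hd : d = 0
  · subst hd
    have hu : ∀ u : Vec 0, ‖u‖ = 0 := fun u => by rw [Subsingleton.elim u 0, norm_zero]
    obtain ⟨L, hL, -⟩ := exists_level_cutoff hδ0 one_pos le_rfl hα hα2
    obtain ⟨h1, h2, h3, h4⟩ := main 1 one_pos
      (fun u => by rw [hu]; simpa using mul_nonneg hκ.le (hForm_self_nonneg u)) _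
      (sum_rpow_mul_exp_le hδ0 one_pos hL)
    refine ⟨h1, h2, h3, h4.trans (le_of_eq ?_)⟩
    simp [cConst, hu]
  · have hξ0 : 0 < xiConst P γ R := mul_pos hκ (lambdaMin_pos hH hd)
    have hξ : ∀ u : Vec d, xiConst P γ R * ‖u‖ ^ 2 ≤ γ * (2 - γ * R ^ 2) * hForm P u u :=
      fun u => by
        rw [xiConst, mul_assoc]
        exact mul_le_mul_of_nonneg_left (lambdaMin_mul_norm_sq_le hM.memLp_x hH u) hκ.le
    obtain ⟨L, hL, hLΛ, hΛ⟩ := exists_level_cutoff hδ0 hξ0 (hM.contraction_le_one hξ hd) hα hα2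
    obtain ⟨h1, h2, h3, h4⟩ := main _ hξ0 hξ _ (sum_rpow_mul_exp_le hδ0 hξ0 hL)
    obtain ⟨hX, hX4⟩ := rpow_log_bounds hδ hΛ
    refine ⟨h1, h2, h3, h4.trans (variance_constant_le ?_ hα hα2 hq hk0 hX (le_trans ?_ hX4))⟩
    · unfold cConst; positivity
    · exact Real.rpow_le_rpow (by positivity) hLΛ (by linarith)
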